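/- For a permutation $\sigma\in S_4$ and a permutation $\pi\in S_n$, let $\#\sigma(\pi)$ be the number of occurrences of the pattern $\sigma$ in $\pi$, that is, of quadruples of positions $1\le i_1<i_2<i_3<i_4\le n$ such that, for all $j,j'$, $\pi(i_j)<\pi(i_{j'})$ if and only if $\sigma(j)<\sigma(j')$. Write $f(n)=\tilde O(g(n))$ if $f(n)=O(g(n)\log^c n)$ for some constant $c$. Theorem. For every $\sigma\in S_4$ there is an algorithm that, given any $n$ and any permutation $\pi\in S_n$ in one-line notation, computes $\#\sigma(\pi)$ in $\tilde O(n^{5/3})$ time and $\tilde O(n)$ space. Here an algorithm is a deterministic program, the same for all $n$, of a random access machine with words of $O(\log n)$ bits. Its instructions are constants, copying, addition, truncated subtraction, multiplication, integer division, indirect load and store, and jumps (unconditional or upon comparison). Time is the number of executed instructions. The space is the size of the initial segment of the memory to which all accessed cells belong, besides finitely many registers. -/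

import Mathlib

open Asymptotics Filter

/-- The number `#σ(π)` of occurrences of the pattern `σ ∈ S_k` in `π ∈ S_n`: the number of
position tuples `i_1 < ... < i_k` such that the entries of `π` at these positions are in the same
relative order as the entries of `σ`. -/
def patternCount {k n : ℕ} (σ : Equiv.Perm (Fin k)) (π : Equiv.Perm (Fin n)) : ℕ :=
  Finset.card {i : Fin k → Fin n |
    (∀ a b, a < b → i a < i b) ∧ ∀ a b, π (i a) < π (i b) ↔ σ a < σ b}

/-- Soft-O: `f(n) = Õ(g(n))` if `f(n) = O(g(n) log^c n)` as `n → ∞` for some constant `c`. -/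
def IsSoftO (f g : ℕ → ℝ) : Prop :=
  ∃ c : ℕ, f =O[atTop] fun n => g n * Real.log n ^ c

/-! ### The word random access machine

A program is a finite list of instructions. It operates on registers (of which it can name only
finitely many) and on a random access memory, whose cells are addressed by register contents.
The machine model is deterministic and every instruction takes one step. -/

namespace WordRAM

/-- Arithmetic instructions; subtraction is truncated at zero, division is integer division (with `x / 0 = 0`). -/
inductive Arith
  | add | sub | mul | div

def Arith.eval : Arith → ℕ → ℕ → ℕ
  | .add, x, y => x + y
  | .sub, x, y => x - y
  | .mul, x, y => x * y
  | .div, x, y => x / y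

/-- The instructions. Below, `R` stands for the registers, and `M` for the memory:
* `const d k`: `R[d] := k`
* `copy d a`: `R[d] := R[a]`
* `arith f d a b`: `R[d] := f R[a] R[b]`
* `load d a`: `R[d] := M[R[a]]`
* `store a b`: `M[R[a]] := R[b]`
* `jump t`: continue with instruction number `t`
* `jumpLt a b t`: if `R[a] < R[b]`, continue with instruction number `t` -/
inductive Instr
  | const (d k : ℕ)
  | copy (d a : ℕ)
  | arith (f : Arith) (d a b : ℕ)
  | load (d a : ℕ)
  | store (a b : ℕ)
  | jump (t : ℕ)
  | jumpLt (a b t : ℕ)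

abbrev Program := List Instr

/-- A configuration of the machine: the program counter, the registers and the memory. -/
structure Config where
  pc : ℕ
  reg : ℕ → ℕ
  mem : ℕ → ℕ

/-- The configuration after the execution of one instruction. -/
def Instr.exec (c : Config) : Instr → Config
  | .const d k => ⟨c.pc + 1, Function.update c.reg d k, c.mem⟩
  | .copy d a => ⟨c.pc + 1, Function.update c.reg d (c.reg a), c.mem⟩
  | .arith f d a b => ⟨c.pc + 1, Function.update c.reg d (f.eval (c.reg a) (c.reg b)), c.mem⟩
  | .load d a => ⟨c.pc + 1, Function.update c.reg d (c.mem (c.reg a)), c.mem⟩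
  | .store a b => ⟨c.pc + 1, c.reg, Function.update c.mem (c.reg a) (c.reg b)⟩
  | .jump t => ⟨t, c.reg, c.mem⟩
  | .jumpLt a b t => ⟨if c.reg a < c.reg b then t else c.pc + 1, c.reg, c.mem⟩

/-- All memory addresses that the instruction accesses are smaller than `S`. -/
def Instr.AddrLt (S : ℕ) (c : Config) : Instr → Prop
  | .load _ a => c.reg a < S
  | .store a _ => c.reg a < S
  | _ => True

/-- All registers and memory cells hold `w`-bit words. -/
def Config.Fits (w : ℕ) (c : Config) : Prop :=
  (∀ i, c.reg i < 2 ^ w) ∧ ∀ i, c.mem i < 2 ^ w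

/-- `P.Runs S w c t c'`: from the configuration `c`, the program `P` reaches `c'` in exactly `t`
steps, where only memory addresses smaller than `S` are accessed, and all registers and memory
cells hold `w`-bit words all along. -/
inductive Program.Runs (P : Program) (S w : ℕ) : Config → ℕ → Config → Prop
  | refl {c : Config} (hc : c.Fits w) : Program.Runs P S w c 0 c
  | step {c c' : Config} {t : ℕ} {I : Instr} (hc : c.Fits w) (hI : P[c.pc]? = some I)
      (ha : I.AddrLt S c) (h : Program.Runs P S w (I.exec c) t c') :
      Program.Runs P S w c (t + 1) c'

/-- The initial configuration on input `π ∈ S_n`: the register `0` holds `n`, the first `n` memory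
cells hold the one-line notation of `π` (with entries in `0, ..., n - 1`), and everything else
is zero. -/
def Config.init {n : ℕ} (π : Equiv.Perm (Fin n)) : Config where
  pc := 0
  reg := Function.update (fun _ => 0) 0 n
  mem := fun i => if h : i < n then (π ⟨i, h⟩ : ℕ) else 0

/-- On input `π`, the program `P` halts (by leaving the list of instructions) within `T` steps
with the number `out` in register `0`, and until then it uses only the first `S` memory cells
and only `w`-bit words. -/
def Program.Outputs (P : Program) {n : ℕ} (π : Equiv.Perm (Fin n)) (T S w : ℕ) (out : ℕ) : Prop :=
  ∃ t ≤ T, ∃ c, P.Runs S w (Config.init π) t c ∧ P[c.pc]? = none ∧ c.reg 0 = out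

/-- The program `P`, which is the same for all `n`, computes the permutation statistic `f` in
time `T(n)` and space `S(n)`, on words of `O(log n)` bits. -/
def Program.Computes (P : Program) (f : ∀ n, Equiv.Perm (Fin n) → ℕ) (T S : ℕ → ℕ) : Prop :=
  ∃ w : ℕ → ℕ, ((fun n => (w n : ℝ)) =O[atTop] fun n : ℕ => Real.log n) ∧
    ∀ (n : ℕ) (π : Equiv.Perm (Fin n)), P.Outputs π (T n) (S n) (w n) (f n π)

end WordRAM

namespace WordRAM

/-! ### A structured language on top of the word RAM

The data are sixteen arrays of length `n` and eight variables, all with entries smaller than a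
modulus `M`. Arithmetic is modulo `M`, and array accesses outside of the bounds have no effect. -/

abbrev Env := Fin 8 → ℕ

abbrev Arrays := Fin 16 → ℕ → ℕ

inductive Expr
  | lit (k : ℕ)
  | var (v : Fin 8)
  | get (k : Fin 16) (e : Expr)
  | add (a b : Expr)
  | sub (a b : Expr)
  | mul (a b : Expr)
  | div (a b : Expr)
  | ite (a b e f : Expr)
  | sum (v : Fin 8) (e b : Expr)

/-- `ite a b e f` is `e` if `a < b` and `f` otherwise; `sum v e b` is the sum of `b` over
`v < e`. -/
def Expr.eval (n M : ℕ) : Expr → Env → Arrays → ℕ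
  | .lit k, _, _ => k % 64
  | .var v, ρ, _ => ρ v
  | .get k e, ρ, m => if e.eval n M ρ m < n then m k (e.eval n M ρ m) else 0
  | .add a b, ρ, m => (a.eval n M ρ m + b.eval n M ρ m) % M
  | .sub a b, ρ, m => (a.eval n M ρ m + (M - b.eval n M ρ m)) % M
  | .mul a b, ρ, m => (a.eval n M ρ m * b.eval n M ρ m) % M
  | .div a b, ρ, m => a.eval n M ρ m / b.eval n M ρ m
  | .ite a b e f, ρ, m =>
    if a.eval n M ρ m < b.eval n M ρ m then e.eval n M ρ m else f.eval n M ρ m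
  | .sum v e b, ρ, m =>
    (∑ i ∈ Finset.range (e.eval n M ρ m), b.eval n M (Function.update ρ v i) m) % M

/-- An upper bound for the number of steps of the evaluation. -/
def Expr.cost (n M : ℕ) : Expr → Env → Arrays → ℕ
  | .lit _, _, _ => 1
  | .var _, _, _ => 1
  | .get _ e, ρ, m => e.cost n M ρ m + 5
  | .add a b, ρ, m => a.cost n M ρ m + b.cost n M ρ m + 4
  | .sub a b, ρ, m => a.cost n M ρ m + b.cost n M ρ m + 5
  | .mul a b, ρ, m => a.cost n M ρ m + b.cost n M ρ m + 4
  | .div a b, ρ, m => a.cost n M ρ m + b.cost n M ρ m + 1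
  | .ite a b e f, ρ, m =>
    a.cost n M ρ m + b.cost n M ρ m + e.cost n M ρ m + f.cost n M ρ m + 2
  | .sum v e b, ρ, m => e.cost n M ρ m +
      ∑ i ∈ Finset.range (e.eval n M ρ m), (b.cost n M (Function.update ρ v i) m + 8) + 7

def Expr.len : Expr → ℕ
  | .lit _ => 1
  | .var _ => 1
  | .get _ e => e.len + 7
  | .add a b => a.len + b.len + 4
  | .sub a b => a.len + b.len + 5
  | .mul a b => a.len + b.len + 4
  | .div a b => a.len + b.len + 1
  | .ite a b e f => a.len + b.len + e.len + f.len + 2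
  | .sum _ e b => e.len + b.len + 14

/-- Replaces the content of register `r` by its residue modulo register `1`. -/
def modCode (r t : ℕ) : List Instr :=
  [.arith .div t r 1, .arith .mul t t 1, .arith .sub r r t]

/-- The code that starts at `pc` and leaves the value of the expression in register `d + 10`,
without changing the registers below. Register `0` holds `n`, register `1` holds `M`, and the
registers `2, ..., 9` hold the variables. -/
def Expr.code : Expr → ℕ → ℕ → List Instr
  | .lit k, d, _ => [.const (d + 10) (k % 64)]
  | .var v, d, _ => [.copy (d + 10) (v + 2)]
  | .get k e, d, pc => e.code d pc ++
      [.jumpLt (d + 10) 0 (pc + e.len + 3), .const (d + 10) 0, .jump (pc + e.len + 7),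
        .const (d + 11) k, .arith .mul (d + 11) (d + 11) 0, .arith .add (d + 10) (d + 10) (d + 11),
        .load (d + 10) (d + 10)]
  | .add a b, d, pc => a.code d pc ++ (b.code (d + 1) (pc + a.len) ++
      (.arith .add (d + 10) (d + 10) (d + 11) :: modCode (d + 10) (d + 11)))
  | .sub a b, d, pc => a.code d pc ++ (b.code (d + 1) (pc + a.len) ++
      (.arith .sub (d + 11) 1 (d + 11) :: .arith .add (d + 10) (d + 10) (d + 11) ::
        modCode (d + 10) (d + 11)))
  | .mul a b, d, pc => a.code d pc ++ (b.code (d + 1) (pc + a.len) ++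
      (.arith .mul (d + 10) (d + 10) (d + 11) :: modCode (d + 10) (d + 11)))
  | .div a b, d, pc => a.code d pc ++ (b.code (d + 1) (pc + a.len) ++
      [.arith .div (d + 10) (d + 10) (d + 11)])
  | .ite a b e f, d, pc => a.code d pc ++ (b.code (d + 1) (pc + a.len) ++
      (.jumpLt (d + 10) (d + 11) (pc + a.len + b.len + f.len + 2) ::
        (f.code d (pc + a.len + b.len + 1) ++
          (.jump (pc + a.len + b.len + f.len + e.len + 2) ::
            e.code d (pc + a.len + b.len + f.len + 2)))))
  | .sum v e b, d, pc => e.code d pc ++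
      ([.copy (d + 11) (v + 2), .const (d + 12) 0, .const (v + 2) 0,
        .jumpLt (v + 2) (d + 10) (pc + e.len + 5), .jump (pc + e.len + b.len + 12)] ++
      (b.code (d + 3) (pc + e.len + 5) ++
      (.arith .add (d + 12) (d + 12) (d + 13) :: (modCode (d + 12) (d + 13) ++
        [.const (d + 13) 1, .arith .add (v + 2) (v + 2) (d + 13), .jump (pc + e.len + 3),
          .copy (v + 2) (d + 11), .copy (d + 10) (d + 12)]))))

theorem Expr.length_code (e : Expr) (d pc : ℕ) : (e.code d pc).length = e.len := by
  induction e generalizing d pc <;> simp [Expr.code, Expr.len, modCode, *] <;> omega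

/-- The program contains the given code at the given position. -/
def CodeAt (P : Program) : ℕ → List Instr → Prop
  | _, [] => True
  | pc, I :: L => P[pc]? = some I ∧ CodeAt P (pc + 1) L

theorem codeAt_append {P : Program} {pc : ℕ} {L L' : List Instr} :
    CodeAt P pc (L ++ L') ↔ CodeAt P pc L ∧ CodeAt P (pc + L.length) L' := by
  induction L generalizing pc with
  | nil => simp [CodeAt]
  | cons I L ih => simp [CodeAt, ih, and_assoc, Nat.add_assoc, Nat.add_comm 1]

theorem codeAt_of_append (L₁ L L₂ : List Instr) : CodeAt (L₁ ++ L ++ L₂) L₁.length L := by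
  induction L generalizing L₁ with
  | nil => trivial
  | cons I L ih =>
    refine ⟨by simp, ?_⟩
    simpa using ih (L₁ ++ [I])

theorem Program.Runs.fits {P : Program} {S w t : ℕ} {c c' : Config} (h : P.Runs S w c t c') :
    c'.Fits w := by
  induction h with
  | refl hc => exact hc
  | step _ _ _ _ ih => exact ih

theorem Program.Runs.trans {P : Program} {S w t t' : ℕ} {c c' c'' : Config}
    (h : P.Runs S w c t c') (h' : P.Runs S w c' t' c'') : P.Runs S w c (t + t') c'' := by
  induction h with
  | refl => simpa using h'
  | step hc hI ha _ ih =>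
    rw [Nat.add_right_comm]
    exact .step hc hI ha (ih h')

/-- Reachability within a number of steps. -/
def Program.Reaches (P : Program) (S w : ℕ) (c : Config) (t : ℕ) (c' : Config) : Prop :=
  ∃ t' ≤ t, P.Runs S w c t' c'

section Reaches

variable {P : Program} {S w t t' : ℕ} {c c' c'' : Config} {pc : ℕ} {R mem : ℕ → ℕ}

theorem Program.Reaches.refl (hc : c.Fits w) : P.Reaches S w c 0 c := ⟨0, le_rfl, .refl hc⟩

theorem Program.Reaches.fits (h : P.Reaches S w c t c') : c'.Fits w :=
  let ⟨_, _, h⟩ := h; h.fits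

theorem Program.Reaches.trans (h : P.Reaches S w c t c') (h' : P.Reaches S w c' t' c'') :
    P.Reaches S w c (t + t') c'' :=
  let ⟨_, hs, h⟩ := h
  let ⟨_, hs', h'⟩ := h'
  ⟨_, add_le_add hs hs', h.trans h'⟩

theorem Program.Reaches.mono (h : P.Reaches S w c t c') (ht : t ≤ t') : P.Reaches S w c t' c' :=
  let ⟨_, hs, h⟩ := h; ⟨_, hs.trans ht, h⟩

theorem Program.Reaches.cast {pc' : ℕ} (h : P.Reaches S w c t ⟨pc, R, mem⟩) (hpc : pc = pc')
    (ht : t ≤ t') : P.Reaches S w c t' ⟨pc', R, mem⟩ :=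
  hpc ▸ h.mono ht

theorem Program.Reaches.step {I : Instr} (hc : c.Fits w) (hI : P[c.pc]? = some I)
    (ha : I.AddrLt S c) (h : P.Reaches S w (I.exec c) t c') : P.Reaches S w c (t + 1) c' :=
  let ⟨_, hs, h⟩ := h; ⟨_, Nat.succ_le_succ hs, .step hc hI ha h⟩

theorem Config.Fits.update {d x : ℕ} {pc' : ℕ} (hc : Config.Fits w ⟨pc, R, mem⟩) (hx : x < 2 ^ w) :
    Config.Fits w ⟨pc', Function.update R d x, mem⟩ := by
  refine ⟨fun i => ?_, hc.2⟩
  by_cases h : i = d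
  · simpa [h] using hx
  · simpa [h] using hc.1 i

theorem reaches_const {d k : ℕ} (hI : P[pc]? = some (.const d k))
    (hc : Config.Fits w ⟨pc, R, mem⟩) (hk : k < 2 ^ w) :
    P.Reaches S w ⟨pc, R, mem⟩ 1 ⟨pc + 1, Function.update R d k, mem⟩ :=
  .step hc hI trivial (.refl (hc.update hk))

theorem reaches_copy {d a : ℕ} (hI : P[pc]? = some (.copy d a))
    (hc : Config.Fits w ⟨pc, R, mem⟩) :
    P.Reaches S w ⟨pc, R, mem⟩ 1 ⟨pc + 1, Function.update R d (R a), mem⟩ :=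
  .step hc hI trivial (.refl (hc.update (hc.1 a)))

theorem reaches_arith {f : Arith} {d a b : ℕ} (hI : P[pc]? = some (.arith f d a b))
    (hc : Config.Fits w ⟨pc, R, mem⟩) (hk : f.eval (R a) (R b) < 2 ^ w) :
    P.Reaches S w ⟨pc, R, mem⟩ 1 ⟨pc + 1, Function.update R d (f.eval (R a) (R b)), mem⟩ :=
  .step hc hI trivial (.refl (hc.update hk))

theorem reaches_arith_eq {f : Arith} {d a b x : ℕ} (hI : P[pc]? = some (.arith f d a b))
    (hc : Config.Fits w ⟨pc, R, mem⟩) (hx : f.eval (R a) (R b) = x) (hk : x < 2 ^ w) :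
    P.Reaches S w ⟨pc, R, mem⟩ 1 ⟨pc + 1, Function.update R d x, mem⟩ :=
  hx ▸ reaches_arith hI hc (hx ▸ hk)

theorem reaches_load {d a : ℕ} (hI : P[pc]? = some (.load d a))
    (hc : Config.Fits w ⟨pc, R, mem⟩) (hk : R a < S) :
    P.Reaches S w ⟨pc, R, mem⟩ 1 ⟨pc + 1, Function.update R d (mem (R a)), mem⟩ :=
  .step hc hI hk (.refl (hc.update (hc.2 _)))

theorem reaches_store {a b : ℕ} (hI : P[pc]? = some (.store a b))
    (hc : Config.Fits w ⟨pc, R, mem⟩) (hk : R a < S) :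
    P.Reaches S w ⟨pc, R, mem⟩ 1 ⟨pc + 1, R, Function.update mem (R a) (R b)⟩ := by
  refine .step hc hI hk (.refl ⟨hc.1, fun i => ?_⟩)
  by_cases h : i = R a
  · simpa [Instr.exec, h] using hc.1 b
  · simpa [Instr.exec, h] using hc.2 i

theorem reaches_jump {q : ℕ} (hI : P[pc]? = some (.jump q)) (hc : Config.Fits w ⟨pc, R, mem⟩) :
    P.Reaches S w ⟨pc, R, mem⟩ 1 ⟨q, R, mem⟩ :=
  .step hc hI trivial (.refl hc)

theorem reaches_jumpLt {a b q : ℕ} (hI : P[pc]? = some (.jumpLt a b q))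
    (hc : Config.Fits w ⟨pc, R, mem⟩) :
    P.Reaches S w ⟨pc, R, mem⟩ 1 ⟨if R a < R b then q else pc + 1, R, mem⟩ :=
  .step hc hI trivial (.refl hc)

theorem reaches_modCode {M r u : ℕ} (h : CodeAt P pc (modCode r u)) (hM : R 1 = M) (hu : u ≠ 1)
    (hr : r ≠ u) (hc : Config.Fits w ⟨pc, R, mem⟩) :
    ∃ R', P.Reaches S w ⟨pc, R, mem⟩ 3 ⟨pc + 3, R', mem⟩ ∧ R' r = R r % M ∧
      ∀ i, i ≠ r → i ≠ u → R' i = R i := by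
  obtain ⟨h1, h2, h3, -⟩ := h
  have hr' := hc.1 r
  have a1 := reaches_arith (S := S) h1 hc ((Nat.div_le_self _ _).trans_lt hr')
  have a2 := reaches_arith (S := S) h2 a1.fits (by
    simp only [Arith.eval, Function.update_self, Function.update_of_ne hu.symm]
    exact (Nat.div_mul_le_self _ _).trans_lt hr')
  have a3 := reaches_arith (S := S) h3 a2.fits (by
    simp only [Arith.eval, Function.update_self, Function.update_of_ne hr]
    exact (Nat.sub_le _ _).trans_lt hr')
  refine ⟨_, (a1.trans a2).trans a3, ?_, fun i hi hi' => ?_⟩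
  · simp only [Arith.eval, Function.update_self, Function.update_of_ne hr,
      Function.update_of_ne hu.symm, hM]
    rw [Nat.mod_eq_sub_div_mul]
  · simp [hi, hi']

/-- A loop that counts register `v` up to the content of register `b`. -/
theorem reaches_loop {L q v b N : ℕ} {τ : ℕ → ℕ} {I : ℕ → (ℕ → ℕ) → (ℕ → ℕ) → Prop}
    (h1 : P[L]? = some (.jumpLt v b (L + 2))) (h2 : P[L + 1]? = some (.jump q))
    (hI : ∀ i R mem, I i R mem → R v = i ∧ R b = N)
    (hs : ∀ i < N, ∀ R mem, I i R mem → Config.Fits w ⟨L + 2, R, mem⟩ →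
      ∃ R' mem', P.Reaches S w ⟨L + 2, R, mem⟩ (τ i) ⟨L, R', mem'⟩ ∧ I (i + 1) R' mem')
    (h0 : I 0 R mem) (hc : Config.Fits w ⟨L, R, mem⟩) :
    ∃ R' mem', P.Reaches S w ⟨L, R, mem⟩ (∑ i ∈ Finset.range N, (τ i + 1) + 2) ⟨q, R', mem'⟩ ∧
      I N R' mem' := by
  have key : ∀ i ≤ N, ∃ R' mem', P.Reaches S w ⟨L, R, mem⟩ (∑ j ∈ Finset.range i, (τ j + 1))
      ⟨L, R', mem'⟩ ∧ I i R' mem' := by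
    intro i
    induction i with
    | zero => exact fun _ => ⟨R, mem, .refl hc, h0⟩
    | succ i ih =>
      intro hi
      obtain ⟨R₁, mem₁, a1, hI₁⟩ := ih (by omega)
      obtain ⟨hv, hb⟩ := hI _ _ _ hI₁
      have a2 := reaches_jumpLt (S := S) h1 a1.fits
      rw [hv, hb, if_pos (by omega)] at a2
      obtain ⟨R₂, mem₂, a3, hI₂⟩ := hs i (by omega) _ _ hI₁ a2.fits
      exact ⟨R₂, mem₂, (a1.trans (a2.trans a3)).mono (by rw [Finset.sum_range_succ]; omega), hI₂⟩
  obtain ⟨R₁, mem₁, a1, hI₁⟩ := key N le_rfl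
  obtain ⟨hv, hb⟩ := hI _ _ _ hI₁
  have a2 := reaches_jumpLt (S := S) h1 a1.fits
  rw [hv, hb, if_neg (by omega)] at a2
  exact ⟨R₁, mem₁, a1.trans (a2.trans (reaches_jump h2 a2.fits)), hI₁⟩

end Reaches

/-- The bounds under which words of `w` bits are long enough. -/
structure Bounds (n M w : ℕ) : Prop where
  le_modulus : 64 ≤ M
  size_le : 17 * n ≤ M
  sq_lt : M * M < 2 ^ w

theorem Bounds.lt {n M w : ℕ} (h : Bounds n M w) : M < 2 ^ w :=
  (Nat.le_mul_self M).trans_lt h.sq_lt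

theorem Bounds.add_lt {n M w x y : ℕ} (h : Bounds n M w) (hx : x ≤ M) (hy : y ≤ M) :
    x + y < 2 ^ w := by
  have := h.sq_lt
  have := h.le_modulus
  nlinarith

theorem Bounds.mul_lt {n M w x y : ℕ} (h : Bounds n M w) (hx : x ≤ M) (hy : y ≤ M) :
    x * y < 2 ^ w :=
  (Nat.mul_le_mul hx hy).trans_lt h.sq_lt

/-- All variables and all array entries are smaller than the modulus. -/
def Valid (n M : ℕ) (ρ : Env) (m : Arrays) : Prop :=
  (∀ v, ρ v < M) ∧ ∀ k, ∀ i < n, m k i < M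

theorem Valid.update {n M : ℕ} {ρ : Env} {m : Arrays} (h : Valid n M ρ m) (v : Fin 8) {x : ℕ}
    (hx : x < M) : Valid n M (Function.update ρ v x) m := by
  refine ⟨fun u => ?_, h.2⟩
  by_cases hu : u = v
  · simpa [hu] using hx
  · simpa [hu] using h.1 u

theorem Expr.eval_lt {n M w : ℕ} (hB : Bounds n M w) (e : Expr) {ρ : Env} {m : Arrays}
    (h : Valid n M ρ m) : e.eval n M ρ m < M := by
  have hM := hB.le_modulus
  have hM0 : 0 < M := by omega
  induction e with
  | lit k => exact (Nat.mod_lt _ (by norm_num)).trans_le hM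
  | var v => exact h.1 v
  | get k e ih =>
    simp only [Expr.eval]
    split_ifs with hi
    · exact h.2 _ _ hi
    · exact hM0
  | div a b iha ihb => exact (Nat.div_le_self _ _).trans_lt iha
  | ite a b e f iha ihb ihe ihf =>
    simp only [Expr.eval]
    split_ifs
    · exact ihe
    · exact ihf
  | _ => exact Nat.mod_lt _ hM0

/-- The machine represents the given variables and arrays. -/
structure Represents (n M : ℕ) (ρ : Env) (m : Arrays) (R mem : ℕ → ℕ) : Prop where
  reg_zero : R 0 = n
  reg_one : R 1 = M
  reg_var : ∀ v : Fin 8, R (v + 2) = ρ v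
  mem_eq : ∀ k : Fin 16, ∀ i < n, mem (k * n + i) = m k i

theorem Represents.congr {n M d : ℕ} {ρ : Env} {m : Arrays} {R R' mem : ℕ → ℕ}
    (h : Represents n M ρ m R mem) (hR : ∀ r < d + 10, R' r = R r) :
    Represents n M ρ m R' mem where
  reg_zero := by rw [hR _ (by omega), h.reg_zero]
  reg_one := by rw [hR _ (by omega), h.reg_one]
  reg_var v := by rw [hR _ (by omega), h.reg_var]
  mem_eq := h.mem_eq

/-- From the position `pc`, the machine reaches the position `pc'` with the value `x` in
register `d + 10`, the registers below being unchanged. -/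
def Delivers (P : Program) (S w pc : ℕ) (R mem : ℕ → ℕ) (t pc' d x : ℕ) : Prop :=
  ∃ R', P.Reaches S w ⟨pc, R, mem⟩ t ⟨pc', R', mem⟩ ∧ R' (d + 10) = x ∧
    ∀ r < d + 10, R' r = R r

section Compile

variable {P : Program} {n M w : ℕ}

/-- The code of a binary operation, given the code of the operands. -/
theorem delivers_binary {pc pc₁ pc₂ t₁ t₂ d x y : ℕ} {R mem : ℕ → ℕ}
    (ha : Delivers P (16 * n) w pc R mem t₁ pc₁ d x)
    (hb : ∀ R', (∀ r < d + 10, R' r = R r) → Config.Fits w ⟨pc₁, R', mem⟩ →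
      Delivers P (16 * n) w pc₁ R' mem t₂ pc₂ (d + 1) y) :
    ∃ R', P.Reaches (16 * n) w ⟨pc, R, mem⟩ (t₁ + t₂) ⟨pc₂, R', mem⟩ ∧ R' (d + 10) = x ∧
      R' (d + 11) = y ∧ ∀ r < d + 10, R' r = R r := by
  obtain ⟨R₁, h₁, hx, hR₁⟩ := ha
  obtain ⟨R₂, h₂, hy, hR₂⟩ := hb R₁ hR₁ h₁.fits
  exact ⟨R₂, h₁.trans h₂, by rw [hR₂ _ (by omega), hx], hy,
    fun r hr => by rw [hR₂ _ (by omega), hR₁ _ hr]⟩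

theorem delivers_arith_mod {pc d x : ℕ} {R mem : ℕ → ℕ} {f : Arith}
    (h : CodeAt P pc (.arith f (d + 10) (d + 10) (d + 11) :: modCode (d + 10) (d + 11)))
    (hM : R 1 = M) (hc : Config.Fits w ⟨pc, R, mem⟩) (hx : f.eval (R (d + 10)) (R (d + 11)) = x)
    (hxw : x < 2 ^ w) : Delivers P (16 * n) w pc R mem 4 (pc + 4) d (x % M) := by
  have a1 := reaches_arith (S := 16 * n) h.1 hc (by rwa [hx])
  obtain ⟨R', a2, h1, h2⟩ := reaches_modCode (S := 16 * n) (M := M) h.2 (by simpa using hM)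
    (by omega) (by omega) a1.fits
  refine ⟨R', a1.trans a2, by simpa [hx] using h1, fun r hr => ?_⟩
  rw [h2 r (by omega) (by omega), Function.update_of_ne (by omega)]

theorem Expr.delivers (hB : Bounds n M w) (e : Expr) {d pc : ℕ} {ρ : Env} {m : Arrays}
    {R mem : ℕ → ℕ} (hP : CodeAt P pc (e.code d pc)) (hV : Valid n M ρ m)
    (hR : Represents n M ρ m R mem) (hc : Config.Fits w ⟨pc, R, mem⟩) :
    Delivers P (16 * n) w pc R mem (e.cost n M ρ m) (pc + e.len) d (e.eval n M ρ m) := by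
  have hM := hB.le_modulus
  have hn := hB.size_le
  have hMw := hB.lt
  induction e generalizing d pc ρ R with
  | lit k =>
    refine ⟨_, reaches_const hP.1 hc ?_, by simp [Expr.eval], fun r hr => by simp [hr.ne]⟩
    have := Nat.mod_lt k (show 0 < 64 by norm_num)
    omega
  | var v =>
    exact ⟨_, reaches_copy hP.1 hc, by simp [Expr.eval, hR.reg_var], fun r hr => by simp [hr.ne]⟩
  | get k e ih =>
    simp only [Expr.code, codeAt_append, Expr.length_code] at hP
    obtain ⟨R₁, a1, hx, hR₁⟩ := ih hP.1 hV hR hc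
    obtain ⟨h1, h2, h3, h4, h5, h6, h7, -⟩ := hP.2
    have b1 := reaches_jumpLt (S := 16 * n) h1 a1.fits
    have hxM := e.eval_lt hB hV
    have hR1 := hR.congr hR₁
    rw [hx, hR1.reg_zero] at b1
    simp only [Expr.eval, Expr.cost, Expr.len]
    by_cases hi : e.eval n M ρ m < n
    · rw [if_pos hi] at b1 ⊢
      have b2 := reaches_const (S := 16 * n) h4 b1.fits (by omega)
      have b3 := reaches_arith (S := 16 * n) h5 b2.fits (by
        simp only [Arith.eval, Function.update_self]
        rw [Function.update_of_ne (by omega), hR1.reg_zero]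
        exact hB.mul_lt (by omega) (by omega))
      have e3 : (k : ℕ) * n ≤ 15 * n := Nat.mul_le_mul_right n (by omega)
      have b4 := reaches_arith (S := 16 * n) h6 b3.fits (by
        simp only [Arith.eval, Function.update_self]
        rw [Function.update_of_ne (by omega), Function.update_of_ne (by omega),
          Function.update_of_ne (by omega), hR1.reg_zero, hx]
        omega)
      have e4 : (Function.update (Function.update (Function.update R₁ (d + 11) k) (d + 11)
          (Arith.mul.eval (Function.update R₁ (d + 11) (k : ℕ) (d + 11))
            (Function.update R₁ (d + 11) (k : ℕ) 0))) (d + 10)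
          (Arith.add.eval (Function.update (Function.update R₁ (d + 11) k) (d + 11)
            (Arith.mul.eval (Function.update R₁ (d + 11) (k : ℕ) (d + 11))
              (Function.update R₁ (d + 11) (k : ℕ) 0)) (d + 10))
            (Function.update (Function.update R₁ (d + 11) k) (d + 11)
              (Arith.mul.eval (Function.update R₁ (d + 11) (k : ℕ) (d + 11))
                (Function.update R₁ (d + 11) (k : ℕ) 0)) (d + 11)))) (d + 10) =
          k * n + e.eval n M ρ m := by
        simp [Arith.eval, hx, hR1.reg_zero, Nat.add_comm]
      have b5 := reaches_load (S := 16 * n) h7 b4.fits (by rw [e4]; omega)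
      refine ⟨_, ((a1.trans (b1.trans (b2.trans (b3.trans (b4.trans b5))))).mono (by omega)),
        ?_, ?_⟩
      · rw [Function.update_self, e4, hR.mem_eq _ _ hi]
      · intro r hr
        rw [Function.update_of_ne (by omega), Function.update_of_ne (by omega),
          Function.update_of_ne (by omega), Function.update_of_ne (by omega), hR₁ r hr]
    · rw [if_neg hi] at b1 ⊢
      have b2 := reaches_const (S := 16 * n) h2 b1.fits (by omega)
      have b3 := reaches_jump (S := 16 * n) h3 b2.fits
      refine ⟨_, ((a1.trans (b1.trans (b2.trans b3))).mono (by omega)), by simp, ?_⟩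
      intro r hr
      rw [Function.update_of_ne (by omega), hR₁ r hr]
  | add a b iha ihb =>
    simp only [Expr.code, codeAt_append, Expr.length_code] at hP
    obtain ⟨R₂, h, hx, hy, hR₂⟩ := delivers_binary (iha hP.1 hV hR hc)
      fun R' hR' hc' => ihb hP.2.1 hV (hR.congr hR') hc'
    have h1 := a.eval_lt hB hV
    have h2 := b.eval_lt hB hV
    obtain ⟨R₃, h', hx', hR₃⟩ := delivers_arith_mod (n := n) hP.2.2 (hR.congr hR₂).reg_one h.fits
      (by rw [hx, hy]; rfl) (hB.add_lt h1.le h2.le)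
    exact ⟨R₃, (h.trans h').cast (by simp only [Expr.len]; omega) le_rfl, hx',
      fun r hr => by rw [hR₃ r hr, hR₂ r hr]⟩
  | sub a b iha ihb =>
    simp only [Expr.code, codeAt_append, Expr.length_code] at hP
    obtain ⟨R₂, h, hx, hy, hR₂⟩ := delivers_binary (iha hP.1 hV hR hc)
      fun R' hR' hc' => ihb hP.2.1 hV (hR.congr hR') hc'
    have h1 := a.eval_lt hB hV
    have hR1 := (hR.congr hR₂).reg_one
    have h2 := reaches_arith (S := 16 * n) hP.2.2.1 h.fits (by
      simp only [Arith.eval, hR1]; omega)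
    obtain ⟨R₃, h', hx', hR₃⟩ := delivers_arith_mod (n := n) (M := M) hP.2.2.2
      (by simpa using hR1) h2.fits (x := a.eval n M ρ m + (M - b.eval n M ρ m))
      (by simp [Arith.eval, hR1, hx, hy]) (hB.add_lt h1.le (Nat.sub_le _ _))
    refine ⟨R₃, (h.trans (h2.trans h')).cast (by simp only [Expr.len]; omega)
      (by simp only [Expr.cost]; omega), hx', ?_⟩
    intro r hr
    rw [hR₃ r hr, Function.update_of_ne (by omega), hR₂ r hr]
  | mul a b iha ihb =>
    simp only [Expr.code, codeAt_append, Expr.length_code] at hP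
    obtain ⟨R₂, h, hx, hy, hR₂⟩ := delivers_binary (iha hP.1 hV hR hc)
      fun R' hR' hc' => ihb hP.2.1 hV (hR.congr hR') hc'
    have h1 := a.eval_lt hB hV
    have h2 := b.eval_lt hB hV
    obtain ⟨R₃, h', hx', hR₃⟩ := delivers_arith_mod (n := n) hP.2.2 (hR.congr hR₂).reg_one h.fits
      (by rw [hx, hy]; rfl) (hB.mul_lt h1.le h2.le)
    exact ⟨R₃, (h.trans h').cast (by simp only [Expr.len]; omega) le_rfl, hx',
      fun r hr => by rw [hR₃ r hr, hR₂ r hr]⟩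
  | div a b iha ihb =>
    simp only [Expr.code, codeAt_append, Expr.length_code] at hP
    obtain ⟨R₂, h, hx, hy, hR₂⟩ := delivers_binary (iha hP.1 hV hR hc)
      fun R' hR' hc' => ihb hP.2.1 hV (hR.congr hR') hc'
    have h1 := a.eval_lt hB hV
    have h2 := reaches_arith (S := 16 * n) hP.2.2.1 h.fits (by
      simp only [Arith.eval, hx]; exact ((Nat.div_le_self _ _).trans_lt h1).trans hMw)
    exact ⟨_, (h.trans h2).cast (by simp only [Expr.len]; omega) le_rfl,
      by simp [Arith.eval, hx, hy, Expr.eval],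
      fun r hr => by rw [Function.update_of_ne (by omega), hR₂ r hr]⟩
  | ite a b e f iha ihb ihe ihf =>
    simp only [Expr.code, codeAt_append, Expr.length_code, CodeAt] at hP
    obtain ⟨hPa, hPb, hj, hPf, hj', hPe⟩ := hP
    obtain ⟨R₂, h, hx, hy, hR₂⟩ := delivers_binary (iha hPa hV hR hc)
      fun R' hR' hc' => ihb hPb hV (hR.congr hR') hc'
    have h1 := reaches_jumpLt (S := 16 * n) hj h.fits
    rw [hx, hy] at h1
    simp only [Expr.eval, Expr.cost, Expr.len]
    by_cases hi : a.eval n M ρ m < b.eval n M ρ m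
    · rw [if_pos hi] at h1 ⊢
      rw [show pc + a.len + b.len + 1 + f.len + 1 = pc + a.len + b.len + f.len + 2 by omega] at hPe
      obtain ⟨R₃, h', hx', hR₃⟩ := ihe hPe hV (hR.congr hR₂) h1.fits
      rw [show pc + (a.len + b.len + e.len + f.len + 2) =
        pc + a.len + b.len + f.len + 2 + e.len by omega]
      exact ⟨R₃, (h.trans (h1.trans h')).mono (by omega), hx',
        fun r hr => by rw [hR₃ r hr, hR₂ r hr]⟩
    · rw [if_neg hi] at h1 ⊢
      obtain ⟨R₃, h', hx', hR₃⟩ := ihf hPf hV (hR.congr hR₂) h1.fits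
      have h3 := reaches_jump (S := 16 * n) hj' h'.fits
      rw [show pc + (a.len + b.len + e.len + f.len + 2) =
        pc + a.len + b.len + f.len + e.len + 2 by omega]
      exact ⟨R₃, (h.trans (h1.trans (h'.trans h3))).mono (by omega), hx',
        fun r hr => by rw [hR₃ r hr, hR₂ r hr]⟩
  | sum v e b ihe ihb =>
    simp only [Expr.code, codeAt_append, Expr.length_code, CodeAt, List.length_cons,
      List.length_nil] at hP
    obtain ⟨hPe, ⟨p1, p2, p3, p4, p5, -⟩, hPb, p6, hPm, p7, p8, p9, p10, p11, -⟩ := hP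
    have lm : (modCode (d + 12) (d + 13)).length = 3 := rfl
    rw [lm] at p7 p8 p9 p10 p11
    have hv : (v : ℕ) + 2 < 10 := by omega
    obtain ⟨R₁, a1, hx, hR₁⟩ := ihe hPe hV hR hc
    have hR1 := hR.congr hR₁
    have a2 := reaches_copy (S := 16 * n) p1 a1.fits
    have a3 := reaches_const (S := 16 * n) p2 a2.fits (by positivity)
    have a4 := reaches_const (S := 16 * n) p3 a3.fits (by positivity)
    set N := e.eval n M ρ m with hN
    have hNM : N < M := e.eval_lt hB hV
    obtain ⟨R₂, mem₂, a5, ⟨h5, h6, h7, h8, h9⟩, rfl⟩ := reaches_loop (S := 16 * n) (N := N)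
      (τ := fun i => b.cost n M (Function.update ρ v i) m + 7)
      (I := fun i R' mem' => (R' (v + 2) = i ∧ R' (d + 10) = N ∧ R' (d + 11) = ρ v ∧
        R' (d + 12) = (∑ j ∈ Finset.range i, b.eval n M (Function.update ρ v j) m) % M ∧
        ∀ r < d + 10, r ≠ v + 2 → R' r = R r) ∧ mem' = mem)
      p4 p5 (fun i R' mem' h => ⟨h.1.1, h.1.2.1⟩) (by
        rintro i hi R' mem' ⟨⟨h1, h2, h3, h4, h5⟩, rfl⟩ hc'
        have hRi : Represents n M (Function.update ρ v i) m R' mem' := by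
          refine ⟨?_, ?_, fun u => ?_, hR.mem_eq⟩
          · rw [h5 _ (by omega) (by omega), hR.reg_zero]
          · rw [h5 _ (by omega) (by omega), hR.reg_one]
          · by_cases hu : u = v
            · simp [hu, h1]
            · rw [Function.update_of_ne hu, h5 _ (by omega) (by omega), hR.reg_var]
        have hVi := hV.update v (hi.trans hNM)
        obtain ⟨R₃, b1, hx3, hR₃⟩ := ihb hPb hVi hRi hc'
        have hb := b.eval_lt hB hVi
        have hM0 : 0 < M := by omega
        have hs := Nat.mod_lt (∑ j ∈ Finset.range i, b.eval n M (Function.update ρ v j) m) hM0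
        have e12 : R₃ (d + 12) = R' (d + 12) := hR₃ _ (by omega)
        have b2 := reaches_arith (S := 16 * n) p6 b1.fits (by
          simp only [Arith.eval, hx3, e12, h4]
          exact hB.add_lt hs.le hb.le)
        obtain ⟨R₄, b3, hx4, hR₄⟩ := reaches_modCode (S := 16 * n) (M := M) hPm (by
          rw [Function.update_of_ne (by omega), hR₃ _ (by omega), hRi.reg_one]) (by omega)
          (by omega) b2.fits
        have hR4 : ∀ r < d + 12, R₄ r = R' r := fun r hr => by
          rw [hR₄ _ (by omega) (by omega), Function.update_of_ne (by omega), hR₃ _ (by omega)]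
        have b4 := reaches_const (S := 16 * n) p7 b3.fits (show 1 < 2 ^ w by omega)
        have b5 := reaches_arith (S := 16 * n) p8 b4.fits (by
          simp only [Arith.eval, Function.update_self]
          rw [Function.update_of_ne (by omega), hR4 _ (by omega), h1]
          omega)
        have b6 := reaches_jump (S := 16 * n) p9 b5.fits
        refine ⟨_, _, (b1.trans (b2.trans (b3.trans (b4.trans (b5.trans b6))))).mono le_rfl,
          ⟨?_, ?_, ?_, ?_, ?_⟩, rfl⟩
        · simp only [Arith.eval, Function.update_self]
          rw [Function.update_of_ne (by omega), hR4 _ (by omega), h1]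
        · rw [Function.update_of_ne (by omega), Function.update_of_ne (by omega),
            hR4 _ (by omega), h2]
        · rw [Function.update_of_ne (by omega), Function.update_of_ne (by omega),
            hR4 _ (by omega), h3]
        · rw [Function.update_of_ne (by omega), Function.update_of_ne (by omega), hx4,
            Finset.sum_range_succ]
          simp only [Arith.eval, Function.update_self, hx3, e12, h4]
          rw [Nat.mod_add_mod]
        · intro r hr hr'
          rw [Function.update_of_ne (by omega), Function.update_of_ne (by omega),
            hR4 _ (by omega), h5 _ hr hr'])
      ⟨⟨by simp, by
        rw [Function.update_of_ne (by omega), Function.update_of_ne (by omega),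
          Function.update_of_ne (by omega), hx], by
        rw [Function.update_of_ne (by omega), Function.update_of_ne (by omega),
          Function.update_self, hR1.reg_var], by
        rw [Function.update_of_ne (by omega), Function.update_self]; simp, fun r hr hr' => by
        rw [Function.update_of_ne (by omega), Function.update_of_ne (by omega),
          Function.update_of_ne (by omega), hR₁ _ hr]⟩, rfl⟩ a4.fits
    rw [show pc + e.len + 1 + 1 + 1 + 1 + 1 + b.len + 1 + 3 + 1 + 1 + 1 =
      pc + e.len + b.len + 12 - 1 + 1 by omega] at p10 p11
    have a6 := reaches_copy (S := 16 * n) p10 a5.fits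
    have a7 := reaches_copy (S := 16 * n) p11 a6.fits
    refine ⟨_, (a1.trans (a2.trans (a3.trans (a4.trans (a5.trans (a6.trans a7)))))).cast
      (by simp only [Expr.len]; omega)
      (by simp only [Expr.cost, ← hN, add_assoc, Nat.reduceAdd]; omega), ?_, ?_⟩
    · rw [Function.update_self, Function.update_of_ne (by omega), h8]
      rfl
    · intro r hr
      rw [Function.update_of_ne (by omega)]
      by_cases hrv : r = v + 2
      · rw [hrv, Function.update_self, h7, hR.reg_var]
      · rw [Function.update_of_ne hrv, h9 _ hr hrv]

end Compile

inductive Stmt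
  | store (k : Fin 16) (i e : Expr)
  | seq (s s' : Stmt)
  | loop (v : Fin 8) (e : Expr) (s : Stmt)
  | letv (v : Fin 8) (e : Expr) (s : Stmt)

/-- The arrays after the execution of a statement. -/
def Stmt.eval (n M : ℕ) : Stmt → Env → Arrays → Arrays
  | .store k i e, ρ, m => if i.eval n M ρ m < n then
      Function.update m k (Function.update (m k) (i.eval n M ρ m) (e.eval n M ρ m)) else m
  | .seq s s', ρ, m => s'.eval n M ρ (s.eval n M ρ m)
  | .loop v e s, ρ, m => (List.range (e.eval n M ρ m)).foldl
      (fun m i => s.eval n M (Function.update ρ v i) m) m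
  | .letv v e s, ρ, m => s.eval n M (Function.update ρ v (e.eval n M ρ m)) m

/-- An upper bound for the number of steps of the execution. -/
def Stmt.cost (n M : ℕ) : Stmt → Env → Arrays → ℕ
  | .store _ i e, ρ, m => i.cost n M ρ m + e.cost n M ρ m + 6
  | .seq s s', ρ, m => s.cost n M ρ m + s'.cost n M ρ (s.eval n M ρ m)
  | .loop v e s, ρ, m => e.cost n M ρ m + ∑ i ∈ Finset.range (e.eval n M ρ m),
      (s.cost n M (Function.update ρ v i) ((List.range i).foldl
        (fun m i => s.eval n M (Function.update ρ v i) m) m) + 4) + 5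
  | .letv v e s, ρ, m =>
      e.cost n M ρ m + s.cost n M (Function.update ρ v (e.eval n M ρ m)) m + 3

def Stmt.len : Stmt → ℕ
  | .store _ i e => i.len + e.len + 6
  | .seq s s' => s.len + s'.len
  | .loop _ e s => e.len + s.len + 8
  | .letv _ e s => e.len + s.len + 3

/-- The code of a statement that starts at `pc` and does not change the registers below
`d + 10`. -/
def Stmt.code : Stmt → ℕ → ℕ → List Instr
  | .store k i e, d, pc => i.code d pc ++ (e.code (d + 1) (pc + i.len) ++
      [.jumpLt (d + 10) 0 (pc + i.len + e.len + 2), .jump (pc + i.len + e.len + 6),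
        .const (d + 12) k, .arith .mul (d + 12) (d + 12) 0, .arith .add (d + 10) (d + 10) (d + 12),
        .store (d + 10) (d + 11)])
  | .seq s s', d, pc => s.code d pc ++ s'.code d (pc + s.len)
  | .loop v e s, d, pc => e.code d pc ++
      ([.copy (d + 11) (v + 2), .const (v + 2) 0,
        .jumpLt (v + 2) (d + 10) (pc + e.len + 4), .jump (pc + e.len + s.len + 7)] ++
      (s.code (d + 2) (pc + e.len + 4) ++
        [.const (d + 12) 1, .arith .add (v + 2) (v + 2) (d + 12), .jump (pc + e.len + 2),
          .copy (v + 2) (d + 11)]))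
  | .letv v e s, d, pc => e.code d pc ++
      ([.copy (d + 11) (v + 2), .copy (v + 2) (d + 10)] ++
      (s.code (d + 2) (pc + e.len + 2) ++ [.copy (v + 2) (d + 11)]))

theorem Stmt.length_code (s : Stmt) (d pc : ℕ) : (s.code d pc).length = s.len := by
  induction s generalizing d pc <;>
    simp [Stmt.code, Stmt.len, Expr.length_code, *] <;> omega

theorem Stmt.eval_lt {n M w : ℕ} (hB : Bounds n M w) (s : Stmt) {ρ : Env} {m : Arrays}
    (h : Valid n M ρ m) : ∀ k, ∀ i < n, s.eval n M ρ m k i < M := by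
  induction s generalizing ρ m with
  | store k i e =>
    simp only [Stmt.eval]
    split_ifs with hi
    · intro k' i' hi'
      by_cases hk : k' = k
      · subst hk
        rw [Function.update_self]
        by_cases hii : i' = i.eval n M ρ m
        · rw [hii, Function.update_self]
          exact e.eval_lt hB h
        · rw [Function.update_of_ne hii]
          exact h.2 _ _ hi'
      · rw [Function.update_of_ne hk]
        exact h.2 _ _ hi'
    · exact h.2
  | seq s s' ih ih' => exact ih' ⟨h.1, ih h⟩
  | loop v e s ih =>
    have he := e.eval_lt hB h
    have key : ∀ N ≤ e.eval n M ρ m, ∀ k, ∀ i < n, (List.range N).foldl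
        (fun m i => s.eval n M (Function.update ρ v i) m) m k i < M := by
      intro N
      induction N with
      | zero => exact fun _ => h.2
      | succ N ihN =>
        intro hN
        rw [List.range_succ, List.foldl_append]
        exact ih (Valid.update ⟨h.1, ihN (by omega)⟩ v (by omega))
    exact key _ le_rfl
  | letv v e s ih => exact ih (h.update v (e.eval_lt hB h))

theorem Represents.update {n M : ℕ} {ρ : Env} {m : Arrays} {R R' mem : ℕ → ℕ} {v : Fin 8} {x : ℕ}
    (h : Represents n M ρ m R mem) (hv : R' (v + 2) = x)
    (hR : ∀ r : ℕ, r < 10 → r ≠ (v : ℕ) + 2 → R' r = R r) :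
    Represents n M (Function.update ρ v x) m R' mem := by
  refine ⟨?_, ?_, fun u => ?_, h.mem_eq⟩
  · rw [hR _ (by omega) (by omega), h.reg_zero]
  · rw [hR _ (by omega) (by omega), h.reg_one]
  · by_cases hu : u = v
    · simp [hu, hv]
    · rw [Function.update_of_ne hu, hR _ (by omega) (by omega), h.reg_var]

theorem Stmt.executes {P : Program} {n M w : ℕ} (hB : Bounds n M w) (s : Stmt) {d pc : ℕ} {ρ : Env}
    {m : Arrays} {R mem : ℕ → ℕ} (hP : CodeAt P pc (s.code d pc)) (hV : Valid n M ρ m)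
    (hR : Represents n M ρ m R mem) (hc : Config.Fits w ⟨pc, R, mem⟩) :
    ∃ R' mem', P.Reaches (16 * n) w ⟨pc, R, mem⟩ (s.cost n M ρ m) ⟨pc + s.len, R', mem'⟩ ∧
      (∀ r < d + 10, R' r = R r) ∧ ∀ k : Fin 16, ∀ i < n,
        mem' (k * n + i) = s.eval n M ρ m k i := by
  have hM := hB.le_modulus
  have hn := hB.size_le
  have hMw := hB.lt
  induction s generalizing d pc ρ m R mem with
  | store k i e =>
    simp only [Stmt.code, codeAt_append, Expr.length_code] at hP
    obtain ⟨R₂, h, hx, hy, hR₂⟩ := delivers_binary (i.delivers hB hP.1 hV hR hc)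
      fun R' hR' hc' => e.delivers hB hP.2.1 hV (hR.congr hR') hc'
    obtain ⟨p1, p2, p3, p4, p5, p6, -⟩ := hP.2.2
    have hR2 := hR.congr hR₂
    have a1 := reaches_jumpLt (S := 16 * n) p1 h.fits
    rw [hx, hR2.reg_zero] at a1
    have hxM := i.eval_lt hB hV
    simp only [Stmt.eval]
    by_cases hi : i.eval n M ρ m < n
    · rw [if_pos hi] at a1 ⊢
      have b2 := reaches_const (S := 16 * n) p3 a1.fits (k := k) (by omega)
      have b3 := reaches_arith (S := 16 * n) p4 b2.fits (by
        simp only [Arith.eval, Function.update_self]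
        rw [Function.update_of_ne (by omega), hR2.reg_zero]
        exact hB.mul_lt (by omega) (by omega))
      have e3 : (k : ℕ) * n ≤ 15 * n := Nat.mul_le_mul_right n (by omega)
      have b4 := reaches_arith (S := 16 * n) p5 b3.fits (by
        simp only [Arith.eval, Function.update_self]
        rw [Function.update_of_ne (by omega), Function.update_of_ne (by omega),
          Function.update_of_ne (by omega), hR2.reg_zero, hx]
        omega)
      generalize hR₄ : Function.update (Function.update (Function.update R₂ (d + 12) (k : ℕ))
        (d + 12) _) (d + 10) _ = R₄ at b4
      have e4 : R₄ (d + 10) = k * n + i.eval n M ρ m := by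
        simp [← hR₄, Arith.eval, hx, hR2.reg_zero, Nat.add_comm]
      have e5 : R₄ (d + 11) = e.eval n M ρ m := by
        rw [← hR₄, Function.update_of_ne (by omega), Function.update_of_ne (by omega),
          Function.update_of_ne (by omega), hy]
      have b5 := reaches_store (S := 16 * n) p6 b4.fits (by rw [e4]; omega)
      refine ⟨_, _, (h.trans (a1.trans (b2.trans (b3.trans (b4.trans b5))))).cast
        (by simp only [Stmt.len]; omega) (by simp only [Stmt.cost]; omega), fun r hr => ?_, ?_⟩
      · rw [← hR₄, Function.update_of_ne (by omega), Function.update_of_ne (by omega),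
          Function.update_of_ne (by omega), hR₂ r hr]
      · intro k' i' hi'
        rw [e4, e5]
        have hinj : (k' : ℕ) * n + i' = k * n + i.eval n M ρ m ↔ k' = k ∧ i' = i.eval n M ρ m := by
          constructor
          · intro heq
            have hdiv := congrArg (· / n) heq
            have hmod := congrArg (· % n) heq
            have hn0 : 0 < n := by omega
            simp only [Nat.mul_comm _ n, Nat.mul_add_div hn0, Nat.div_eq_of_lt hi,
              Nat.div_eq_of_lt hi', Nat.mul_add_mod, Nat.mod_eq_of_lt hi,
              Nat.mod_eq_of_lt hi'] at hdiv hmod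
            exact ⟨Fin.ext (by omega), hmod⟩
          · rintro ⟨rfl, rfl⟩
            rfl
        simp only [Function.update_apply, hinj]
        by_cases hk : k' = k
        · subst hk
          by_cases hii : i' = i.eval n M ρ m
          · simp [hii]
          · simp [hii, hR.mem_eq _ _ hi']
        · simp [hk, hR.mem_eq _ _ hi']
    · rw [if_neg hi] at a1 ⊢
      have a2 := reaches_jump (S := 16 * n) p2 a1.fits
      exact ⟨_, _, (h.trans (a1.trans a2)).cast (by simp only [Stmt.len]; omega)
        (by simp only [Stmt.cost]; omega), hR₂, hR.mem_eq⟩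
  | seq s s' ih ih' =>
    simp only [Stmt.code, codeAt_append, Stmt.length_code] at hP
    obtain ⟨R₁, mem₁, a1, hR₁, hm₁⟩ := ih hP.1 hV hR hc
    have hR1 := hR.congr hR₁
    obtain ⟨R₂, mem₂, a2, hR₂, hm₂⟩ := ih' hP.2 ⟨hV.1, s.eval_lt hB hV⟩
      ⟨hR1.reg_zero, hR1.reg_one, hR1.reg_var, hm₁⟩ a1.fits
    exact ⟨R₂, mem₂, (a1.trans a2).cast (by simp only [Stmt.len]; omega) le_rfl,
      fun r hr => by rw [hR₂ r hr, hR₁ r hr], hm₂⟩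
  | loop v e s ih =>
    simp only [Stmt.code, codeAt_append, Expr.length_code, Stmt.length_code, CodeAt,
      List.length_cons, List.length_nil] at hP
    obtain ⟨hPe, ⟨p1, p2, p3, p4, -⟩, hPs, p5, p6, p7, p8, -⟩ := hP
    have hv : (v : ℕ) + 2 < 10 := by omega
    obtain ⟨R₁, a1, hx, hR₁⟩ := e.delivers hB hPe hV hR hc
    have hR1 := hR.congr hR₁
    have a2 := reaches_copy (S := 16 * n) p1 a1.fits
    have a3 := reaches_const (S := 16 * n) p2 a2.fits (by positivity)
    set N := e.eval n M ρ m with hN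
    have hNM : N < M := e.eval_lt hB hV
    obtain ⟨R₂, mem₂, a5, h5, h6, h7, h8, h9, h10⟩ := reaches_loop (S := 16 * n) (N := N)
      (τ := fun i => s.cost n M (Function.update ρ v i) ((List.range i).foldl
        (fun m i => s.eval n M (Function.update ρ v i) m) m) + 3)
      (I := fun i R' mem' => R' (v + 2) = i ∧ R' (d + 10) = N ∧ R' (d + 11) = ρ v ∧
        (∀ r < d + 10, r ≠ v + 2 → R' r = R r) ∧
        (∀ k : Fin 16, ∀ j < n, mem' (k * n + j) = (List.range i).foldl
          (fun m i => s.eval n M (Function.update ρ v i) m) m k j) ∧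
        ∀ k, ∀ j < n, (List.range i).foldl
          (fun m i => s.eval n M (Function.update ρ v i) m) m k j < M)
      p3 p4 (fun i R' mem' h => ⟨h.1, h.2.1⟩) (by
        rintro i hi R' mem' ⟨h1, h2, h3, h4, h5, h6⟩ hc'
        have hRi : Represents n M (Function.update ρ v i) ((List.range i).foldl
            (fun m i => s.eval n M (Function.update ρ v i) m) m) R' mem' :=
          Represents.update ⟨hR.reg_zero, hR.reg_one, hR.reg_var, h5⟩ h1
            fun r hr hr' => h4 r (by omega) hr'
        have hVi := Valid.update ⟨hV.1, h6⟩ v (hi.trans hNM)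
        obtain ⟨R₃, mem₃, b1, hR₃, hm₃⟩ := ih hPs hVi hRi hc'
        have b4 := reaches_const (S := 16 * n) p5 b1.fits (show 1 < 2 ^ w by omega)
        have b5 := reaches_arith (S := 16 * n) p6 b4.fits (by
          simp only [Arith.eval, Function.update_self]
          rw [Function.update_of_ne (by omega), hR₃ _ (by omega), h1]
          omega)
        have b6 := reaches_jump (S := 16 * n) p7 b5.fits
        refine ⟨_, _, (b1.trans (b4.trans (b5.trans b6))).mono le_rfl, ?_, ?_, ?_, ?_, ?_, ?_⟩
        · simp only [Arith.eval, Function.update_self]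
          rw [Function.update_of_ne (by omega), hR₃ _ (by omega), h1]
        · rw [Function.update_of_ne (by omega), Function.update_of_ne (by omega),
            hR₃ _ (by omega), h2]
        · rw [Function.update_of_ne (by omega), Function.update_of_ne (by omega),
            hR₃ _ (by omega), h3]
        · intro r hr hr'
          rw [Function.update_of_ne (by omega), Function.update_of_ne (by omega),
            hR₃ _ (by omega), h4 _ hr hr']
        · rw [List.range_succ, List.foldl_append]
          exact hm₃
        · rw [List.range_succ, List.foldl_append]
          exact s.eval_lt hB hVi)
      ⟨by simp, by
        rw [Function.update_of_ne (by omega), Function.update_of_ne (by omega), hx], by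
        rw [Function.update_of_ne (by omega), Function.update_self, hR1.reg_var],
        fun r hr hr' => by
          rw [Function.update_of_ne (by omega), Function.update_of_ne (by omega), hR₁ _ hr],
        hR.mem_eq, hV.2⟩ a3.fits
    rw [show pc + e.len + 1 + 1 + 1 + 1 + s.len + 1 + 1 + 1 = pc + e.len + s.len + 7 by omega] at p8
    have a6 := reaches_copy (S := 16 * n) p8 a5.fits
    refine ⟨_, _, (a1.trans (a2.trans (a3.trans (a5.trans a6)))).cast
      (by simp only [Stmt.len]; omega)
      (by simp only [Stmt.cost, ← hN, add_assoc, Nat.reduceAdd]; omega), ?_, h9⟩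
    intro r hr
    by_cases hrv : r = v + 2
    · rw [hrv, Function.update_self, h7, hR.reg_var]
    · rw [Function.update_of_ne hrv, h8 _ hr hrv]
  | letv v e s ih =>
    simp only [Stmt.code, codeAt_append, Expr.length_code, Stmt.length_code, CodeAt,
      List.length_cons, List.length_nil] at hP
    obtain ⟨hPe, ⟨p1, p2, -⟩, hPs, p3, -⟩ := hP
    have hv : (v : ℕ) + 2 < 10 := by omega
    obtain ⟨R₁, a1, hx, hR₁⟩ := e.delivers hB hPe hV hR hc
    have hR1 := hR.congr hR₁
    have a2 := reaches_copy (S := 16 * n) p1 a1.fits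
    have a3 := reaches_copy (S := 16 * n) p2 a2.fits
    obtain ⟨R₂, mem₂, a4, hR₂, hm₂⟩ := ih hPs (hV.update v (e.eval_lt hB hV))
      (hR1.update (R' := Function.update (Function.update R₁ (d + 11) (R₁ (v + 2))) (v + 2)
        (Function.update R₁ (d + 11) (R₁ (v + 2)) (d + 10))) (by
          rw [Function.update_self, Function.update_of_ne (by omega), hx])
        fun r hr hr' => by rw [Function.update_of_ne hr', Function.update_of_ne (by omega)]) a3.fits
    have a5 := reaches_copy (S := 16 * n) p3 a4.fits
    refine ⟨_, _, (a1.trans (a2.trans (a3.trans (a4.trans a5)))).cast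
      (by simp only [Stmt.len]; omega) (by simp only [Stmt.cost]; omega), fun r hr => ?_, hm₂⟩
    by_cases hrv : r = v + 2
    · rw [hrv, Function.update_self, hR₂ _ (by omega), Function.update_of_ne (by omega),
        Function.update_self, hR1.reg_var, hR.reg_var]
    · rw [Function.update_of_ne hrv, hR₂ _ (by omega), Function.update_of_ne hrv,
        Function.update_of_ne (by omega), hR₁ _ hr]

/-- The program that executes the statement, with `n` in variable `0` and modulo `(n + 64) ^ 5`,
and that outputs the value of the expression afterwards. -/
def Stmt.program (s : Stmt) (e : Expr) : Program :=
  [.const 10 64, .arith .add 10 10 0, .arith .mul 1 10 10, .arith .mul 1 1 1, .arith .mul 1 1 10,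
    .copy 2 0] ++ (s.code 0 6 ++ (e.code 0 (6 + s.len) ++ [.copy 0 10]))

/-- The arrays that hold the input. -/
def inputArrays {n : ℕ} (π : Equiv.Perm (Fin n)) : Arrays := fun k i =>
  if h : i < n then if k = 0 then (π ⟨i, h⟩ : ℕ) else 0 else 0

theorem Stmt.program_outputs (s : Stmt) (e : Expr) {n M w : ℕ} (hM : M = (n + 64) ^ 5)
    (hw : M * M < 2 ^ w) (π : Equiv.Perm (Fin n)) :
    let ρ : Env := Function.update 0 0 n
    let m' := s.eval n M ρ (inputArrays π)
    (s.program e).Outputs π (s.cost n M ρ (inputArrays π) + e.cost n M ρ m' + 7) (16 * n) w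
      (e.eval n M ρ m') := by
  intro ρ m'
  have hB : Bounds n M w := by
    refine ⟨?_, ?_, hw⟩
    · rw [hM]
      calc 64 ≤ n + 64 := by omega
        _ ≤ (n + 64) ^ 5 := Nat.le_self_pow (by norm_num) _
    · rw [hM]
      calc 17 * n ≤ (n + 64) ^ 2 := by nlinarith
        _ ≤ (n + 64) ^ 5 := Nat.pow_le_pow_right (by omega) (by norm_num)
  have hMw := hB.lt
  have hM64 := hB.le_modulus
  have hn := hB.size_le
  have hpow : (n + 64) ^ 2 ≤ M ∧ (n + 64) ^ 4 ≤ M ∧ n + 64 ≤ M := by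
    rw [hM]
    exact ⟨Nat.pow_le_pow_right (by omega) (by norm_num),
      Nat.pow_le_pow_right (by omega) (by norm_num), Nat.le_self_pow (by norm_num) _⟩
  have hP : CodeAt (s.program e) 0 (s.program e) := by
    simpa using codeAt_of_append [] (s.program e) []
  obtain ⟨q1, hPs, hPe, q2, -⟩ : _ ∧ _ ∧ _ ∧ CodeAt _ _ [Instr.copy 0 10] := by
    simpa only [Stmt.program, codeAt_append, Stmt.length_code, Expr.length_code] using hP
  obtain ⟨p1, p2, p3, p4, p5, p6, -⟩ := q1
  have hlt : ∀ i (h : i < n), (π ⟨i, h⟩ : ℕ) < M := fun i h => (π ⟨i, h⟩).2.trans_le (by omega)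
  have hc : (Config.init π).Fits w := by
    refine ⟨fun i => ?_, fun i => ?_⟩
    · simp only [Config.init, Function.update_apply]
      split_ifs <;> omega
    · simp only [Config.init]
      split_ifs with h
      · exact (hlt i h).trans hMw
      · positivity
  have e3 : (n + 64) ^ 2 * (n + 64) ^ 2 = (n + 64) ^ 4 := by ring
  have e4 : (n + 64) ^ 4 * (n + 64) = M := by rw [hM]; ring
  have a1 := reaches_const (S := 16 * n) p1 hc (by omega)
  have a2 := reaches_arith_eq (S := 16 * n) (x := n + 64) p2 a1.fits
    (by simp [Arith.eval, Nat.add_comm]) (by omega)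
  have a3 := reaches_arith_eq (S := 16 * n) (x := (n + 64) ^ 2) p3 a2.fits
    (by simp [Arith.eval, sq]) (by omega)
  have a4 := reaches_arith_eq (S := 16 * n) (x := (n + 64) ^ 4) p4 a3.fits
    (by simp [Arith.eval, e3]) (by omega)
  have a5 := reaches_arith_eq (S := 16 * n) (x := M) p5 a4.fits
    (by simp [Arith.eval, e4]) (by omega)
  have a6 := reaches_copy (S := 16 * n) p6 a5.fits
  have hV : Valid n M ρ (inputArrays π) := by
    refine ⟨fun v => ?_, fun k i hi => ?_⟩
    · simp only [ρ, Function.update_apply]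
      split_ifs
      · omega
      · simp only [Pi.zero_apply]; omega
    · simp only [inputArrays, hi, dif_pos]
      split_ifs
      · exact hlt i hi
      · omega
  obtain ⟨R₀, a0, hR⟩ : ∃ R₀, (s.program e).Reaches (16 * n) w (Config.init π) 6
      ⟨6, R₀, (Config.init π).mem⟩ ∧ Represents n M ρ (inputArrays π) R₀ (Config.init π).mem := by
    refine ⟨_, a1.trans (a2.trans (a3.trans (a4.trans (a5.trans a6)))), ?_, ?_, fun v => ?_,
      fun k i hi => ?_⟩
    · simp
    · simp
    · by_cases hv : v = 0
      · simp [hv, ρ]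
      · have hv' : (v : ℕ) ≠ 0 := fun h => hv (Fin.ext h)
        simp only [ρ, Function.update_of_ne hv]
        rw [Function.update_of_ne (by omega), Function.update_of_ne (by omega),
          Function.update_of_ne (by omega), Function.update_of_ne (by omega),
          Function.update_of_ne (by omega), Function.update_of_ne (by omega),
          Function.update_of_ne (by omega)]
        rfl
    · simp only [Config.init, inputArrays, hi, dif_pos]
      by_cases hk : k = 0
      · simp [hk, hi]
      · have hk' : 1 ≤ (k : ℕ) := Nat.one_le_iff_ne_zero.2 fun h => hk (Fin.ext h)
        have : n ≤ k * n := Nat.le_mul_of_pos_left n hk'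
        rw [dif_neg (by omega), if_neg hk]
  obtain ⟨R₁, mem₁, a7, hR₁, hm₁⟩ := s.executes hB hPs hV hR a0.fits
  have hR1 := hR.congr hR₁
  obtain ⟨R₂, a8, hx, hR₂⟩ := e.delivers (m := m') hB hPe ⟨hV.1, s.eval_lt hB hV⟩
    ⟨hR1.reg_zero, hR1.reg_one, hR1.reg_var, hm₁⟩ a7.fits
  have a9 := reaches_copy (S := 16 * n) q2 a8.fits
  obtain ⟨t, ht, hrun⟩ := a0.trans (a7.trans (a8.trans a9))
  refine ⟨t, ht.trans (by omega), _, hrun, ?_, ?_⟩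
  · rw [List.getElem?_eq_none]
    simp [Stmt.program, Stmt.length_code, Expr.length_code]
    omega
  · simp [hx, m']

/-! ### Program logic -/

/-- The statement runs within cost `c` and its outcome satisfies `Q`. -/
def Stmt.Meets (n M : ℕ) (s : Stmt) (ρ : Env) (m : Arrays) (c : ℕ) (Q : Arrays → Prop) : Prop :=
  Q (s.eval n M ρ m) ∧ s.cost n M ρ m ≤ c

section Logic

variable {n M : ℕ} {ρ : Env} {m : Arrays} {c c' : ℕ} {Q Q' : Arrays → Prop}

theorem Stmt.Meets.mono {s : Stmt} (h : s.Meets n M ρ m c Q) (hc : c ≤ c') (hQ : ∀ m', Q m' → Q' m') :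
    s.Meets n M ρ m c' Q' :=
  ⟨hQ _ h.1, h.2.trans hc⟩

theorem Stmt.Meets.seq {s s' : Stmt} (h : s.Meets n M ρ m c Q)
    (h' : ∀ m', Q m' → s'.Meets n M ρ m' c' Q') : (s.seq s').Meets n M ρ m (c + c') Q' :=
  ⟨(h' _ h.1).1, add_le_add h.2 (h' _ h.1).2⟩

theorem Stmt.meets_loop {s : Stmt} {v : Fin 8} {e : Expr} (N ce : ℕ) (I : ℕ → Arrays → Prop)
    (hN : e.eval n M ρ m = N) (he : e.cost n M ρ m ≤ ce) (h0 : I 0 m)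
    (hs : ∀ i < N, ∀ m', I i m' → s.Meets n M (Function.update ρ v i) m' c (I (i + 1))) :
    (s.loop v e).Meets n M ρ m (ce + N * (c + 4) + 5) (I N) := by
  have key : ∀ i ≤ N, I i ((List.range i).foldl
      (fun m i => s.eval n M (Function.update ρ v i) m) m) := by
    intro i
    induction i with
    | zero => exact fun _ => h0
    | succ i ih =>
      intro hi
      rw [List.range_succ, List.foldl_append]
      exact (hs i (by omega) _ (ih (by omega))).1
  refine ⟨?_, ?_⟩
  · simpa only [Stmt.eval, hN] using key N le_rfl
  · simp only [Stmt.cost, hN]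
    have := Finset.sum_le_card_nsmul (Finset.range N) (fun i => s.cost n M (Function.update ρ v i)
      ((List.range i).foldl (fun m i => s.eval n M (Function.update ρ v i) m) m) + 4) (c + 4)
      fun i hi => by
        have hi := Finset.mem_range.1 hi
        exact Nat.add_le_add_right (hs i hi _ (key i hi.le)).2 4
    simp only [Finset.card_range, smul_eq_mul] at this
    omega

theorem Stmt.Meets.letv {s : Stmt} {v : Fin 8} {e : Expr} {x : ℕ} (hx : e.eval n M ρ m = x)
    (h : s.Meets n M (Function.update ρ v x) m c Q) :
    (s.letv v e).Meets n M ρ m (e.cost n M ρ m + c + 3) Q := by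
  subst hx
  exact ⟨h.1, by simp only [Stmt.cost]; have := h.2; omega⟩

theorem Stmt.meets_store {k : Fin 16} {i e : Expr} (hi : i.eval n M ρ m < n)
    (hc : i.cost n M ρ m + e.cost n M ρ m ≤ c)
    (hQ : Q (Function.update m k (Function.update (m k) (i.eval n M ρ m) (e.eval n M ρ m)))) :
    (Stmt.store k i e).Meets n M ρ m (c + 6) Q :=
  ⟨by simpa only [Stmt.eval, if_pos hi] using hQ, by simp only [Stmt.cost]; omega⟩

theorem Expr.cost_sum_le {v : Fin 8} {e b : Expr} {N ce : ℕ} (hN : e.eval n M ρ m = N)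
    (he : e.cost n M ρ m ≤ ce) (hb : ∀ i < N, b.cost n M (Function.update ρ v i) m ≤ c) :
    (Expr.sum v e b).cost n M ρ m ≤ ce + N * (c + 8) + 7 := by
  have := Finset.sum_le_card_nsmul (Finset.range N)
    (fun i => b.cost n M (Function.update ρ v i) m + 8) (c + 8)
    fun i hi => Nat.add_le_add_right (hb i (Finset.mem_range.1 hi)) 8
  simp only [Finset.card_range, smul_eq_mul] at this
  simp only [Expr.cost, hN]
  omega

theorem Expr.cast_add (a b : Expr) : (((Expr.add a b).eval n M ρ m : ℕ) : ZMod M) =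
    (a.eval n M ρ m : ZMod M) + (b.eval n M ρ m : ZMod M) := by
  simp [Expr.eval]

theorem Expr.cast_mul (a b : Expr) : (((Expr.mul a b).eval n M ρ m : ℕ) : ZMod M) =
    (a.eval n M ρ m : ZMod M) * (b.eval n M ρ m : ZMod M) := by
  simp [Expr.eval]

theorem Expr.cast_sub (a b : Expr) (hb : b.eval n M ρ m ≤ M) :
    (((Expr.sub a b).eval n M ρ m : ℕ) : ZMod M) =
      (a.eval n M ρ m : ZMod M) - (b.eval n M ρ m : ZMod M) := by
  simp only [Expr.eval, ZMod.natCast_mod]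
  push_cast [hb]
  simp
  ring

theorem Expr.cast_sum (v : Fin 8) (e b : Expr) : (((Expr.sum v e b).eval n M ρ m : ℕ) : ZMod M) =
    ∑ i ∈ Finset.range (e.eval n M ρ m), (b.eval n M (Function.update ρ v i) m : ZMod M) := by
  simp [Expr.eval]

theorem Expr.cast_ite (a b e f : Expr) : (((Expr.ite a b e f).eval n M ρ m : ℕ) : ZMod M) =
    if a.eval n M ρ m < b.eval n M ρ m then (e.eval n M ρ m : ZMod M)
      else (f.eval n M ρ m : ZMod M) := by
  simp only [Expr.eval]
  split_ifs <;> rfl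

/-- The arrays outside of `T` agree. -/
def Keeps (T : Finset (Fin 16)) (m m' : Arrays) : Prop := ∀ k ∉ T, m' k = m k

theorem Keeps.refl (T : Finset (Fin 16)) (m : Arrays) : Keeps T m m := fun _ _ => rfl

theorem Keeps.trans {T T' T'' : Finset (Fin 16)} {m m' m'' : Arrays} (h : Keeps T m m')
    (h' : Keeps T' m' m'') (hT : T ⊆ T'') (hT' : T' ⊆ T'') : Keeps T'' m m'' := fun k hk => by
  rw [h' k fun hk' => hk (hT' hk'), h k fun hk' => hk (hT hk')]

theorem Keeps.mono {T T' : Finset (Fin 16)} {m m' : Arrays} (h : Keeps T m m') (hT : T ⊆ T') :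
    Keeps T' m m' := fun k hk => h k fun hk' => hk (hT hk')

theorem Keeps.update {T : Finset (Fin 16)} {m m' : Arrays} (h : Keeps T m m') {k : Fin 16}
    (hk : k ∈ T) (f : ℕ → ℕ) : Keeps T m (Function.update m' k f) := fun k' hk' => by
  rw [Function.update_of_ne (by rintro rfl; exact hk' hk), h k' hk']

/-- Stores the values of an expression in all entries of an array. -/
def Stmt.fill (v : Fin 8) (k : Fin 16) (e : Expr) : Stmt := .loop v (.var 0) (.store k (.var v) e)

theorem Stmt.meets_fill {v : Fin 8} {k : Fin 16} {e : Expr} (h0 : ρ 0 = n) (G : ℕ → ℕ → Prop)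
    (h : ∀ i < n, ∀ m', Keeps {k} m m' → m' k i = m k i →
      G i (e.eval n M (Function.update ρ v i) m') ∧ e.cost n M (Function.update ρ v i) m' ≤ c) :
    (Stmt.fill v k e).Meets n M ρ m (n * (c + 11) + 6)
      fun m' => Keeps {k} m m' ∧ ∀ i < n, G i (m' k i) := by
  refine (Stmt.meets_loop (c := c + 7) n 1 (fun t m' => Keeps {k} m m' ∧
    (∀ i < t, G i (m' k i)) ∧ ∀ i, t ≤ i → m' k i = m k i) (by exact h0) le_rfl
    ⟨.refl _ _, by simp, fun _ _ => rfl⟩ ?_).mono (by ring_nf; omega) fun m' h => ⟨h.1, h.2.1⟩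
  rintro i hi m' ⟨h1, h2, h3⟩
  obtain ⟨he, hc⟩ := h i hi m' h1 (h3 i le_rfl)
  have hv : (Expr.var v).eval n M (Function.update ρ v i) m' = i := by simp [Expr.eval]
  refine (Stmt.meets_store (c := c + 1) (by rw [hv]; exact hi)
    (by simp only [Expr.cost]; omega) ?_).mono le_rfl fun _ => id
  rw [hv]
  refine ⟨h1.update (by simp) _, fun j hj => ?_, fun j hj => ?_⟩
  · rw [Function.update_self]
    rcases Nat.lt_succ_iff_lt_or_eq.1 hj with hj | rfl
    · rw [Function.update_of_ne hj.ne]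
      exact h2 j hj
    · rwa [Function.update_self]
  · rw [Function.update_self, Function.update_of_ne (by omega), h3 j (by omega)]

end Logic

/-- The array `k` holds the vector `f` modulo `M`. -/
def Holds {n : ℕ} (M : ℕ) (m : Arrays) (k : Fin 16) (f : Fin n → ZMod M) : Prop :=
  ∀ i : Fin n, (m k i : ZMod M) = f i

theorem Holds.congr {n M : ℕ} {m m' : Arrays} {k : Fin 16} {f : Fin n → ZMod M}
    {T : Finset (Fin 16)} (h : Holds M m k f) (hm : Keeps T m m') (hk : k ∉ T) :
    Holds M m' k f := fun i => by
  rw [hm k hk, h i]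

/-- The two coordinates of the points of a permutation. -/
inductive Axis
  | pos | val

/-- The array of the coordinates of the points. -/
def Axis.keys : Axis → Fin 16
  | .pos => 2
  | .val => 0

/-- The array of the points, sorted by the coordinate. -/
def Axis.sorted : Axis → Fin 16
  | .pos => 2
  | .val => 1

/-- The coordinate of the points. -/
def Axis.key {n : ℕ} (π : Equiv.Perm (Fin n)) : Axis → Equiv.Perm (Fin n)
  | .pos => 1
  | .val => π

/-- The first three arrays hold the permutation, its inverse and the identity. -/
structure Ready {n : ℕ} (π : Equiv.Perm (Fin n)) (m : Arrays) : Prop where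
  val : ∀ i : Fin n, m 0 i = π i
  inv : ∀ i : Fin n, m 1 i = π.symm i
  pos : ∀ i : Fin n, m 2 i = i

theorem Ready.congr {n : ℕ} {π : Equiv.Perm (Fin n)} {m m' : Arrays} {T : Finset (Fin 16)}
    (h : Ready π m) (hm : Keeps T m m') (h0 : 0 ∉ T) (h1 : 1 ∉ T) (h2 : 2 ∉ T) : Ready π m' :=
  ⟨fun i => by rw [hm _ h0, h.val], fun i => by rw [hm _ h1, h.inv],
    fun i => by rw [hm _ h2, h.pos]⟩

theorem Ready.keys {n : ℕ} {π : Equiv.Perm (Fin n)} {m : Arrays} (h : Ready π m) (a : Axis)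
    (i : Fin n) : m a.keys i = a.key π i := by
  cases a
  · exact h.pos i
  · exact h.val i

theorem Ready.sorted {n : ℕ} {π : Equiv.Perm (Fin n)} {m : Arrays} (h : Ready π m) (a : Axis)
    (i : Fin n) : m a.sorted i = (a.key π).symm i := by
  cases a
  · exact h.pos i
  · exact h.inv i

theorem Expr.eval_get {n M : ℕ} {ρ : Env} {m : Arrays} {k : Fin 16} {e : Expr} (i : Fin n)
    (hi : e.eval n M ρ m = i) : (Expr.get k e).eval n M ρ m = m k i := by
  simp [Expr.eval, hi]

/-! ### Prefix sums along a coordinate -/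

/-- The relation that `p` precedes `p'` in the coordinate `a`, in the same block of length `q`. -/
def precedes {n : ℕ} (π : Equiv.Perm (Fin n)) (a : Axis) (q : ℕ) (p p' : Fin n) : Prop :=
  a.key π p < a.key π p' ∧ (a.key π p : ℕ) / q = a.key π p' / q

instance {n : ℕ} (π : Equiv.Perm (Fin n)) (a : Axis) (q : ℕ) (p p' : Fin n) :
    Decidable (precedes π a q p p') := instDecidableAnd

/-- The sum of `f` over the predecessors under a relation. -/
def sumBelow {n : ℕ} {K : Type*} [AddCommMonoid K] (r : Fin n → Fin n → Prop)
    [∀ p p', Decidable (r p p')] (f : Fin n → K) (p : Fin n) : K :=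
  ∑ p', if r p' p then f p' else 0

theorem sumBelow_precedes {n : ℕ} {K : Type*} [AddCommMonoid K] (π : Equiv.Perm (Fin n)) (a : Axis)
    {q : ℕ} (hq : 0 < q) (f : Fin n → K) (t : Fin n) :
    sumBelow (precedes π a q) f ((a.key π).symm t) =
      if h : (t : ℕ) / q * q < t then
        sumBelow (precedes π a q) f ((a.key π).symm ⟨t - 1, by omega⟩) +
          f ((a.key π).symm ⟨t - 1, by omega⟩) else 0 := by
  split_ifs with h
  · have ht : 0 < (t : ℕ) := by omega
    have hdiv : ((t : ℕ) - 1) / q = t / q := by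
      refine le_antisymm (Nat.div_le_div_right (by omega)) ?_
      rw [Nat.le_div_iff_mul_le hq]
      omega
    simp only [sumBelow, precedes, Equiv.apply_symm_apply, hdiv]
    have hf : f ((a.key π).symm ⟨t - 1, by omega⟩) =
        ∑ p, if p = (a.key π).symm ⟨t - 1, by omega⟩ then f p else 0 := by simp
    rw [hf, ← Finset.sum_add_distrib]
    refine Finset.sum_congr rfl fun p _ => ?_
    have hp : p = (a.key π).symm ⟨t - 1, by omega⟩ ↔ (a.key π p : ℕ) = t - 1 := by
      rw [Equiv.eq_symm_apply, Fin.ext_iff]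
    simp only [hp, Fin.lt_def]
    by_cases h1 : (a.key π p : ℕ) = t - 1
    · rw [h1, hdiv]
      simp [ht]
    · by_cases h2 : (a.key π p : ℕ) < t
      · simp [h1, h2, show (a.key π p : ℕ) < t - 1 by omega]
      · simp [h1, h2, show ¬ (a.key π p : ℕ) < t - 1 by omega]
  · refine Finset.sum_eq_zero fun p _ => if_neg ?_
    simp only [precedes, Equiv.apply_symm_apply, Fin.lt_def]
    rintro ⟨h1, h2⟩
    have := Nat.div_mul_le_self (a.key π p) q
    rw [h2] at this
    omega

/-- Stores in `dst` the sums of `src` over the preceding points in the same block, the length of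
the blocks being the variable `u`. -/
def Stmt.scan (a : Axis) (u : Fin 8) (src dst : Fin 16) : Stmt :=
  .loop 3 (.var 0) (.store dst (.get a.sorted (.var 3))
    (.ite (.mul (.div (.var 3) (.var u)) (.var u)) (.var 3)
      (.add (.get dst (.get a.sorted (.sub (.var 3) (.lit 1))))
        (.get src (.get a.sorted (.sub (.var 3) (.lit 1))))) (.lit 0)))

theorem Expr.eval_sub {n M : ℕ} {ρ : Env} {m : Arrays} {a b : Expr} (h : b.eval n M ρ m ≤ a.eval n M ρ m)
    (ha : a.eval n M ρ m < M) :
    (Expr.sub a b).eval n M ρ m = a.eval n M ρ m - b.eval n M ρ m := by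
  simp only [Expr.eval]
  rw [show a.eval n M ρ m + (M - b.eval n M ρ m) = a.eval n M ρ m - b.eval n M ρ m + M by omega,
    Nat.add_mod_right, Nat.mod_eq_of_lt (by omega)]

theorem Stmt.meets_scan {n M : ℕ} {ρ : Env} {m : Arrays} {π : Equiv.Perm (Fin n)} {a : Axis}
    {u : Fin 8} {src dst : Fin 16} {f : Fin n → ZMod M} (hnM : n < M) (h0 : ρ 0 = n) (hu : u ≠ 3)
    (hq : 0 < ρ u) (hm : Ready π m) (hsrc : Holds M m src f) (hdst : 2 < dst) (hsd : src ≠ dst) :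
    (Stmt.scan a u src dst).Meets n M ρ m (66 * n + 6)
      fun m' => Keeps {dst} m m' ∧ Holds M m' dst (sumBelow (precedes π a (ρ u)) f) := by
  have hT : ∀ k : Fin 16, k ≤ 2 → k ∉ ({dst} : Finset (Fin 16)) := fun k hk => by
    rw [Finset.mem_singleton]
    rintro rfl
    exact absurd hdst (not_lt.2 hk)
  refine (Stmt.meets_loop (c := 62) n 1 (fun t m' => Keeps {dst} m m' ∧
    ∀ s : Fin n, (s : ℕ) < t → (m' dst ((a.key π).symm s) : ZMod M) =
      sumBelow (precedes π a (ρ u)) f ((a.key π).symm s)) (by exact h0) le_rfl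
    ⟨.refl _ _, by simp⟩ ?_).mono (by omega) fun m' h => ⟨h.1, fun i => by
      simpa using h.2 (a.key π i) (Fin.is_lt _)⟩
  rintro t ht m' ⟨h1, h2⟩
  have hm' := hm.congr h1 (hT 0 (by decide)) (hT 1 (by decide)) (hT 2 (by decide))
  have hv : (Expr.var 3).eval n M (Function.update ρ 3 t) m' = t := by simp [Expr.eval]
  have hi := Expr.eval_get (k := a.sorted) ⟨t, ht⟩ hv
  rw [hm'.sorted] at hi
  have hdiv : (Expr.mul (.div (.var 3) (.var u)) (.var u)).eval n M (Function.update ρ 3 t) m' =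
      t / ρ u * ρ u := by
    simp only [Expr.eval, Function.update_self, Function.update_of_ne hu]
    exact Nat.mod_eq_of_lt ((Nat.div_mul_le_self _ _).trans_lt (ht.trans hnM))
  refine Stmt.meets_store (c := 56) (by rw [hi]; exact Fin.is_lt _)
    (by simp only [Expr.cost]; omega) ⟨h1.update (by simp) _, fun s hs => ?_⟩
  rw [Function.update_self, hi]
  rcases Nat.lt_succ_iff_lt_or_eq.1 hs with hs | hs
  · rw [Function.update_of_ne, h2 s hs]
    intro h
    have := (a.key π).symm.injective (Fin.ext h)
    simp [this] at hs
  · obtain rfl : s = ⟨t, ht⟩ := Fin.ext hs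
    rw [Function.update_self, Expr.cast_ite, hdiv, hv, sumBelow_precedes π a hq]
    by_cases hlt : t / ρ u * ρ u < t
    · have hs : (Expr.sub (.var 3) (.lit 1)).eval n M (Function.update ρ 3 t) m' = t - 1 := by
        rw [Expr.eval_sub] <;> simp [Expr.eval] <;> omega
      have hi' := Expr.eval_get (k := a.sorted) ⟨t - 1, by omega⟩ hs
      rw [hm'.sorted] at hi'
      rw [if_pos hlt, dif_pos hlt, Expr.cast_add, Expr.eval_get _ hi', Expr.eval_get _ hi',
        h2 _ (by simp; omega), h1 src (by simpa using hsd), hsrc]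
    · rw [if_neg hlt, dif_neg hlt]
      simp [Expr.eval]

/-! ### Accumulation -/

/-- Adds a multiple of the value of an expression to the accumulator, which is the first entry of
array `3`, or subtracts it. -/
def Stmt.bump (c : Bool × ℕ) (e : Expr) : Stmt :=
  .store 3 (.lit 0) (if c.1 then .add (.get 3 (.lit 0)) (.mul (.lit c.2) e)
    else .sub (.get 3 (.lit 0)) (.mul (.lit c.2) e))

/-- The signed multiple. -/
def coeff (M : ℕ) (c : Bool × ℕ) : ZMod M := if c.1 then (c.2 % 64 : ℕ) else -(c.2 % 64 : ℕ)

theorem Stmt.meets_bump {n M : ℕ} {ρ : Env} {m : Arrays} {c : Bool × ℕ} {e : Expr} {ce : ℕ}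
    (hn : 0 < n) (hM : 0 < M) (hc : e.cost n M ρ m ≤ ce) :
    (Stmt.bump c e).Meets n M ρ m (ce + 23) fun m' => Keeps {3} m m' ∧
      (m' 3 0 : ZMod M) = (m 3 0 : ZMod M) + coeff M c * (e.eval n M ρ m : ZMod M) := by
  have h0 : (Expr.lit 0).eval n M ρ m = 0 := rfl
  have hg : (Expr.get 3 (.lit 0)).eval n M ρ m = m 3 0 := Expr.eval_get ⟨0, hn⟩ h0
  have hmul : (Expr.mul (.lit c.2) e).eval n M ρ m ≤ M := (Nat.mod_lt _ hM).le
  refine Stmt.meets_store (c := ce + 17) (by rw [h0]; exact hn) ?_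
    ⟨(Keeps.refl _ _).update (by simp) _, ?_⟩
  · split_ifs <;> simp only [Expr.cost] <;> omega
  · rw [Function.update_self, h0, Function.update_self]
    unfold coeff
    split_ifs
    · rw [Expr.cast_add, hg, Expr.cast_mul]
      rfl
    · rw [Expr.cast_sub _ _ hmul, hg, Expr.cast_mul, neg_mul, sub_eq_add_neg]
      rfl

/-- The variable `0` holds `n`, the variable `1` holds the length `B` of the blocks. -/
structure Setting (n M B : ℕ) (ρ : Env) : Prop where
  size : ρ 0 = n
  block : ρ 1 = B
  pos : 0 < n
  block_pos : 0 < B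
  block_le : B ≤ n
  lt : 2 * n + 1 < M

theorem Setting.update {n M B : ℕ} {ρ : Env} (h : Setting n M B ρ) {v : Fin 8} (x : ℕ)
    (hv : 1 < v) : Setting n M B (Function.update ρ v x) where
  size := by rw [Function.update_of_ne (by rintro rfl; exact absurd hv (by decide)), h.size]
  block := by rw [Function.update_of_ne (by rintro rfl; exact absurd hv (by decide)), h.block]
  pos := h.pos
  block_pos := h.block_pos
  block_le := h.block_le
  lt := h.lt

theorem precedes_size {n : ℕ} (π : Equiv.Perm (Fin n)) (a : Axis) (p p' : Fin n) :
    precedes π a n p p' ↔ a.key π p < a.key π p' := by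
  simp [precedes, Nat.div_eq_of_lt]

theorem sum_block {n : ℕ} {K : Type*} [AddCommMonoid K] {B : ℕ} (hB : 0 < B) (k : ℕ)
    (g : Fin n → K) : ∑ t ∈ Finset.range B, (if h : k * B + t < n then g ⟨k * B + t, h⟩ else 0) =
      ∑ z : Fin n, if (z : ℕ) / B = k then g z else 0 := by
  set F : ℕ → K := fun i => if h : i < n then g ⟨i, h⟩ else 0 with hF
  have h1 : ∑ t ∈ Finset.range B, F (k * B + t) = ∑ i ∈ Finset.Ico (k * B) (k * B + B), F i := by
    rw [Finset.sum_Ico_eq_sum_range]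
    simp
  have h2 : (∑ z : Fin n, if (z : ℕ) / B = k then g z else 0) =
      ∑ i ∈ Finset.range n with i / B = k, F i := by
    rw [Finset.sum_filter, Finset.sum_fin_eq_sum_range]
    refine Finset.sum_congr rfl fun i hi => ?_
    simp [hF, Finset.mem_range.1 hi]
  refine h1.trans (h2.trans (Finset.sum_subset (fun i hi => ?_) fun i _ hi' => ?_)).symm
  · simp only [Finset.mem_filter, Finset.mem_range, Finset.mem_Ico] at hi ⊢
    rw [← hi.2]
    have := Nat.div_mul_le_self i B
    have := Nat.lt_div_mul_add (a := i) hB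
    omega
  · rename_i hi
    simp only [Finset.mem_filter, Finset.mem_range, Finset.mem_Ico] at hi hi'
    refine dif_neg fun h => hi' ⟨h, ?_⟩
    rw [Nat.div_eq_iff hB]
    omega

/-- The relations between points that occur in the counting formulas. -/
inductive Rel
  | all | pos | val | both | eq

/-- The relation between points with positions `x`, `x'` and values `y`, `y'`. -/
def Rel.test : Rel → ℕ → ℕ → ℕ → ℕ → Bool
  | .all, _, _, _, _ => true
  | .pos, x, x', _, _ => Nat.blt x x'
  | .val, _, _, y, y' => Nat.blt y y'
  | .both, x, x', y, y' => Nat.blt x x' && Nat.blt y y'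
  | .eq, x, x', _, _ => Nat.beq x x'

def Rel.holds {n : ℕ} (π : Equiv.Perm (Fin n)) (r : Rel) (p p' : Fin n) : Prop :=
  r.test p p' (π p) (π p') = true

instance {n : ℕ} (π : Equiv.Perm (Fin n)) (r : Rel) (p p' : Fin n) :
    Decidable (r.holds π p p') := instDecidableEqBool _ _

/-- The part of the sum over the dominated points that comes from the same block of values. -/
def Expr.near (src : Fin 16) : Expr :=
  .sum 4 (.var 1) (.ite (.add (.mul (.div (.get 0 (.var 3)) (.var 1)) (.var 1)) (.var 4))
    (.get 0 (.var 3))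
    (.ite (.get 1 (.add (.mul (.div (.get 0 (.var 3)) (.var 1)) (.var 1)) (.var 4))) (.var 3)
      (.get src (.get 1 (.add (.mul (.div (.get 0 (.var 3)) (.var 1)) (.var 1)) (.var 4))))
      (.lit 0)) (.lit 0))

/-- Stores in `dst` the sums of `src` over the dominated points. -/
def Stmt.dominance (src dst : Fin 16) : Stmt :=
  .seq (.fill 3 dst (.near src)) (.loop 2 (.add (.div (.var 0) (.var 1)) (.lit 1))
    (.seq (.fill 3 8 (.ite (.div (.get 0 (.var 3)) (.var 1)) (.var 2) (.get src (.var 3)) (.lit 0)))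
      (.seq (.scan .pos 0 8 9) (.fill 3 dst (.add (.get dst (.var 3))
        (.ite (.div (.get 0 (.var 3)) (.var 1)) (.var 2) (.lit 0)
          (.ite (.var 2) (.div (.get 0 (.var 3)) (.var 1)) (.lit 0) (.get 9 (.var 3)))))))))

section Dominance

variable {n M B : ℕ} {ρ : Env} {m : Arrays} {π : Equiv.Perm (Fin n)} {src dst : Fin 16}
  {f : Fin n → ZMod M}

theorem Expr.eval_var_self {v : Fin 8} {x : ℕ} :
    (Expr.var v).eval n M (Function.update ρ v x) m = x := by simp [Expr.eval]

theorem Expr.eval_key (hm : Ready π m) (a : Axis) {v : Fin 8} (p : Fin n) (hv : ρ v = p) :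
    (Expr.get a.keys (.var v)).eval n M ρ m = a.key π p := by
  rw [Expr.eval_get p (by exact hv), hm.keys]

theorem Expr.near_spec (hS : Setting n M B ρ) (hm : Ready π m) (hsrc : Holds M m src f)
    (p : Fin n) :
    ((Expr.near src).eval n M (Function.update ρ 3 p) m : ZMod M) =
      ∑ p', if p' < p ∧ π p' < π p ∧ (π p' : ℕ) / B = π p / B then f p' else 0 := by
  have hlt := hS.lt
  have hB := hS.block_pos
  set g : Fin n → ZMod M := fun z => if z < π p ∧ π.symm z < p then f (π.symm z) else 0 with hg
  unfold Expr.near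
  rw [Expr.cast_sum, show (Expr.var 1).eval n M (Function.update ρ 3 p) m = B from
    (hS.update p (by decide)).block]
  have hsum := sum_block hB ((π p : ℕ) / B) g
  rw [show (∑ z : Fin n, if (z : ℕ) / B = (π p : ℕ) / B then g z else 0) =
      ∑ p', if p' < p ∧ π p' < π p ∧ (π p' : ℕ) / B = π p / B then f p' else 0 by
    rw [← Equiv.sum_comp π]
    refine Finset.sum_congr rfl fun p' _ => ?_
    simp only [hg, Equiv.symm_apply_apply]
    rw [← ite_and]
    exact if_congr (by tauto) rfl rfl] at hsum
  rw [← hsum]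
  refine Finset.sum_congr rfl fun t ht => ?_
  have ht := Finset.mem_range.1 ht
  set ρ' := Function.update (Function.update ρ 3 (p : ℕ)) 4 t with hρ'
  have hS' : Setting n M B ρ' := (hS.update p (by decide)).update t (by decide)
  have hv3 : ρ' 3 = p := by simp [hρ']
  have hv4 : ρ' 4 = t := by simp [hρ']
  have hy : (Expr.get 0 (.var 3)).eval n M ρ' m = π p := Expr.eval_key hm .val p hv3
  have hle := Nat.div_mul_le_self (π p : ℕ) B
  have hpn := (π p).2
  have hbase : (Expr.mul (.div (.get 0 (.var 3)) (.var 1)) (.var 1)).eval n M ρ' m =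
      (π p : ℕ) / B * B := by
    have : (Expr.div (.get 0 (.var 3)) (.var 1)).eval n M ρ' m = (π p : ℕ) / B := by
      rw [Expr.eval, hy, Expr.eval, hS'.block]
    rw [Expr.eval, this, Expr.eval, hS'.block, Nat.mod_eq_of_lt (by omega)]
  have hBn := hS.block_le
  have hidx : (Expr.add (.mul (.div (.get 0 (.var 3)) (.var 1)) (.var 1)) (.var 4)).eval n M ρ' m =
      (π p : ℕ) / B * B + t := by
    rw [Expr.eval, hbase, Expr.eval, hv4, Nat.mod_eq_of_lt (by omega)]
  rw [Expr.cast_ite, hidx, hy]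
  by_cases h : (π p : ℕ) / B * B + t < n
  · rw [dif_pos h]
    have hq : (Expr.get 1 (.add (.mul (.div (.get 0 (.var 3)) (.var 1)) (.var 1))
        (.var 4))).eval n M ρ' m = π.symm ⟨_, h⟩ := by
      rw [Expr.eval_get ⟨_, h⟩ hidx, hm.inv]
    rw [Expr.cast_ite, hq, Expr.eval_get _ hq, hsrc, show (Expr.var 3).eval n M ρ' m = p from hv3]
    simp only [hg, ite_and, Fin.lt_def]
    simp [Expr.eval]
  · rw [dif_neg h, if_neg (by omega)]
    simp [Expr.eval]

theorem Expr.near_cost (hS : Setting n M B ρ) :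
    (Expr.near src).cost n M ρ m ≤ 90 * B + 8 := by
  refine (Expr.cost_sum_le (c := 82) (ce := 1) (N := B) (by exact hS.block) le_rfl fun i _ => ?_).trans (by omega)
  simp only [Expr.cost]
  omega

theorem Stmt.meets_scan_size (hS : Setting n M B ρ) (hm : Ready π m) (a : Axis)
    (hsrc : Holds M m src f) (hdst : 2 < dst) (hsd : src ≠ dst) :
    (Stmt.scan a 0 src dst).Meets n M ρ m (66 * n + 6) fun m' => Keeps {dst} m m' ∧
      Holds M m' dst (sumBelow (fun p p' => a.key π p < a.key π p') f) := by
  have hlt := hS.lt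
  refine (Stmt.meets_scan (by omega) hS.size (by decide) (by rw [hS.size]; exact hS.pos) hm hsrc
    hdst hsd).mono le_rfl fun m' h => ⟨h.1, fun p => ?_⟩
  rw [h.2 p]
  simp only [sumBelow, hS.size, precedes_size]

theorem Stmt.meets_fill_vec (hS : Setting n M B ρ) {c : ℕ} {k : Fin 16} {e : Expr}
    (g : Fin n → ZMod M)
    (h : ∀ p : Fin n, ∀ m', Keeps {k} m m' → m' k p = m k p →
      (e.eval n M (Function.update ρ 3 p) m' : ZMod M) = g p ∧
        e.cost n M (Function.update ρ 3 p) m' ≤ c) :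
    (Stmt.fill 3 k e).Meets n M ρ m (n * (c + 11) + 6)
      fun m' => Keeps {k} m m' ∧ Holds M m' k g :=
  (Stmt.meets_fill hS.size (fun i x => ∀ hi : i < n, (x : ZMod M) = g ⟨i, hi⟩)
    fun i hi m' h1 h2 => ⟨fun _ => (h ⟨i, hi⟩ m' h1 h2).1, (h ⟨i, hi⟩ m' h1 h2).2⟩).mono le_rfl
    fun _ h => ⟨h.1, fun p => h.2 p p.2 p.2⟩

theorem Ready.congr_work {m' : Arrays} {T : Finset (Fin 16)} (hm : Ready π m) (h : Keeps T m m')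
    (hT : ∀ k ∈ T, 2 < k) : Ready π m' :=
  hm.congr h (fun h => absurd (hT _ h) (by decide)) (fun h => absurd (hT _ h) (by decide))
    (fun h => absurd (hT _ h) (by decide))

theorem Stmt.meets_dominance (hS : Setting n M B ρ) (hm : Ready π m) (hsrc : Holds M m src f)
    (hs : src < 8) (hsd : src ≠ dst) (hd : 2 < dst) (hd' : dst < 8) :
    (Stmt.dominance src dst).Meets n M ρ m (n * (90 * B + 19) + 6 + (8 + (n / B + 1) *
      (n * 31 + 6 + (66 * n + 6 + (n * 51 + 6)) + 4) + 5)) fun m' =>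
      Keeps {8, 9, dst} m m' ∧ Holds M m' dst (sumBelow (fun p p' => p < p' ∧ π p < π p') f) := by
  have hlt := hS.lt
  have hB := hS.block_pos
  set near : Fin n → ZMod M := fun p =>
    ∑ p', if p' < p ∧ π p' < π p ∧ (π p' : ℕ) / B = π p / B then f p' else 0 with hnear
  set far : ℕ → Fin n → ZMod M := fun j p =>
    ∑ p', if p' < p then (if (π p' : ℕ) / B < j then f p' else 0) else 0 with hfar
  have hT : ∀ k ∈ ({8, 9, dst} : Finset (Fin 16)), 2 < k := by
    simp only [Finset.mem_insert, Finset.mem_singleton]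
    rintro k (rfl | rfl | rfl)
    exacts [by decide, by decide, hd]
  have hsT : src ∉ ({8, 9, dst} : Finset (Fin 16)) := by
    simp only [Finset.mem_insert, Finset.mem_singleton]
    omega
  have hdT : dst ∉ ({8} : Finset (Fin 16)) ∧ dst ∉ ({9} : Finset (Fin 16)) := by
    simp only [Finset.mem_singleton]
    omega
  have hkey : ∀ (ρ' : Env) (m' : Arrays) (p : Fin n), Setting n M B ρ' → Ready π m' → ρ' 3 = p →
      (Expr.div (.get 0 (.var 3)) (.var 1)).eval n M ρ' m' = (π p : ℕ) / B := by
    intro ρ' m' p hS' hm' h3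
    have : (Expr.get 0 (.var 3)).eval n M ρ' m' = π p := Expr.eval_key hm' .val p h3
    rw [Expr.eval, this, Expr.eval, hS'.block]
  refine Stmt.Meets.seq (Stmt.meets_fill_vec (c := 90 * B + 8) hS near (fun p m' h _ => ⟨?_, ?_⟩)) ?_
  · exact Expr.near_spec hS (hm.congr_work h (by simpa using hd)) (hsrc.congr h (by simpa using hsd)) p
  · exact Expr.near_cost (hS.update p (by decide))
  rintro m₁ ⟨hk₁, hv₁⟩
  refine (Stmt.meets_loop (n / B + 1) 8 (fun j m' => Keeps {8, 9, dst} m m' ∧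
    Holds M m' dst fun p => near p + ∑ i ∈ Finset.range j,
      if (π p : ℕ) / B = i then far i p else 0) ?_ ?_ ⟨hk₁.mono (by simp), by simpa using hv₁⟩
    ?_).mono le_rfl fun m' h => ⟨h.1, fun p => ?_⟩
  · have : n / B ≤ n := Nat.div_le_self _ _
    simp only [Expr.eval, hS.size, hS.block]
    exact Nat.mod_eq_of_lt (by omega)
  · simp [Expr.cost]
  · rintro j hj m₂ ⟨hk₂, hv₂⟩
    have hS₂ := hS.update (v := 2) j (by decide)
    have h2 : ∀ p : Fin n, Function.update (Function.update ρ 2 j) 3 (p : ℕ) 2 = j := by simp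
    have hm₂ := hm.congr_work hk₂ hT
    refine Stmt.Meets.seq (Stmt.meets_fill_vec (c := 20) hS₂
      (fun p => if (π p : ℕ) / B < j then f p else 0) fun p m' h _ => ⟨?_, ?_⟩) ?_
    · rw [Expr.cast_ite, hkey _ _ p (hS₂.update p (by decide)) (hm₂.congr_work h (by decide))
        (by simp), Expr.eval_get p Expr.eval_var_self, h src (by simp; omega), hk₂ src hsT, hsrc,
        show (Expr.var 2).eval n M (Function.update (Function.update ρ 2 j) 3 (p : ℕ)) m' = j from h2 p]
      simp [Expr.eval]
    · simp [Expr.cost]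
    rintro m₃ ⟨hk₃, hv₃⟩
    have hm₃ := hm₂.congr_work hk₃ (by decide)
    refine Stmt.Meets.seq (Stmt.meets_scan_size hS₂ hm₃ .pos hv₃ (by decide) (by decide)) ?_
    rintro m₄ ⟨hk₄, hv₄⟩
    have hm₄ := hm₃.congr_work hk₄ (by decide)
    have hk24 : Keeps {8, 9, dst} m m₄ :=
      (hk₂.trans hk₃ subset_rfl (by simp)).trans hk₄ subset_rfl (by simp)
    refine (Stmt.meets_fill_vec (c := 40) hS₂ (fun p => near p + ∑ i ∈ Finset.range (j + 1),
      if (π p : ℕ) / B = i then far i p else 0) fun p m' h hp => ⟨?_, ?_⟩).mono le_rfl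
        fun m' h => ⟨hk24.trans h.1 subset_rfl (by simp), h.2⟩
    · have hm' := hm₄.congr_work h (by simpa using hd)
      have hdst : (m' dst p : ZMod M) = near p + ∑ i ∈ Finset.range j,
          if (π p : ℕ) / B = i then far i p else 0 := by
        rw [hp, hk₄ _ hdT.2, hk₃ _ hdT.1, hv₂]
      rw [Expr.cast_add, Expr.cast_ite, Expr.cast_ite, Expr.eval_get p Expr.eval_var_self, hdst,
        hkey _ _ p (hS₂.update p (by decide)) hm' (by simp), Expr.eval_get p Expr.eval_var_self,
        show (Expr.var 2).eval n M (Function.update (Function.update ρ 2 j) 3 (p : ℕ)) m' = j from h2 p, h 9 (by simp; omega), hv₄,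
        Finset.sum_range_succ, add_assoc]
      congr 2
      rcases lt_trichotomy ((π p : ℕ) / B) j with h | h | h
      · simp [h, h.ne, Expr.eval]
      · simp [h, hfar, sumBelow, Axis.key]
        rfl
      · simp [h, h.ne', h.not_gt, Expr.eval]
    · simp [Expr.cost]
  · have hp : (π p : ℕ) / B < n / B + 1 :=
      Nat.lt_succ_of_le (Nat.div_le_div_right (π p).2.le)
    refine (h.2 p).trans ?_
    beta_reduce
    rw [Finset.sum_ite_eq, if_pos (Finset.mem_range.2 hp), ← Finset.sum_add_distrib]
    refine Finset.sum_congr rfl fun p' _ => ?_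
    have hdiv : ∀ a b : ℕ, a / B < b / B → a < b := fun a b h =>
      lt_of_not_ge fun h' => absurd (Nat.div_le_div_right (c := B) h') (not_le.2 h)
    have hdiv' : π p' < π p → (π p' : ℕ) / B ≤ (π p : ℕ) / B := fun h => Nat.div_le_div_right h.le
    by_cases h1 : p' < p <;> by_cases h2 : π p' < π p
    · rcases (hdiv' h2).lt_or_eq with h3 | h3
      · simp [h1, h2, h3, h3.ne]
      · simp [h1, h2, h3]
    · have : ¬ (π p' : ℕ) / B < π p / B := fun h => h2 (hdiv _ _ h)
      simp [h1, h2, this]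
    · simp [h1]
    · simp [h1]

end Dominance

/-- The order of magnitude of the running time. -/
def timeBound (n B : ℕ) : ℕ := n * (n / B + 1) + n * B * B

theorem le_timeBound (n B : ℕ) : n ≤ timeBound n B :=
  (Nat.le_mul_of_pos_right n (Nat.succ_pos _)).trans (Nat.le_add_right _ _)

theorem mul_blocks_le {n B : ℕ} (hn : 0 < n) (c d : ℕ) :
    (n / B + 1) * (c * n + d) ≤ (c + d) * (n * (n / B + 1)) := by
  have : d * (n / B + 1) ≤ d * (n * (n / B + 1)) :=
    Nat.mul_le_mul_left d (Nat.le_mul_of_pos_left _ hn)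
  nlinarith

/-- Stores in `dst` the sums of `src` over the points that are related by `r`. -/
def Stmt.relSum : Rel → Fin 16 → Fin 16 → Stmt
  | .all, src, dst => .seq (.store 8 (.lit 0) (.sum 3 (.var 0) (.get src (.var 3))))
      (.fill 3 dst (.get 8 (.lit 0)))
  | .pos, src, dst => .scan .pos 0 src dst
  | .val, src, dst => .scan .val 0 src dst
  | .both, src, dst => .dominance src dst
  | .eq, src, dst => .fill 3 dst (.get src (.var 3))

section

variable {n M B : ℕ} {ρ : Env} {m : Arrays} {π : Equiv.Perm (Fin n)} {src dst : Fin 16}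
  {f : Fin n → ZMod M}

theorem Expr.cast_sum_vec {v : Fin 8} {b : Expr} {g : Fin n → ZMod M} (h0 : ρ 0 = n)
    (h : ∀ p : Fin n, (b.eval n M (Function.update ρ v p) m : ZMod M) = g p) :
    ((Expr.sum v (.var 0) b).eval n M ρ m : ZMod M) = ∑ p, g p := by
  rw [Expr.cast_sum, show (Expr.var 0).eval n M ρ m = n from h0, Finset.sum_range]
  exact Finset.sum_congr rfl fun p _ => h p

theorem sumBelow_congr {K : Type*} [AddCommMonoid K] {r r' : Fin n → Fin n → Prop}
    [∀ p p', Decidable (r p p')] [∀ p p', Decidable (r' p p')] (h : ∀ p p', r p p' ↔ r' p p')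
    (f : Fin n → K) : sumBelow r f = sumBelow r' f := by
  funext p
  exact Finset.sum_congr rfl fun p' _ => if_congr (h _ _) rfl rfl

theorem Stmt.meets_relSum (hS : Setting n M B ρ) (hm : Ready π m) (r : Rel) (hsrc : Holds M m src f)
    (hs : src < 8) (hsd : src ≠ dst) (hd : 2 < dst) (hd' : dst < 8) :
    (Stmt.relSum r src dst).Meets n M ρ m (300 * timeBound n B) fun m' =>
      Keeps {8, 9, dst} m m' ∧ Holds M m' dst (sumBelow (r.holds π) f) := by
  have hn := hS.pos
  have hL := le_timeBound n B
  cases r with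
  | all =>
    refine (Stmt.Meets.seq (c := 14 * n + 15) (c' := n * (6 + 11) + 6)
      (Q := fun m' => Keeps {8} m m' ∧ (m' 8 0 : ZMod M) = ∑ p, f p) ?_ ?_).mono (by omega)
      fun _ => id
    · refine (Stmt.meets_store (c := 14 * n + 9) (by exact hn) ?_
        ⟨(Keeps.refl _ _).update (by simp) _, ?_⟩).mono le_rfl fun _ => id
      · have := Expr.cost_sum_le (n := n) (M := M) (ρ := ρ) (m := m) (v := 3) (e := .var 0) (c := 6)
          (ce := 1) (N := n) (b := .get src (.var 3)) (by exact hS.size) le_rfl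
          fun i _ => by simp [Expr.cost]
        simp only [Expr.cost] at this ⊢
        omega
      · rw [Function.update_self, show (Expr.lit 0).eval n M ρ m = 0 from rfl, Function.update_self]
        exact Expr.cast_sum_vec hS.size fun p => by
          rw [Expr.eval_get p Expr.eval_var_self, hsrc]
    · rintro m₁ ⟨hk₁, hv₁⟩
      refine (Stmt.meets_fill_vec hS (fun _ => ∑ p, f p) fun p m' h _ => ⟨?_, ?_⟩).mono le_rfl
        fun m' h => ⟨hk₁.trans h.1 (by simp) (by simp), fun p => (h.2 p).trans ?_⟩
      · rw [Expr.eval_get ⟨0, hn⟩ rfl, h 8 (by simp; omega)]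
        exact hv₁
      · simp [Expr.cost]
      · simp [sumBelow, Rel.holds, Rel.test]
  | pos =>
    refine (Stmt.meets_scan_size hS hm .pos hsrc hd hsd).mono (by omega)
      fun m' h => ⟨h.1.mono (by simp), ?_⟩
    rw [sumBelow_congr (r' := fun p p' => (Axis.pos).key π p < (Axis.pos).key π p')]
    · exact h.2
    · intro p p'
      simp [Rel.holds, Rel.test, Axis.key]
  | val =>
    refine (Stmt.meets_scan_size hS hm .val hsrc hd hsd).mono (by omega)
      fun m' h => ⟨h.1.mono (by simp), ?_⟩
    rw [sumBelow_congr (r' := fun p p' => (Axis.val).key π p < (Axis.val).key π p')]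
    · exact h.2
    · intro p p'
      simp [Rel.holds, Rel.test, Axis.key]
  | both =>
    refine (Stmt.meets_dominance hS hm hsrc hs hsd hd hd').mono ?_ fun m' h => ⟨h.1, ?_⟩
    · have h1 := mul_blocks_le (n := n) (B := B) hn 148 22
      have h2 : n * B ≤ n * B * B := Nat.le_mul_of_pos_right _ hS.block_pos
      have h3 : (n / B + 1) * (n * 31 + 6 + (66 * n + 6 + (n * 51 + 6)) + 4) =
        (n / B + 1) * (148 * n + 22) := by ring
      rw [h3]
      have h4 : n * (90 * B + 19) = 90 * (n * B) + 19 * n := by ring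
      simp only [timeBound] at hL ⊢
      omega
    · rw [sumBelow_congr (r' := fun p p' => p < p' ∧ π p < π p')]
      · exact h.2
      · intro p p'
        simp [Rel.holds, Rel.test]
  | eq =>
    refine (Stmt.meets_fill_vec (c := 6) hS f fun p m' h hp => ⟨?_, ?_⟩).mono (by omega)
      fun m' h => ⟨h.1.mono (by simp), fun p => (h.2 p).trans ?_⟩
    · rw [Expr.eval_get p Expr.eval_var_self, h src (by simpa using hsd), hsrc]
    · simp [Expr.cost]
    · simp [sumBelow, Rel.holds, Rel.test, Fin.val_inj]

/-- Adds a multiple of the sum of the array `7` to the accumulator. -/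
def Stmt.bumpSum (c : Bool × ℕ) : Stmt := .bump c (.sum 3 (.var 0) (.get 7 (.var 3)))

theorem Stmt.meets_bumpSum (hS : Setting n M B ρ) {c : Bool × ℕ} (hf : Holds M m 7 f) :
    (Stmt.bumpSum c).Meets n M ρ m (14 * n + 31) fun m' => Keeps {3} m m' ∧
      (m' 3 0 : ZMod M) = (m 3 0 : ZMod M) + coeff M c * ∑ p, f p := by
  have hlt := hS.lt
  refine (Stmt.meets_bump (ce := 14 * n + 8) hS.pos (by omega) ?_).mono le_rfl
    fun m' h => ⟨h.1, ?_⟩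
  · exact (Expr.cost_sum_le (c := 6) (ce := 1) (N := n) (by exact hS.size) le_rfl
      fun i _ => by simp [Expr.cost]).trans (by omega)
  · rw [h.2, Expr.cast_sum_vec (g := f) hS.size fun p => by
      rw [Expr.eval_get p Expr.eval_var_self, hf]]

/-- Adds a multiple of the number of quadruples whose consecutive points are related to the
accumulator. -/
def Stmt.chain (c : Bool × ℕ) (r₁ r₂ r₃ : Rel) : Stmt :=
  .seq (.fill 3 4 (.lit 1)) (.seq (.relSum r₁ 4 5) (.seq (.relSum r₂ 5 6) (.seq (.relSum r₃ 6 7)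
    (.bumpSum c))))

/-- Adds a multiple of the number of quadruples in which the third point is related to the other
points to the accumulator. -/
def Stmt.star (c : Bool × ℕ) (r₁ r₂ r₃ : Rel) : Stmt :=
  .seq (.fill 3 4 (.lit 1)) (.seq (.relSum r₁ 4 5) (.seq (.relSum r₂ 4 6)
    (.seq (.fill 3 4 (.mul (.get 5 (.var 3)) (.get 6 (.var 3)))) (.seq (.relSum r₃ 4 7)
      (.bumpSum c)))))

/-- The arrays of intermediate results. -/
def scratch : Finset (Fin 16) := {4, 5, 6, 7, 8, 9}

theorem Keeps.step {T T' : Finset (Fin 16)} {m m' m'' : Arrays} (h : Keeps T' m m')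
    (h' : Keeps T m' m'') (hT : T ⊆ T') : Keeps T' m m'' := h.trans h' subset_rfl hT

/-- The arrays besides the input arrays. -/
def work : Finset (Fin 16) := {3, 4, 5, 6, 7, 8, 9}

theorem meets_ones (hS : Setting n M B ρ) :
    (Stmt.fill 3 4 (.lit 1)).Meets n M ρ m (12 * n + 6)
      fun m' => Keeps {4} m m' ∧ Holds M m' 4 fun _ : Fin n => 1 :=
  (Stmt.meets_fill_vec (c := 1) hS (fun _ => 1) fun p m' _ _ => by
    simp [Expr.eval, Expr.cost]).mono (by omega) fun _ => id

theorem Stmt.meets_chain (hS : Setting n M B ρ) (hm : Ready π m) (c : Bool × ℕ) (r₁ r₂ r₃ : Rel) :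
    (Stmt.chain c r₁ r₂ r₃).Meets n M ρ m (1000 * timeBound n B) fun m' =>
      Keeps work m m' ∧ (m' 3 0 : ZMod M) = (m 3 0 : ZMod M) + coeff M c *
        ∑ p, sumBelow (r₃.holds π) (sumBelow (r₂.holds π) (sumBelow (r₁.holds π) fun _ => 1)) p := by
  have hn := hS.pos
  have hL := le_timeBound n B
  refine Stmt.Meets.mono (c := 12 * n + 6 + (300 * timeBound n B + (300 * timeBound n B +
    (300 * timeBound n B + (14 * n + 31))))) (Stmt.Meets.seq (meets_ones hS) ?_) (by omega)
    fun _ => id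
  · rintro m₁ ⟨hk₁, hv₁⟩
    have hm₁ := hm.congr_work hk₁ (by decide)
    refine Stmt.Meets.seq (Stmt.meets_relSum hS hm₁ r₁ hv₁ (by decide) (by decide) (by decide)
      (by decide)) ?_
    rintro m₂ ⟨hk₂, hv₂⟩
    have hm₂ := hm₁.congr_work hk₂ (by decide)
    refine Stmt.Meets.seq (Stmt.meets_relSum hS hm₂ r₂ hv₂ (by decide) (by decide) (by decide)
      (by decide)) ?_
    rintro m₃ ⟨hk₃, hv₃⟩
    have hm₃ := hm₂.congr_work hk₃ (by decide)
    refine Stmt.Meets.seq (Stmt.meets_relSum hS hm₃ r₃ hv₃ (by decide) (by decide) (by decide)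
      (by decide)) ?_
    rintro m₄ ⟨hk₄, hv₄⟩
    have hk : Keeps scratch m m₄ := (((hk₁.mono (by decide)).step hk₂ (by decide)).step hk₃
      (by decide)).step hk₄ (by decide)
    refine (Stmt.meets_bumpSum hS hv₄).mono le_rfl fun m' h => ⟨hk.trans h.1 (by decide) (by decide),
      ?_⟩
    rw [h.2, hk 3 (by decide)]

theorem Stmt.meets_star (hS : Setting n M B ρ) (hm : Ready π m) (c : Bool × ℕ) (r₁ r₂ r₃ : Rel) :
    (Stmt.star c r₁ r₂ r₃).Meets n M ρ m (1100 * timeBound n B) fun m' =>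
      Keeps work m m' ∧ (m' 3 0 : ZMod M) = (m 3 0 : ZMod M) + coeff M c *
        ∑ p, sumBelow (r₃.holds π) (fun p => sumBelow (r₁.holds π) (fun _ => 1) p *
          sumBelow (r₂.holds π) (fun _ => 1) p) p := by
  have hn := hS.pos
  have hL := le_timeBound n B
  refine Stmt.Meets.mono (c := 12 * n + 6 + (300 * timeBound n B + (300 * timeBound n B +
    (n * (16 + 11) + 6 + (300 * timeBound n B + (14 * n + 31)))))) (Stmt.Meets.seq (meets_ones hS) ?_)
    (by omega) fun _ => id
  · rintro m₁ ⟨hk₁, hv₁⟩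
    have hm₁ := hm.congr_work hk₁ (by decide)
    refine Stmt.Meets.seq (Stmt.meets_relSum hS hm₁ r₁ hv₁ (by decide) (by decide) (by decide)
      (by decide)) ?_
    rintro m₂ ⟨hk₂, hv₂⟩
    have hm₂ := hm₁.congr_work hk₂ (by decide)
    refine Stmt.Meets.seq (Stmt.meets_relSum hS hm₂ r₂ (hv₁.congr hk₂ (by decide)) (by decide)
      (by decide) (by decide) (by decide)) ?_
    rintro m₃ ⟨hk₃, hv₃⟩
    have hm₃ := hm₂.congr_work hk₃ (by decide)
    have hv₂' := hv₂.congr hk₃ (by decide)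
    refine Stmt.Meets.seq (Stmt.meets_fill_vec (c := 16) hS (fun p => sumBelow (r₁.holds π)
      (fun _ => 1) p * sumBelow (r₂.holds π) (fun _ => 1) p) fun p m' h _ => ⟨?_, ?_⟩) ?_
    · rw [Expr.cast_mul, Expr.eval_get p Expr.eval_var_self, Expr.eval_get p Expr.eval_var_self,
        hv₂'.congr h (by decide) p, hv₃.congr h (by decide) p]
    · simp [Expr.cost]
    rintro m₄ ⟨hk₄, hv₄⟩
    have hm₄ := hm₃.congr_work hk₄ (by decide)
    refine Stmt.Meets.seq (Stmt.meets_relSum hS hm₄ r₃ hv₄ (by decide) (by decide) (by decide)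
      (by decide)) ?_
    rintro m₅ ⟨hk₅, hv₅⟩
    have hk : Keeps scratch m m₅ := ((((hk₁.mono (by decide)).step hk₂ (by decide)).step hk₃
      (by decide)).step hk₄ (by decide)).step hk₅ (by decide)
    refine (Stmt.meets_bumpSum hS hv₅).mono le_rfl fun m' h => ⟨hk.trans h.1 (by decide) (by decide),
      ?_⟩
    rw [h.2, hk 3 (by decide)]

end

/-- The indicator of a proposition. -/
def ind (K : Type*) [Zero K] [One K] (P : Prop) [Decidable P] : K := if P then 1 else 0

theorem ite_zero_eq_ind_mul {K : Type*} [Semiring K] (P : Prop) [Decidable P] (x : K) :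
    (if P then x else 0) = ind K P * x := by
  unfold ind
  split_ifs <;> simp

theorem ind_mul_ind {K : Type*} [Semiring K] (P Q : Prop) [Decidable P] [Decidable Q] :
    ind K P * ind K Q = ind K (P ∧ Q) := by
  unfold ind
  by_cases hP : P <;> by_cases hQ : Q <;> simp [hP, hQ]

section Quadruples

variable {K : Type*}

theorem sum_pi_four {α : Type*} [Fintype α] [AddCommMonoid K] (F : α → α → α → α → K) :
    ∑ t : Fin 4 → α, F (t 0) (t 1) (t 2) (t 3) = ∑ a, ∑ b, ∑ c, ∑ d, F a b c d := by
  have h : ∀ (k : ℕ) (G : (Fin (k + 1) → α) → K),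
      ∑ t, G t = ∑ a, ∑ t : Fin k → α, G (Fin.cons a t) := fun k G => by
    rw [← Equiv.sum_comp (Fin.consEquiv fun _ => α), Fintype.sum_prod_type]
    rfl
  simp only [h]
  refine Finset.sum_congr rfl fun a _ => Finset.sum_congr rfl fun b _ =>
    Finset.sum_congr rfl fun c _ => Finset.sum_congr rfl fun d _ => ?_
  rw [Fintype.sum_unique]
  rfl

theorem sum_four {α : Type*} [Fintype α] [AddCommMonoid K] (e : Equiv.Perm (Fin 4))
    (F : α → α → α → α → K) : ∑ a, ∑ b, ∑ c, ∑ d, F a b c d =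
      ∑ t : Fin 4 → α, F (t (e 0)) (t (e 1)) (t (e 2)) (t (e 3)) := by
  rw [← sum_pi_four, ← Equiv.sum_comp (e.symm.arrowCongr (Equiv.refl α))]
  simp [Equiv.arrowCongr]

variable [CommSemiring K] {n : ℕ} (r₁ r₂ r₃ : Fin n → Fin n → Prop) [∀ p p', Decidable (r₁ p p')]
  [∀ p p', Decidable (r₂ p p')] [∀ p p', Decidable (r₃ p p')]

theorem sum_mul_chain (v w : Fin n → K) :
    ∑ p, v p * sumBelow r₃ (sumBelow r₂ (sumBelow r₁ w)) p = ∑ t : Fin 4 → Fin n,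
      v (t 3) * w (t 0) * ind K (r₁ (t 0) (t 1) ∧ r₂ (t 1) (t 2) ∧ r₃ (t 2) (t 3)) := by
  simp only [sumBelow, ite_zero_eq_ind_mul, Finset.mul_sum]
  rw [sum_four Fin.revPerm]
  refine Finset.sum_congr rfl fun t _ => ?_
  simp only [← ind_mul_ind]
  rw [show Fin.revPerm (0 : Fin 4) = 3 from rfl, show Fin.revPerm (1 : Fin 4) = 2 from rfl,
    show Fin.revPerm (2 : Fin 4) = 1 from rfl, show Fin.revPerm (3 : Fin 4) = 0 from rfl]
  ring

theorem sum_chain : ∑ p, sumBelow r₃ (sumBelow r₂ (sumBelow r₁ fun _ => (1 : K))) p =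
    ∑ t : Fin 4 → Fin n, ind K (r₁ (t 0) (t 1) ∧ r₂ (t 1) (t 2) ∧ r₃ (t 2) (t 3)) := by
  simpa using sum_mul_chain r₁ r₂ r₃ (fun _ => (1 : K)) fun _ => 1

theorem sum_star : ∑ p, sumBelow r₃ (fun p => sumBelow r₁ (fun _ => (1 : K)) p *
    sumBelow r₂ (fun _ => 1) p) p =
      ∑ t : Fin 4 → Fin n, ind K (r₁ (t 0) (t 2) ∧ r₂ (t 1) (t 2) ∧ r₃ (t 2) (t 3)) := by
  simp only [sumBelow, ite_zero_eq_ind_mul, Finset.mul_sum, Finset.sum_mul]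
  rw [sum_four Fin.revPerm]
  refine Finset.sum_congr rfl fun t _ => ?_
  simp only [← ind_mul_ind]
  rw [show Fin.revPerm (0 : Fin 4) = 3 from rfl, show Fin.revPerm (1 : Fin 4) = 2 from rfl,
    show Fin.revPerm (2 : Fin 4) = 1 from rfl, show Fin.revPerm (3 : Fin 4) = 0 from rfl]
  ring

end Quadruples

/-! ### Counting cyclic patterns -/

/-- Adds a multiple of the number of quadruples whose consecutive points are related in the
coordinates `a`, `b`, `a`, and whose ends lie in decreasing blocks of the coordinate `b`, to
the accumulator. -/
def Stmt.cut (c : Bool × ℕ) (a b : Axis) (u u' : Fin 8) : Stmt :=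
  .loop 2 (.add (.div (.var 0) (.var 1)) (.lit 1))
    (.seq (.fill 3 4 (.ite (.div (.get b.keys (.var 3)) (.var 1)) (.var 2) (.lit 0)
      (.ite (.var 2) (.div (.get b.keys (.var 3)) (.var 1)) (.lit 0) (.lit 1))))
    (.seq (.scan a u 4 5) (.seq (.scan b u' 5 6) (.seq (.scan a u 6 7)
      (.seq (.fill 3 7 (.ite (.div (.get b.keys (.var 3)) (.var 1)) (.var 2) (.get 7 (.var 3))
        (.lit 0))) (.bumpSum c))))))

section Cut

variable {n M B : ℕ} {ρ : Env} {m : Arrays} {π : Equiv.Perm (Fin n)}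

theorem Stmt.meets_cut (hS : Setting n M B ρ) (hm : Ready π m) (c : Bool × ℕ) (a b : Axis)
    {u u' : Fin 8} (hu : u < 2) (hu' : u' < 2) :
    (Stmt.cut c a b u u').Meets n M ρ m (500 * timeBound n B) fun m' => Keeps work m m' ∧
      (m' 3 0 : ZMod M) = (m 3 0 : ZMod M) + coeff M c * ∑ t : Fin 4 → Fin n,
        ind (ZMod M) ((precedes π a (ρ u) (t 0) (t 1) ∧ precedes π b (ρ u') (t 1) (t 2) ∧
          precedes π a (ρ u) (t 2) (t 3)) ∧ (b.key π (t 3) : ℕ) / B < b.key π (t 0) / B) := by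
  have hlt := hS.lt
  have hn := hS.pos
  have hpos : ∀ v : Fin 8, v < 2 → 0 < ρ v := by
    intro v hv
    obtain rfl | rfl : v = 0 ∨ v = 1 := by omega
    · rw [hS.size]; exact hn
    · rw [hS.block]; exact hS.block_pos
  set low : ℕ → Fin n → ZMod M := fun j p => if (b.key π p : ℕ) / B < j then
    sumBelow (precedes π a (ρ u)) (sumBelow (precedes π b (ρ u')) (sumBelow (precedes π a (ρ u))
      fun p => if (b.key π p : ℕ) / B = j then 1 else 0)) p else 0 with hlow
  set term : ℕ → ZMod M := fun j => ∑ p, low j p with hterm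
  refine (Stmt.meets_loop (c := n * (33 + 11) + 6 + (66 * n + 6 + (66 * n + 6 + (66 * n + 6 +
    (n * (19 + 11) + 6 + (14 * n + 31)))))) (n / B + 1) 8 (fun j m' => Keeps work m m' ∧
      (m' 3 0 : ZMod M) = (m 3 0 : ZMod M) + coeff M c * ∑ i ∈ Finset.range j, term i)
      ?_ ?_ ⟨Keeps.refl _ _, by simp⟩ ?_).mono ?_ fun m' h => ⟨h.1, ?_⟩
  · have : n / B ≤ n := Nat.div_le_self _ _
    simp only [Expr.eval, hS.size, hS.block]
    exact Nat.mod_eq_of_lt (by omega)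
  · simp [Expr.cost]
  · rintro j hj m₀ ⟨hk₀, hv₀⟩
    have hS' := hS.update (v := 2) j (by decide)
    have hm₀ := hm.congr_work hk₀ (by decide)
    have h2 : ∀ (p : Fin n) (m' : Arrays),
        (Expr.var 2).eval n M (Function.update (Function.update ρ 2 j) 3 (p : ℕ)) m' = j := by
      simp [Expr.eval]
    have hkey : ∀ (m' : Arrays) (p : Fin n), Ready π m' →
        (Expr.div (.get b.keys (.var 3)) (.var 1)).eval n M
          (Function.update (Function.update ρ 2 j) 3 (p : ℕ)) m' = (b.key π p : ℕ) / B := by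
      intro m' p hm'
      rw [Expr.eval, Expr.eval_key hm' b p (by simp), Expr.eval,
        (hS'.update (v := 3) p (by decide)).block]
    have hρ : ∀ v : Fin 8, v < 2 → Function.update ρ 2 j v = ρ v := fun v hv =>
      Function.update_of_ne hv.ne _ _
    have hscan : ∀ (x : Axis) {v : Fin 8} {src dst : Fin 16} {m' : Arrays} {f : Fin n → ZMod M},
        v < 2 → Ready π m' → Holds M m' src f → 2 < dst → src ≠ dst →
        (Stmt.scan x v src dst).Meets n M (Function.update ρ 2 j) m' (66 * n + 6) fun m'' =>
          Keeps {dst} m' m'' ∧ Holds M m'' dst (sumBelow (precedes π x (ρ v)) f) := by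
      intro x v src dst m' f hv hm' hf hd hsd
      have := Stmt.meets_scan (a := x) (u := v) (by omega) hS'.size (by omega)
        (by rw [hρ v hv]; exact hpos v hv) hm' hf hd hsd
      rwa [hρ v hv] at this
    refine Stmt.Meets.seq (Stmt.meets_fill_vec hS'
      (fun p => if (b.key π p : ℕ) / B = j then 1 else 0) fun p m' h _ => ⟨?_, ?_⟩) ?_
    · rw [Expr.cast_ite, Expr.cast_ite, hkey _ _ (hm₀.congr_work h (by decide)), h2]
      rcases lt_trichotomy ((b.key π p : ℕ) / B) j with h | h | h
      · simp [h, h.ne, Expr.eval]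
      · simp [h, Expr.eval]
      · simp [h, h.ne', h.not_gt, Expr.eval]
    · simp [Expr.cost]
    rintro m₁ ⟨hk₁, hv₁⟩
    have hm₁ := hm₀.congr_work hk₁ (by decide)
    refine Stmt.Meets.seq (hscan a hu hm₁ hv₁ (by decide) (by decide)) ?_
    rintro m₂ ⟨hk₂, hv₂⟩
    have hm₂ := hm₁.congr_work hk₂ (by decide)
    refine Stmt.Meets.seq (hscan b hu' hm₂ hv₂ (by decide) (by decide)) ?_
    rintro m₃ ⟨hk₃, hv₃⟩
    have hm₃ := hm₂.congr_work hk₃ (by decide)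
    refine Stmt.Meets.seq (hscan a hu hm₃ hv₃ (by decide) (by decide)) ?_
    rintro m₄ ⟨hk₄, hv₄⟩
    have hm₄ := hm₃.congr_work hk₄ (by decide)
    refine Stmt.Meets.seq (Stmt.meets_fill_vec hS' (low j) fun p m' h hp => ⟨?_, ?_⟩) ?_
    · rw [Expr.cast_ite, hkey _ _ (hm₄.congr_work h (by decide)), h2, Expr.eval_get p
        Expr.eval_var_self, hp, hv₄, show (Expr.lit 0).eval n M _ m' = 0 from rfl, Nat.cast_zero]
    · simp [Expr.cost]
    rintro m₅ ⟨hk₅, hv₅⟩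
    have hk : Keeps scratch m₀ m₅ := ((((hk₁.mono (by decide)).step hk₂ (by decide)).step hk₃
      (by decide)).step hk₄ (by decide)).step hk₅ (by decide)
    refine (Stmt.meets_bumpSum hS' hv₅).mono le_rfl fun m' h => ⟨hk₀.trans (hk.trans h.1
      (T'' := work) (by decide) (by decide)) (by decide) (by decide), ?_⟩
    rw [h.2, hk 3 (by decide), hv₀, Finset.sum_range_succ, mul_add, add_assoc]
  · have h1 := mul_blocks_le (n := n) (B := B) hn 286 65
    have hL := le_timeBound n B
    have h3 : (n / B + 1) * (n * (33 + 11) + 6 + (66 * n + 6 + (66 * n + 6 + (66 * n + 6 +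
      (n * (19 + 11) + 6 + (14 * n + 31))))) + 4) = (n / B + 1) * (286 * n + 65) := by ring
    rw [h3]
    simp only [timeBound] at hL ⊢
    omega
  · rw [h.2]
    congr 2
    have hterm' : ∀ i, term i = ∑ t : Fin 4 → Fin n, ind (ZMod M) ((b.key π (t 3) : ℕ) / B < i) *
        ind (ZMod M) ((b.key π (t 0) : ℕ) / B = i) * ind (ZMod M) (precedes π a (ρ u) (t 0) (t 1) ∧
          precedes π b (ρ u') (t 1) (t 2) ∧ precedes π a (ρ u) (t 2) (t 3)) := by
      intro i
      rw [hterm, hlow]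
      simp only [ite_zero_eq_ind_mul]
      exact (sum_mul_chain _ _ _ _ _).trans (by simp)
    simp only [hterm']
    rw [Finset.sum_comm]
    refine Finset.sum_congr rfl fun t _ => ?_
    have hp : (b.key π (t 0) : ℕ) / B < n / B + 1 :=
      Nat.lt_succ_of_le (Nat.div_le_div_right (b.key π (t 0)).2.le)
    rw [← Finset.sum_mul, Finset.sum_eq_single_of_mem _ (Finset.mem_range.2 hp),
      ← ind_mul_ind (_ ∧ _), mul_comm]
    · congr 1
      simp [ind]
    · intro i _ hi
      simp [ind, hi.symm]

/-- The number `v` of the entries in the block of `e`. -/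
def Expr.inBlock (e : Expr) (v : Fin 8) : Expr := .add (.mul (.div e (.var 1)) (.var 1)) (.var v)

theorem Expr.eval_inBlock (hS : Setting n M B ρ) {e : Expr} {v : Fin 8} {x : Fin n} {t : ℕ}
    (he : e.eval n M ρ m = x) (hv : ρ v = t) (ht : t < B) :
    (e.inBlock v).eval n M ρ m = x / B * B + t := by
  have hlt := hS.lt
  have hle := Nat.div_mul_le_self (x : ℕ) B
  have hx := x.2
  have hB := hS.block_le
  have hd : (Expr.div e (.var 1)).eval n M ρ m = (x : ℕ) / B := by
    rw [Expr.eval, he, Expr.eval, hS.block]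
  have hmul : (Expr.mul (.div e (.var 1)) (.var 1)).eval n M ρ m = (x : ℕ) / B * B := by
    rw [Expr.eval, hd, Expr.eval, hS.block, Nat.mod_eq_of_lt (by omega)]
  rw [Expr.inBlock, Expr.eval, hmul, Expr.eval, hv, Nat.mod_eq_of_lt (by omega)]

theorem Expr.cast_sum_block (hS : Setting n M B ρ) {e : Expr} {v : Fin 8} (k : ℕ)
    (g : Fin n → ZMod M) (h : ∀ t < B, (e.eval n M (Function.update ρ v t) m : ZMod M) =
      if h : k * B + t < n then g ⟨k * B + t, h⟩ else 0) :
    ((Expr.sum v (.var 1) e).eval n M ρ m : ZMod M) =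
      ∑ z : Fin n, if (z : ℕ) / B = k then g z else 0 := by
  rw [Expr.cast_sum, show (Expr.var 1).eval n M ρ m = B from hS.block, ← sum_block hS.block_pos]
  exact Finset.sum_congr rfl fun t ht => h t (Finset.mem_range.1 ht)

/-- The sum of the array `5` over the points that follow the point `e` in the same block. -/
def Expr.above (e : Expr) : Expr :=
  .sum 4 (.var 1) (.ite e (e.inBlock 4) (.get 5 (e.inBlock 4)) (.lit 0))

theorem Expr.cast_above (hS : Setting n M B ρ) {e : Expr} {c : Fin n} {f : Fin n → ZMod M}
    (he : ∀ t, e.eval n M (Function.update ρ 4 t) m = c) (hf : Holds M m 5 f) :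
    ((Expr.above e).eval n M ρ m : ZMod M) =
      ∑ d, if precedes π .pos B c d then f d else 0 := by
  rw [Expr.above, Expr.cast_sum_block hS ((c : ℕ) / B)
    fun d => if c < d then f d else 0]
  · refine Finset.sum_congr rfl fun d _ => ?_
    simp only [precedes, Axis.key, Equiv.Perm.one_apply]
    rw [← ite_and]
    exact if_congr ⟨fun h => ⟨h.2, h.1.symm⟩, fun h => ⟨h.2.symm, h.1⟩⟩ rfl rfl
  · intro t ht
    have hidx := Expr.eval_inBlock (m := m) (e := e) (v := 4) (t := t) (hS.update t (by decide)) (he t)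
      (by simp) ht
    rw [Expr.cast_ite, hidx, he]
    split_ifs with h1 h2 h3 h2 h3
    · rw [Expr.eval_get ⟨_, h2⟩ hidx, hf]
    · exact absurd h1 h3
    · rw [Expr.eval, hidx, if_neg h2, Nat.cast_zero]
    · exact absurd h3 h1
    · simp [Expr.eval]
    · simp [Expr.eval]

end Cut

/-- The entry number `v` of the block of values that contains the point that is the variable
`2`. -/
def Expr.mate (v : Fin 8) : Expr := (Expr.get 0 (.var 2)).inBlock v

/-- The sum of the array `5` over the points `d` for which some `c` lies above the point that is
the variable `2` and to the left of `d`, in the same blocks. -/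
def Expr.aboveAbove : Expr :=
  .sum 3 (.var 1) (.ite (.get 0 (.var 2)) (.mate 3) (.ite (.mate 3) (.var 0)
    (.above (.get 1 (.mate 3))) (.lit 0)) (.lit 0))

/-- Adds a multiple of the number of the cyclic quadruples within blocks to the accumulator. -/
def Stmt.inner (c : Bool × ℕ) : Stmt :=
  .seq (.fill 3 5 (.lit 0)) (.loop 2 (.var 0) (.seq (.bump c .aboveAbove)
    (.loop 3 (.var 1) (.store 5 (.get 1 (.mate 3)) (.add (.get 5 (.get 1 (.mate 3)))
      (.ite (.mate 3) (.get 0 (.var 2)) (.lit 1) (.lit 0)))))))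

section Inner

variable {n M B : ℕ} {ρ : Env} {m : Arrays} {π : Equiv.Perm (Fin n)}

theorem Expr.eval_mate (hS : Setting n M B ρ) (hm : Ready π m) {v : Fin 8} {b : Fin n} {t : ℕ}
    (hb : ρ 2 = b) (hv : ρ v = t) (ht : t < B) :
    (Expr.mate v).eval n M ρ m = (π b : ℕ) / B * B + t :=
  Expr.eval_inBlock hS (Expr.eval_key hm .val b hb) hv ht

theorem Expr.cast_aboveAbove (hS : Setting n M B ρ) (hm : Ready π m) {b : Fin n} (hb : ρ 2 = b)
    {f : Fin n → ZMod M} (hf : Holds M m 5 f) :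
    (Expr.aboveAbove.eval n M ρ m : ZMod M) = ∑ c, if precedes π .val B b c then
      ∑ d, if precedes π .pos B c d then f d else 0 else 0 := by
  set F : Fin n → ZMod M := fun c => ∑ d, if precedes π .pos B c d then f d else 0 with hF
  rw [Expr.aboveAbove, Expr.cast_sum_block hS ((π b : ℕ) / B)
    fun z => if π b < z then F (π.symm z) else 0, ← Equiv.sum_comp π]
  · refine Finset.sum_congr rfl fun c _ => ?_
    rw [Equiv.symm_apply_apply, ← ite_and]
    exact if_congr ⟨fun h => ⟨h.2, h.1.symm⟩, fun h => ⟨h.2.symm, h.1⟩⟩ rfl rfl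
  · intro t ht
    have hS' := hS.update (v := 3) t (by decide)
    have hidx := Expr.eval_mate hS' hm (v := 3) (t := t) (b := b) (by simpa using hb) (by simp) ht
    have hy : (Expr.get 0 (.var 2)).eval n M (Function.update ρ 3 t) m = π b :=
      Expr.eval_key hm .val b (by simpa using hb)
    rw [Expr.cast_ite, Expr.cast_ite, hidx, hy, 
      show (Expr.var 0).eval n M (Function.update ρ 3 t) m = n from hS'.size]
    by_cases h1 : (π b : ℕ) / B * B + t < n
    · rw [if_pos h1, dif_pos h1]
      rw [Expr.cast_above hS' (c := π.symm ⟨_, h1⟩) (fun t' => ?_) hf]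
      · simp only [Expr.eval, Nat.zero_mod, Nat.cast_zero]
        rfl
      · have hidx' := Expr.eval_mate (hS'.update (v := 4) t' (by decide)) hm (v := 3) (t := t)
          (b := b) (by simpa using hb) (by simp) ht
        rw [Expr.eval_get ⟨_, h1⟩ hidx', hm.inv]
    · rw [dif_neg h1, if_neg h1]
      simp [Expr.eval]

theorem Expr.aboveAbove_cost (hS : Setting n M B ρ) :
    Expr.aboveAbove.cost n M ρ m ≤ 300 * (B * B) := by
  have hB := hS.block_pos
  have h1 : ∀ i, (Expr.above (.get 1 (.mate 3))).cost n M (Function.update ρ 3 i) m ≤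
      1 + B * (112 + 8) + 7 := fun i =>
    Expr.cost_sum_le (by exact (hS.update (v := 3) i (by decide)).block) le_rfl fun j _ => by
      simp only [Expr.cost, Expr.inBlock, Expr.mate]
      omega
  refine (Expr.cost_sum_le (c := 80 + B * 120) (ce := 1) (N := B) (by exact hS.block) le_rfl
    fun i _ => ?_).trans ?_
  · have := h1 i
    simp only [Expr.cost, Expr.inBlock, Expr.mate] at this ⊢
    omega
  · nlinarith

theorem Stmt.meets_inner (hS : Setting n M B ρ) (hm : Ready π m) (c : Bool × ℕ) :
    (Stmt.inner c).Meets n M ρ m (500 * timeBound n B) fun m' => Keeps work m m' ∧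
      (m' 3 0 : ZMod M) = (m 3 0 : ZMod M) + coeff M c * ∑ t : Fin 4 → Fin n,
        ind (ZMod M) ((precedes π .val B (t 1) (t 2) ∧ precedes π .pos B (t 2) (t 3) ∧
          precedes π .val B (t 3) (t 0)) ∧ t 0 < t 1) := by
  have hlt := hS.lt
  have hn := hS.pos
  have hB := hS.block_pos
  set cnt : ℕ → Fin n → ZMod M := fun b d =>
    ∑ a : Fin n, ind (ZMod M) ((a : ℕ) < b ∧ precedes π .val B d a) with hcnt
  set term : Fin n → ZMod M := fun b => ∑ c, if precedes π .val B b c then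
      ∑ d, if precedes π .pos B c d then cnt b d else 0 else 0 with hterm
  refine Stmt.Meets.mono (c := n * (1 + 11) + 6 + (1 + n * (300 * (B * B) + 23 +
    (1 + B * (92 + 6 + 4) + 5) + 4) + 5)) (Stmt.Meets.seq (Stmt.meets_fill_vec hS (fun _ => 0)
      fun p m' _ _ => by simp [Expr.eval, Expr.cost]) fun m₁ h₁ => ?_) ?_ fun m' => id
  · have hk₁ := h₁.1
    refine (Stmt.meets_loop n 1 (fun b m' => Keeps work m m' ∧ Holds M m' 5 (cnt b) ∧
      (m' 3 0 : ZMod M) = (m 3 0 : ZMod M) + coeff M c * ∑ i ∈ Finset.range b,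
        if h : i < n then term ⟨i, h⟩ else 0) (by exact hS.size) le_rfl
        ⟨hk₁.mono (by decide), fun d => ?_, ?_⟩ ?_).mono le_rfl fun m' h => ⟨h.1, ?_⟩
    · rw [h₁.2 d]
      simp [hcnt, ind]
    · rw [hk₁ 3 (by decide)]
      simp
    · rintro b hb m₂ ⟨hk₂, hv₂, ha₂⟩
      have hS' := hS.update (v := 2) b (by decide)
      have hm₂ := hm.congr_work hk₂ (by decide)
      set b' : Fin n := ⟨b, hb⟩ with hb'
      refine Stmt.Meets.seq (Stmt.meets_bump hn (by omega) (Expr.aboveAbove_cost hS')) ?_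
      rintro m₃ ⟨hk₃, hv₃⟩
      rw [Expr.cast_aboveAbove hS' hm₂ (b := b') (by simp [hb']) hv₂] at hv₃
      have hm₃ := hm₂.congr_work hk₃ (by decide)
      refine (Stmt.meets_loop B 1 (fun t m' => Keeps {5} m₃ m' ∧ Holds M m' 5 fun d => cnt b d +
        ind (ZMod M) ((π d : ℕ) / B = π b' / B ∧ π d < π b' ∧ (π d : ℕ) < π b' / B * B + t))
          (by exact hS'.block) le_rfl ⟨Keeps.refl _ _, ?_⟩ ?_).mono le_rfl fun m' h =>
          ⟨(hk₂.trans hk₃ subset_rfl (by decide)).trans h.1 subset_rfl (by decide), ?_, ?_⟩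
      · intro d
        rw [hk₃ 5 (by decide), hv₂ d]
        refine (add_zero _).symm.trans (congrArg _ (if_neg ?_).symm)
        rintro ⟨h1, -, h3⟩
        rw [← h1] at h3
        have := Nat.div_mul_le_self (π d : ℕ) B
        omega
      · rintro t ht m₄ ⟨hk₄, hv₄⟩
        have hm₄ := hm₃.congr_work hk₄ (by decide)
        have hS'' := hS'.update (v := 3) t (by decide)
        have hidx := Expr.eval_mate hS'' hm₄ (v := 3) (t := t) (b := b') (by simp [hb']) (by simp) ht
        have hy : (Expr.get 0 (.var 2)).eval n M
            (Function.update (Function.update ρ 2 b) 3 t) m₄ = π b' :=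
          Expr.eval_key hm₄ .val b' (by simp [hb'])
        obtain ⟨q, hq, hq'⟩ : ∃ q : Fin n, (Expr.get 1 (.mate 3)).eval n M
            (Function.update (Function.update ρ 2 b) 3 t) m₄ = q ∧
            ((π b' : ℕ) / B * B + t < n → (π q : ℕ) = (π b' : ℕ) / B * B + t) := by
          by_cases h : (π b' : ℕ) / B * B + t < n
          · exact ⟨π.symm ⟨_, h⟩, by rw [Expr.eval_get ⟨_, h⟩ hidx, hm₄.inv], fun _ => by simp⟩
          · exact ⟨⟨0, hn⟩, by rw [Expr.eval, hidx, if_neg h], fun h' => absurd h' h⟩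
        refine Stmt.meets_store (c := 92) (by rw [hq]; exact q.2) (by
          simp only [Expr.cost, Expr.mate, Expr.inBlock]; omega)
          ⟨hk₄.update (by simp) _, fun d => ?_⟩
        have hdiv : ((π b' : ℕ) / B * B + t) / B = π b' / B := by
          rw [Nat.div_eq_iff hB]
          omega
        rw [Function.update_self, hq]
        have hyn := (π b').2
        by_cases hd : d = q
        · subst hd
          rw [Function.update_self, Expr.cast_add, Expr.eval_get d hq, hv₄, Expr.cast_ite, hidx, hy,
            add_assoc]
          congr 1
          by_cases h : (π b' : ℕ) / B * B + t < n
          · have hd := hq' h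
            rw [hd, hdiv]
            simp [ind, Expr.eval, Fin.lt_def, hd]
          · rw [if_neg (by omega), show (Expr.lit 0).eval n M _ m₄ = 0 from rfl, Nat.cast_zero,
              add_zero]
            have := (π d).2
            simp only [ind]
            exact if_congr (and_congr_right fun _ => and_congr_right fun _ => by omega) rfl rfl
        · rw [Function.update_of_ne (by simpa [Fin.val_inj] using hd), hv₄]
          refine congrArg (cnt b d + ·) ?_
          simp only [ind]
          refine if_congr (and_congr_right fun _ => and_congr_right fun _ => ?_) rfl rfl
          have h1 : (π d : ℕ) ≠ (π b' : ℕ) / B * B + t := by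
            intro h
            refine hd (π.injective (Fin.ext ?_))
            rw [h, hq' (h ▸ (π d).2)]
          omega
      · intro d
        rw [h.2 d]
        have hsplit : ∀ a : Fin n, ind (ZMod M) ((a : ℕ) < b + 1 ∧ precedes π .val B d a) =
            ind (ZMod M) ((a : ℕ) < b ∧ precedes π .val B d a) +
              if a = b' then ind (ZMod M) (precedes π .val B d b') else 0 := by
          intro a
          by_cases h : a = b'
          · subst h
            simp [ind, hb']
          · have : (a : ℕ) ≠ b := fun h' => h (Fin.ext h')
            rw [if_neg h, add_zero]
            simp only [ind]
            exact if_congr (and_congr_left fun _ => by omega) rfl rfl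
        simp only [hcnt, hsplit, Finset.sum_add_distrib, Finset.sum_ite_eq', Finset.mem_univ, if_true]
        congr 1
        simp only [ind]
        refine if_congr ⟨fun h => ⟨h.2.1, h.1⟩, fun h => ⟨h.2, h.1, ?_⟩⟩ rfl rfl
        have h2 : (π d : ℕ) / B = π b' / B := h.2
        rw [← h2]
        exact Nat.lt_div_mul_add hB
      · rw [h.1 3 (by decide), hv₃, ha₂, Finset.sum_range_succ, dif_pos hb, mul_add, add_assoc]
    · rw [h.2.2, ← Finset.sum_fin_eq_sum_range]
      congr 2
      simp only [hterm, hcnt, ite_zero_eq_ind_mul, Finset.mul_sum]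
      rw [sum_four (finRotate 4)]
      refine Finset.sum_congr rfl fun t _ => ?_
      simp only [ind_mul_ind]
      rw [show finRotate 4 0 = 1 by decide, show finRotate 4 1 = 2 by decide,
        show finRotate 4 2 = 3 by decide, show finRotate 4 3 = 0 by decide]
      simp only [ind]
      exact if_congr (by rw [Fin.lt_def]; tauto) rfl rfl
  · have hL := le_timeBound n B
    have h1 : n * B ≤ n * B * B := Nat.le_mul_of_pos_right _ hB
    have h2 : n * (300 * (B * B) + 23 + (1 + B * (92 + 6 + 4) + 5) + 4) =
      300 * (n * B * B) + 102 * (n * B) + 33 * n := by ring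
    rw [h2]
    have h3 : n ≤ n * (n / B + 1) := Nat.le_mul_of_pos_right _ (Nat.succ_pos _)
    simp only [timeBound] at hL ⊢
    omega

theorem ind_cycle (K : Type*) [Semiring K] {P₁ P₂ P₃ P₄ : Prop} [Decidable P₁] [Decidable P₂]
    [Decidable P₃] [Decidable P₄] {x y z w u v : ℕ} (h₂ : P₂ → x ≤ y) (h₂' : x < y → P₂)
    (h₃ : P₃ → z ≤ w) (h₃' : z < w → P₃) (h₄ : P₄ → u ≤ v) (h₄' : u < v → P₄) :
    ind K ((P₃ ∧ P₄ ∧ P₁) ∧ x < y) + (ind K ((P₁ ∧ (P₂ ∧ x = y) ∧ P₃) ∧ u < v) +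
      (ind K (((P₄ ∧ u = v) ∧ P₁ ∧ P₂ ∧ x = y) ∧ z < w) +
        ind K (((P₂ ∧ x = y) ∧ (P₃ ∧ z = w) ∧ P₄ ∧ u = v) ∧ P₁))) =
      ind K (P₁ ∧ P₂ ∧ P₃ ∧ P₄) := by
  have h : P₁ ∧ P₂ ∧ P₃ ∧ P₄ ↔ (P₃ ∧ P₄ ∧ P₁) ∧ x < y ∨ (P₁ ∧ (P₂ ∧ x = y) ∧ P₃) ∧ u < v ∨
      ((P₄ ∧ u = v) ∧ P₁ ∧ P₂ ∧ x = y) ∧ z < w ∨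
        ((P₂ ∧ x = y) ∧ (P₃ ∧ z = w) ∧ P₄ ∧ u = v) ∧ P₁ := by
    constructor
    · rintro ⟨p₁, p₂, p₃, p₄⟩
      rcases (h₂ p₂).lt_or_eq with h | h
      · exact .inl ⟨⟨p₃, p₄, p₁⟩, h⟩
      rcases (h₄ p₄).lt_or_eq with h' | h'
      · exact .inr (.inl ⟨⟨p₁, ⟨p₂, h⟩, p₃⟩, h'⟩)
      rcases (h₃ p₃).lt_or_eq with h'' | h''
      · exact .inr (.inr (.inl ⟨⟨⟨p₄, h'⟩, p₁, p₂, h⟩, h''⟩))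
      · exact .inr (.inr (.inr ⟨⟨⟨p₂, h⟩, ⟨p₃, h''⟩, p₄, h'⟩, p₁⟩))
    · rintro (⟨⟨p₃, p₄, p₁⟩, h⟩ | ⟨⟨p₁, ⟨p₂, h⟩, p₃⟩, h'⟩ | ⟨⟨⟨p₄, h'⟩, p₁, p₂, h⟩, h''⟩ |
        ⟨⟨⟨p₂, h⟩, ⟨p₃, h''⟩, p₄, h'⟩, p₁⟩)
      exacts [⟨p₁, h₂' h, p₃, p₄⟩, ⟨p₁, p₂, p₃, h₄' h'⟩, ⟨p₁, p₂, h₃' h'', p₄⟩, ⟨p₁, p₂, p₃, p₄⟩]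
  have hor : ∀ {P Q : Prop} [Decidable P] [Decidable Q], ¬ (P ∧ Q) → ind K P + ind K Q =
      ind K (P ∨ Q) := by
    intro P Q _ _ hPQ
    by_cases hP : P <;> by_cases hQ : Q <;> simp_all [ind]
  rw [hor (by omega), hor (by omega), hor (by omega)]
  exact if_congr h.symm rfl rfl

/-- Adds a multiple of the number of the cyclic quadruples to the accumulator. -/
def Stmt.cycle (c : Bool × ℕ) : Stmt :=
  .seq (.cut c .pos .val 0 0) (.seq (.cut c .pos .val 0 1) (.seq (.cut c .val .pos 1 0) (.inner c)))

theorem Stmt.meets_cycle (hS : Setting n M B ρ) (hm : Ready π m) (c : Bool × ℕ) :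
    (Stmt.cycle c).Meets n M ρ m (2000 * timeBound n B) fun m' => Keeps work m m' ∧
      (m' 3 0 : ZMod M) = (m 3 0 : ZMod M) + coeff M c * ∑ t : Fin 4 → Fin n,
        ind (ZMod M) (t 0 < t 1 ∧ π (t 1) < π (t 2) ∧ t 2 < t 3 ∧ π (t 3) < π (t 0)) := by
  refine Stmt.Meets.mono (c := 500 * timeBound n B + (500 * timeBound n B + (500 * timeBound n B +
    500 * timeBound n B))) (Stmt.Meets.seq (Stmt.meets_cut hS hm c .pos .val (u := 0) (u' := 0)
      (by decide) (by decide)) ?_) (by omega) fun _ => id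
  rintro m₁ ⟨hk₁, hv₁⟩
  have hm₁ := hm.congr_work hk₁ (by decide)
  refine Stmt.Meets.seq (Stmt.meets_cut hS hm₁ c .pos .val (u := 0) (u' := 1) (by decide)
    (by decide)) ?_
  rintro m₂ ⟨hk₂, hv₂⟩
  have hm₂ := hm₁.congr_work hk₂ (by decide)
  refine Stmt.Meets.seq (Stmt.meets_cut hS hm₂ c .val .pos (u := 1) (u' := 0) (by decide)
    (by decide)) ?_
  rintro m₃ ⟨hk₃, hv₃⟩
  have hm₃ := hm₂.congr_work hk₃ (by decide)
  refine (Stmt.meets_inner hS hm₃ c).mono le_rfl fun m' h => ⟨((hk₁.step hk₂ subset_rfl).step hk₃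
    subset_rfl).step h.1 subset_rfl, ?_⟩
  rw [h.2, hv₃, hv₂, hv₁, add_assoc, add_assoc, add_assoc, ← mul_add, ← mul_add, ← mul_add]
  congr 2
  have hrot : ∀ (e : Equiv.Perm (Fin 4)) (F : (Fin 4 → Fin n) → ZMod M),
      ∑ t, F t = ∑ t, F (t ∘ e) := fun e F => by
    rw [← Equiv.sum_comp (e.symm.arrowCongr (Equiv.refl (Fin n)))]
    rfl
  rw [hrot (finRotate 4 * finRotate 4), hrot (finRotate 4)⁻¹ (fun t => ind (ZMod M)
    ((precedes π .val (ρ 1) (t 0) (t 1) ∧ _) ∧ _)), ← Finset.sum_add_distrib,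
    ← Finset.sum_add_distrib, ← Finset.sum_add_distrib]
  refine Finset.sum_congr rfl fun t _ => ?_
  simp only [Function.comp_apply, show (finRotate 4 * finRotate 4) 0 = 2 by decide,
    show (finRotate 4 * finRotate 4) 1 = 3 by decide, show (finRotate 4 * finRotate 4) 2 = 0 by decide,
    show (finRotate 4 * finRotate 4) 3 = 1 by decide, show (finRotate 4)⁻¹ 0 = 3 by decide,
    show (finRotate 4)⁻¹ 1 = 0 by decide, show (finRotate 4)⁻¹ 2 = 1 by decide,
    show (finRotate 4)⁻¹ 3 = 2 by decide, hS.size, hS.block, precedes_size]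
  have hle : ∀ {x y : Fin n}, x < y → (x : ℕ) / B ≤ y / B := fun h => Nat.div_le_div_right h.le
  have hlt : ∀ {x y : Fin n}, (x : ℕ) / B < y / B → x < y := fun {x y} h =>
    lt_of_not_ge fun h' => absurd (Nat.div_le_div_right (c := B) h') (not_le.2 h)
  exact ind_cycle (ZMod M) hle hlt hle hlt hle hlt

end Inner

/-! ### Functions of the relative order of quadruples of points -/

/-- The map preserves and reflects the strict order of both coordinates on the list. -/
def SameOrder (l : List (ℕ × ℕ)) (f : ℕ × ℕ → ℕ × ℕ) : Prop :=
  ∀ p ∈ l, ∀ q ∈ l, ((f p).1 < (f q).1 ↔ p.1 < q.1) ∧ ((f p).2 < (f q).2 ↔ p.2 < q.2)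

/-- The function depends only on the relative order of the coordinates. -/
def OrderInvariant {K : Type*} (F : List (ℕ × ℕ) → K) : Prop :=
  ∀ l f, SameOrder l f → F (l.map f) = F l

/-- Replaces each entry by the number of the smaller entries. -/
def rankVector (v : List ℕ) : List ℕ := v.map fun a => v.countP fun b => Nat.blt b a

/-- Replaces each point by the numbers of the points with smaller coordinates. -/
def ranks (l : List (ℕ × ℕ)) (p : ℕ × ℕ) : ℕ × ℕ :=
  (l.countP fun q => Nat.blt q.1 p.1, l.countP fun q => Nat.blt q.2 p.2)

/-- The rank vectors of length four. -/
def rankVectors : List (List ℕ) :=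
  ([0, 1, 2, 3].flatMap fun a => [0, 1, 2, 3].flatMap fun b => [0, 1, 2, 3].flatMap fun c =>
    [0, 1, 2, 3].map fun d => [a, b, c, d]).filter fun v => rankVector v == v

/-- The relative orders of quadruples of points of a permutation, up to the order in which the
points are listed. -/
def orderTypes : List (List (ℕ × ℕ)) :=
  (rankVectors.filter fun u => u.Pairwise fun a b => Nat.ble a b).flatMap fun u =>
    (rankVectors.map fun v => u.zip v).filter fun l =>
      l.all fun p => l.all fun q => Nat.beq p.1 q.1 == Nat.beq p.2 q.2

theorem countP_lt_countP_iff {α : Type*} (l : List α) (k : α → ℕ) {a b : α} (ha : a ∈ l)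
    (hb : b ∈ l) : (l.countP fun c => Nat.blt (k c) (k a)) < l.countP (fun c => Nat.blt (k c) (k b)) ↔
      k a < k b := by
  have hlt : ∀ {a b : α}, a ∈ l → k a < k b → (l.countP fun c => Nat.blt (k c) (k a)) <
      l.countP fun c => Nat.blt (k c) (k b) := by
    intro a b ha h
    have hs : (l.filter fun c => Nat.blt (k c) (k a)).Sublist (l.filter fun c => Nat.blt (k c) (k b)) :=
      List.monotone_filter_right l fun c hc => by
        simp only [Nat.blt_eq] at hc ⊢
        omega
    simp only [List.countP_eq_length_filter]
    refine lt_of_le_of_ne hs.length_le fun h' => ?_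
    have hmem : a ∈ l.filter fun c => Nat.blt (k c) (k b) := by simp [ha, h]
    rw [← hs.eq_of_length h'] at hmem
    simp at hmem
  refine ⟨fun h => ?_, hlt ha⟩
  by_contra h'
  rcases (not_lt.1 h').lt_or_eq with h' | h'
  · exact absurd (hlt hb h') h.not_gt
  · rw [h'] at h
    exact lt_irrefl _ h

theorem sameOrder_ranks (l : List (ℕ × ℕ)) : SameOrder l (ranks l) := fun _ hp _ hq =>
  ⟨countP_lt_countP_iff l Prod.fst hp hq, countP_lt_countP_iff l Prod.snd hp hq⟩

theorem rankVector_rankVector (v : List ℕ) : rankVector (rankVector v) = rankVector v := by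
  unfold rankVector
  rw [List.map_map]
  refine List.map_congr_left fun a ha => ?_
  simp only [Function.comp_apply, List.countP_map]
  refine List.countP_congr fun b hb => ?_
  simp only [Function.comp_apply, Nat.blt_eq]
  exact countP_lt_countP_iff v id hb ha

theorem mem_rankVectors {v : List ℕ} (hv : v.length = 4) : rankVector v ∈ rankVectors := by
  refine List.mem_filter.2 ⟨?_, by simp [rankVector_rankVector]⟩
  match v, hv with
  | [a, b, c, d], _ =>
    have h : ∀ x ∈ [a, b, c, d], ([a, b, c, d].countP fun y => Nat.blt y x) ∈ [0, 1, 2, 3] := by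
      intro x hx
      have h1 : ([a, b, c, d].countP fun y => Nat.blt y x) < 4 := by
        refine lt_of_le_of_ne List.countP_le_length fun h => ?_
        have := List.countP_eq_length.1 h x hx
        simp at this
      generalize [a, b, c, d].countP _ = k at h1
      interval_cases k <;> simp
    simp only [List.mem_flatMap, List.mem_map]
    exact ⟨_, h a (by simp), _, h b (by simp), _, h c (by simp), _, h d (by simp), rfl⟩

theorem map_ranks (l : List (ℕ × ℕ)) : l.map (ranks l) =
    (rankVector (l.map Prod.fst)).zip (rankVector (l.map Prod.snd)) := by
  unfold rankVector
  rw [List.map_map, List.map_map, List.zip_map']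
  refine List.map_congr_left fun p _ => ?_
  simp [ranks, List.countP_map, Function.comp_def]

theorem natBeq_beq_natBeq (a b c d : ℕ) :
    (Nat.beq a b == Nat.beq c d) = true ↔ (a = b ↔ c = d) := by
  rw [beq_iff_eq, Bool.eq_iff_iff, Nat.beq_eq, Nat.beq_eq]

theorem mem_orderTypes {l : List (ℕ × ℕ)} (hl : l.length = 4)
    (hs : l.Pairwise fun p q => p.1 ≤ q.1) (he : ∀ p ∈ l, ∀ q ∈ l, p.1 = q.1 ↔ p.2 = q.2) :
    l.map (ranks l) ∈ orderTypes := by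
  refine List.mem_flatMap.2 ⟨rankVector (l.map Prod.fst), List.mem_filter.2
    ⟨mem_rankVectors (by simpa using hl), ?_⟩, List.mem_filter.2 ⟨List.mem_map.2
      ⟨rankVector (l.map Prod.snd), mem_rankVectors (by simpa using hl), (map_ranks l).symm⟩, ?_⟩⟩
  · simp only [decide_eq_true_eq, rankVector, List.map_map]
    rw [List.pairwise_map]
    refine hs.imp fun {p q} h => ?_
    simp only [Function.comp_apply, Nat.ble_eq]
    exact List.countP_mono_left fun x _ hx => by
      simp only [Nat.blt_eq] at hx ⊢
      omega
  · simp only [List.all_map, List.all_eq_true, Function.comp_apply, natBeq_beq_natBeq]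
    intro p hp q hq
    have h1 := sameOrder_ranks l p hp q hq
    have h2 := sameOrder_ranks l q hq p hp
    have := he p hp q hq
    omega

/-- The points of a permutation at a quadruple of positions. -/
def points {n : ℕ} (π : Equiv.Perm (Fin n)) (t : Fin 4 → Fin n) : List (ℕ × ℕ) :=
  List.ofFn fun i => ((t i : ℕ), (π (t i) : ℕ))

theorem sum_permutations {n : ℕ} {K : Type*} [CommSemiring K] (π : Equiv.Perm (Fin n))
    (F : List (ℕ × ℕ) → K) : ∑ t, ((points π t).permutations'.map F).sum =
      24 * ∑ t, F (points π t) := by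
  have h : ∀ i j k l : Fin 4, [i, j, k, l].Nodup → ∑ t : Fin 4 → Fin n, F [((t i : ℕ), (π (t i) : ℕ)),
      ((t j : ℕ), (π (t j) : ℕ)), ((t k : ℕ), (π (t k) : ℕ)), ((t l : ℕ), (π (t l) : ℕ))] =
        ∑ t, F (points π t) := by
    intro i j k l hn
    have hinj : Function.Injective ![i, j, k, l] := by
      rw [← List.nodup_ofFn]
      simpa [List.ofFn_succ] using hn
    set e : Equiv.Perm (Fin 4) := Equiv.ofBijective _ (Finite.injective_iff_bijective.1 hinj) with he
    set G : Fin n → Fin n → Fin n → Fin n → K := fun a b c d =>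
      F [((a : ℕ), (π a : ℕ)), ((b : ℕ), (π b : ℕ)), ((c : ℕ), (π c : ℕ)), ((d : ℕ), (π d : ℕ))]
    exact ((sum_four e G).symm.trans (sum_pi_four G).symm).trans
      (Finset.sum_congr rfl fun t _ => by simp [points, List.ofFn_succ, G])
  have hP : ∀ t, points π t = [((t 0 : ℕ), (π (t 0) : ℕ)), ((t 1 : ℕ), (π (t 1) : ℕ)),
      ((t 2 : ℕ), (π (t 2) : ℕ)), ((t 3 : ℕ), (π (t 3) : ℕ))] := fun t => by
    simp [points, List.ofFn_succ]
  generalize ∑ t, F (points π t) = S at h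
  simp only [hP, List.permutations', List.permutations'Aux,
    List.flatMap_cons, List.flatMap_nil, List.map_cons, List.map_nil, List.append_nil, List.cons_append,
    List.nil_append, List.sum_cons, List.sum_nil, Finset.sum_add_distrib]
  simp (discharger := decide) only [h]
  simp only [Finset.sum_const_zero]
  ring

theorem sum_points_eq_zero {n : ℕ} {F : List (ℕ × ℕ) → ℤ} (hF : OrderInvariant F)
    (h : ∀ l ∈ orderTypes, (l.permutations'.map F).sum = 0) (π : Equiv.Perm (Fin n)) :
    ∑ t, F (points π t) = 0 := by
  refine (mul_eq_zero.1 ((sum_permutations π F).symm.trans (Finset.sum_eq_zero fun t _ => ?_))).resolve_left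
    (by norm_num)
  set le : ℕ × ℕ → ℕ × ℕ → Bool := fun p q => Nat.ble p.1 q.1 with hle
  set l := (points π t).mergeSort le with hl
  have hperm : l.Perm (points π t) := List.mergeSort_perm _ _
  rw [((hperm.permutations').map F).sum_eq.symm]
  have hmem : ∀ p ∈ l, ∃ i : Fin n, p = ((i : ℕ), (π i : ℕ)) := fun p hp => by
    obtain ⟨i, rfl⟩ := List.mem_ofFn.1 (hperm.mem_iff.1 hp)
    exact ⟨t i, rfl⟩
  have hs : l.Pairwise fun p q => p.1 ≤ q.1 := by
    refine (List.pairwise_mergeSort (le := le) ?_ ?_ _).imp fun {p q} h => ?_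
    · simp only [hle, Nat.ble_eq]
      exact fun _ _ _ => le_trans
    · simp only [hle, Bool.or_eq_true, Nat.ble_eq]
      exact fun _ _ => le_total _ _
    · simpa only [hle, Nat.ble_eq] using h
  have htype := h _ (mem_orderTypes (l := l) (hperm.length_eq.trans (by simp [points])) hs
    fun p hp q hq => by
      obtain ⟨i, rfl⟩ := hmem p hp
      obtain ⟨j, rfl⟩ := hmem q hq
      simp [Fin.val_inj])
  rw [← List.map_permutations', List.map_map] at htype
  rw [← htype]
  refine congrArg List.sum (List.map_congr_left fun l' hl' => (hF l' _ fun p hp q hq => ?_).symm)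
  have hsub := (List.mem_permutations'.1 hl').mem_iff (a := p)
  exact sameOrder_ranks l p (hsub.1 hp) q ((List.mem_permutations'.1 hl').mem_iff.1 hq)

/-! ### Linear combinations of counts -/

/-- The counts of quadruples that the program combines. -/
inductive Term
  | chain (r₁ r₂ r₃ : Rel)
  | star (r₁ r₂ r₃ : Rel)
  | cycle

def Rel.testPoints (r : Rel) (p q : ℕ × ℕ) : Bool := r.test p.1 q.1 p.2 q.2

/-- The quadruples of points that are counted. -/
def Term.test : Term → List (ℕ × ℕ) → Bool
  | .chain r₁ r₂ r₃, [a, b, c, d] => r₁.testPoints a b && r₂.testPoints b c && r₃.testPoints c d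
  | .star r₁ r₂ r₃, [a, b, c, d] => r₁.testPoints a c && r₂.testPoints b c && r₃.testPoints c d
  | .cycle, [a, b, c, d] =>
    Nat.blt a.1 b.1 && Nat.blt b.2 c.2 && Nat.blt c.1 d.1 && Nat.blt d.2 a.2
  | _, _ => false

/-- The occurrences of a pattern that is given by its values. -/
def patternTest : List ℕ → List (ℕ × ℕ) → Bool
  | s, [a, b, c, d] => Nat.blt a.1 b.1 && Nat.blt b.1 c.1 && Nat.blt c.1 d.1 &&
    ([a, b, c, d].zip s).all fun u => ([a, b, c, d].zip s).all fun v =>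
      Nat.blt u.1.2 v.1.2 == Nat.blt u.2 v.2
  | _, _ => false

/-- The terms, whose counts determine the counts of all patterns of length four. -/
def terms : List Term := [
  .chain .eq .both .both, .chain .eq .pos .both, .chain .eq .val .pos, .chain .all .all .both,
  .chain .all .pos .both, .chain .all .val .both, .chain .both .eq .both, .chain .both .all .both,
  .chain .both .all .pos, .chain .both .both .all, .chain .both .both .both,
  .chain .both .both .pos, .chain .both .both .val, .chain .both .pos .all, .chain .both .pos .pos,
  .chain .both .pos .val, .chain .both .val .pos, .chain .pos .eq .val, .chain .pos .all .val,
  .chain .pos .both .eq, .chain .pos .both .both, .chain .pos .both .pos, .chain .pos .both .val,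
  .chain .pos .pos .eq, .chain .pos .pos .both, .chain .pos .pos .pos, .chain .pos .pos .val,
  .chain .pos .val .eq, .chain .pos .val .all, .chain .pos .val .both, .chain .pos .val .val,
  .chain .val .all .eq, .chain .val .both .pos, .chain .val .both .val, .chain .val .pos .eq,
  .chain .val .pos .all, .chain .val .val .all, .chain .val .val .pos, .star .both .both .both,
  .star .both .both .pos, .star .both .pos .both, .star .both .pos .pos, .star .both .val .eq,
  .star .both .val .both, .star .both .val .val, .star .pos .val .pos, .cycle]

/-- For each pattern, the coefficients of its twelvefold count. -/
def weights : List (List ℕ × List ℤ) := [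
  ([0, 1, 2, 3], [
    0, 0, 0, 0, 0, 0, 0, 0, 0, 0, 12, 0, 0, 0, 0, 0, 0, 0, 0, 0, 0, 0, 0, 0, 0, 0, 0, 0, 0, 0, 0, 0,
    0, 0, 0, 0, 0, 0, 0, 0, 0, 0, 0, 0, 0, 0, 0]),
  ([0, 1, 3, 2], [
    0, 6, 0, 0, 0, 0, -6, 0, 6, 0, -12, 6, 0, 0, 0, 0, 0, 6, -6, -6, 6, -6, -6, 6, 6, 12, 6, 0, 0,
    -6, 6, 0, 0, 0, 0, 0, 0, 0, 6, 0, -6, 6, 0, -6, 0, -6, 0]),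
  ([0, 2, 1, 3], [
    -3, 5, 6, 1, -6, 2, -8, 0, 4, 5, 0, -3, 0, -6, -4, 0, 3, 12, -4, -3, -3, -3, 0, 4, 3, 17, 12, 3,
    -2, 0, 6, -1, 3, -6, 4, -9, 8, 3, -4, -4, -2, 6, -2, 2, 4, -6, 3]),
  ([0, 2, 3, 1], [
    -3, 1, 6, -1, 0, -2, 8, 0, -4, -5, 0, -9, 12, 6, 10, -12, 3, 6, -2, 3, -9, 15, 0, 2, 3, 7, 6,
    -3, 2, 6, 0, 1, -3, -6, -4, -3, 4, -3, -2, 4, 2, -6, 8, 10, 2, 0, -3]),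
  ([0, 3, 1, 2], [
    -3, -5, -6, -1, 6, -2, 8, 0, -4, -5, 0, 3, 0, 6, 4, 0, -3, -12, 4, 3, -9, 3, 0, -4, -3, -17,
    -12, -3, 2, 0, -6, 1, -3, 6, -4, 9, -8, -3, -2, 4, 14, -6, 2, -2, -4, 6, -3]),
  ([0, 3, 2, 1], [
    3, 7, -6, 5, -18, 10, -10, 0, 2, 13, 0, 3, -12, -18, -8, 12, 3, -6, -2, 3, 15, -9, 6, -10, 9,
    -11, -6, 3, 2, -6, -12, -5, 3, 6, 8, 3, 4, 3, 4, -8, -16, 12, -10, -8, -4, 0, 3]),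
  ([1, 0, 2, 3], [
    -6, 0, 0, 0, 0, 0, 0, 0, 0, 0, -12, 0, 0, 0, 0, 0, 0, 0, 0, 0, 0, 0, 0, 0, 0, 0, 0, 0, 0, 0, 0,
    0, 0, 0, 0, 0, 0, 0, 6, 0, 0, 0, 0, 0, 0, 0, 0]),
  ([1, 0, 3, 2], [
    6, -2, 12, 2, -12, 4, -10, 0, 2, 10, 12, -6, 0, -12, -8, 0, 0, 12, -2, 6, -6, 6, 12, 2, -6, 16,
    12, -6, 8, 6, -6, -2, 6, 0, 8, -18, 10, 6, -8, -8, -4, 0, -4, 4, 2, 0, 0]),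
  ([1, 2, 0, 3], [
    3, 1, -6, -1, 6, -2, 2, 0, 2, -5, 0, -3, 0, 6, 4, 0, -3, -6, -2, -3, 9, -3, -6, 2, 3, -5, -6,
    -3, 2, -6, 0, 1, -3, 6, -4, 9, -8, -3, -2, 4, -4, 0, 2, 4, -4, 0, -3]),
  ([1, 2, 3, 0], [
    3, -7, -6, 1, 0, 2, -2, 0, -2, 5, 0, 15, -12, -6, -10, 12, -3, -12, 8, 3, 3, -9, 6, -8, -9, -19,
    -12, 3, -2, 0, -6, -1, 3, 6, 4, 3, -4, 3, -4, -4, 4, 0, -8, -4, -2, 6, 3]),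
  ([1, 3, 0, 2], [
    -3, -3, 6, 3, 6, -6, 12, 0, -12, -9, 0, -3, 0, 6, 12, 0, 3, 6, 0, -3, -3, 9, -6, 0, 3, 9, -6, 9,
    -6, 0, 18, -3, -3, -6, 0, -3, 6, -3, 0, 12, 12, -12, 6, 0, 6, 0, 3]),
  ([1, 3, 2, 0], [
    -3, -1, 0, -5, 12, -10, 10, 0, -2, -7, 0, -9, 12, 12, 8, -12, 3, 6, 2, -3, -9, 3, -6, 4, -3, 5,
    6, 3, -8, 6, 12, 5, 3, -6, -8, 3, 2, -9, 2, 2, 4, 0, 10, 8, 4, 0, -3]),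
  ([2, 0, 1, 3], [
    3, 1, -6, -1, 6, -2, 2, 0, 2, -5, 0, 9, -12, 6, 4, 0, -3, -6, -2, -3, 9, -3, -6, 2, 3, -5, -6,
    -3, 2, -6, 0, 1, -3, 6, -4, 9, -8, -3, -2, 4, 8, 0, 2, -8, -4, 0, -3]),
  ([2, 0, 3, 1], [
    -3, -3, -6, 3, 6, -6, 12, 0, -12, -9, 0, -3, 0, 6, 12, 0, 3, -6, 0, -3, -3, -3, -6, -12, 3, -15,
    -18, 9, -6, 0, 6, -3, -3, 6, 0, 9, 6, -3, 0, 12, 12, 0, 6, 0, -6, 0, 3]),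
  ([2, 1, 0, 3], [
    3, -11, 6, 5, 0, -2, 2, 0, -10, 1, 0, 3, 12, -6, -2, 0, -3, 0, 4, 3, -9, 3, 6, -4, -9, 1, 0, 3,
    2, 12, -6, -5, 3, -6, 8, -9, 4, 3, 4, -8, -4, 0, -4, 4, 2, 6, 3]),
  ([2, 1, 3, 0], [
    -3, 11, -12, -5, 0, 2, -2, 0, 10, 5, 0, -9, 0, 0, -4, 0, 3, -6, 2, -3, 3, 3, -6, 4, 9, -7, 6, 3,
    -8, -6, 0, 5, 3, -6, -8, 15, -10, -9, 2, 2, -8, 0, -2, -4, 4, 0, -3]),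
  ([2, 3, 0, 1], [
    6, -4, 0, -2, -6, 8, -20, 6, 4, 14, -12, 6, 0, -12, -22, 12, 0, -6, 8, 6, 6, -6, 12, -2, -12,
    -10, 6, -6, 4, 6, -18, 2, 6, 0, 4, -6, -4, 6, 8, -16, -20, 0, -14, -4, -2, 6, 0]),
  ([2, 3, 1, 0], [
    0, 0, 6, 0, 0, 0, 6, -6, 6, -6, 12, -6, 0, 6, 18, -12, -6, 6, -6, 0, -6, 6, 0, 6, 0, 12, 6, -6,
    6, 0, 0, 0, -6, 0, 0, -6, 0, 6, -6, 6, 12, 0, 6, 0, 0, -6, 0]),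
  ([3, 0, 1, 2], [
    3, -1, 6, 1, -6, 2, -2, 0, -2, 5, 0, -9, 12, -6, -4, 0, 3, 6, 2, 3, 3, 3, 6, -2, -3, 5, 6, 3,
    -2, 6, 0, -1, 3, -6, 4, -9, 8, 3, -4, -4, -8, 0, -2, 8, 4, 0, 3]),
  ([3, 0, 2, 1], [
    -3, -7, 0, -5, 12, -4, 10, 0, -2, -7, 0, 3, 0, 12, 2, 0, -3, -6, 8, -3, -9, 3, 0, 10, -9, 5, -6,
    -3, -2, 0, 6, 5, -3, -6, -8, 3, -10, -3, 2, 2, 10, -6, 4, 2, 4, 0, -3]),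
  ([3, 1, 0, 2], [
    -3, 11, -12, -5, -6, 8, -2, 0, 10, 5, 0, 3, -12, 0, -4, 0, 3, -12, 2, -3, 3, -9, 0, 4, 9, -7, 0,
    -3, -2, -6, -12, 5, -3, 6, -8, 15, -10, -3, 2, 2, -2, 6, -2, -10, -2, -6, -3]),
  ([3, 1, 2, 0], [
    3, 1, 6, 5, -6, 4, -10, 0, 2, 1, 0, 3, 0, -6, -2, 0, -3, 6, -8, 3, 3, 3, 0, -4, 3, 1, 6, -3, 8,
    0, -6, -5, -3, 6, 8, -9, 4, 9, 4, -8, -10, 6, -4, -2, -4, 0, 3]),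
  ([3, 2, 0, 1], [
    0, 6, 6, 0, 0, -6, 6, -6, 6, -6, 12, -6, 0, 6, 12, -12, 0, 18, -12, 0, -6, 6, -6, 0, 18, 12, 6,
    0, 0, -6, 18, 0, 0, 0, 0, -6, 12, 0, -6, 6, 6, 6, 12, 6, 0, -6, 0]),
  ([3, 2, 1, 0], [
    0, -6, 0, 0, 6, 0, -6, 6, -6, 0, -12, 12, 0, 0, -18, 12, 0, -6, 6, 0, 12, -12, 0, 0, -18, 6, -6,
    0, 0, 0, 0, 0, 0, 0, 0, 0, -6, 0, 0, 0, 0, -12, -6, 0, 0, 6, 0])]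

theorem weights_valid : (orderTypes.all fun l => weights.all fun r =>
    (List.zipWith (fun c T => c * (l.permutations'.countP (Term.test T) : ℤ)) r.2 terms).sum ==
      12 * (l.permutations'.countP (patternTest r.1) : ℤ)) = true := by
  decide +kernel

theorem exists_weights : ∀ σ : Equiv.Perm (Fin 4), ∃ r ∈ weights, r.1 =
    List.ofFn fun i => (σ i : ℕ) := by
  decide +kernel

theorem natAbs_weights : ∀ r ∈ weights, r.2.all fun c => c.natAbs < 64 := by
  decide +kernel

theorem SameOrder.testPoints {l : List (ℕ × ℕ)} {f : ℕ × ℕ → ℕ × ℕ} (h : SameOrder l f)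
    {p q : ℕ × ℕ} (hp : p ∈ l) (hq : q ∈ l) (r : Rel) :
    r.testPoints (f p) (f q) = r.testPoints p q := by
  have h1 := h p hp q hq
  have h2 := h q hq p hp
  rw [Bool.eq_iff_iff]
  cases r <;> simp only [Rel.testPoints, Rel.test, Bool.and_eq_true, Nat.blt_eq, Nat.beq_eq] <;> omega

theorem orderInvariant_test (T : Term) : OrderInvariant T.test := by
  intro l f h
  match l, h with
  | [a, b, c, d], h =>
    cases T with
    | chain r₁ r₂ r₃ =>
      simp only [List.map_cons, List.map_nil, Term.test]
      rw [h.testPoints (by simp) (by simp), h.testPoints (by simp) (by simp),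
        h.testPoints (by simp) (by simp)]
    | star r₁ r₂ r₃ =>
      simp only [List.map_cons, List.map_nil, Term.test]
      rw [h.testPoints (by simp) (by simp), h.testPoints (by simp) (by simp),
        h.testPoints (by simp) (by simp)]
    | cycle =>
      have h1 := (h a (by simp) b (by simp)).1
      have h2 := (h b (by simp) c (by simp)).2
      have h3 := (h c (by simp) d (by simp)).1
      have h4 := (h d (by simp) a (by simp)).2
      rw [Bool.eq_iff_iff]
      simp only [List.map_cons, List.map_nil, Term.test, Bool.and_eq_true, Nat.blt_eq, h1, h2, h3, h4]
  | [], _ => rfl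
  | [a], _ => cases T <;> rfl
  | [a, b], _ => cases T <;> rfl
  | [a, b, c], _ => cases T <;> rfl
  | a :: b :: c :: d :: e :: l, _ => cases T <;> rfl

theorem orderInvariant_patternTest (s : List ℕ) : OrderInvariant (patternTest s) := by
  intro l f h
  match l, h with
  | [a, b, c, d], h =>
    have hx : ∀ p ∈ [a, b, c, d], ∀ q ∈ [a, b, c, d],
        Nat.blt (f p).1 (f q).1 = Nat.blt p.1 q.1 := fun p hp q hq => by
      rw [Bool.eq_iff_iff, Nat.blt_eq, Nat.blt_eq, (h p hp q hq).1]
    have hy : ∀ p ∈ [a, b, c, d], ∀ q ∈ [a, b, c, d],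
        Nat.blt (f p).2 (f q).2 = Nat.blt p.2 q.2 := fun p hp q hq => by
      rw [Bool.eq_iff_iff, Nat.blt_eq, Nat.blt_eq, (h p hp q hq).2]
    rw [List.map_cons, List.map_cons, List.map_cons, List.map_cons, List.map_nil, patternTest,
      patternTest, hx a (by simp) b (by simp), hx b (by simp) c (by simp), hx c (by simp) d (by simp)]
    congr 1
    rw [show [f a, f b, f c, f d] = [a, b, c, d].map f from rfl, List.zip_map_left, List.all_map,
      Bool.eq_iff_iff, List.all_eq_true, List.all_eq_true]
    refine forall₂_congr fun u hu => ?_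
    rw [Function.comp_apply, List.all_map, List.all_eq_true, List.all_eq_true]
    refine forall₂_congr fun v hv => ?_
    simp only [Function.comp_apply, Prod.map_fst, Prod.map_snd, id]
    rw [hy _ (List.of_mem_zip hu).1 _ (List.of_mem_zip hv).1]
  | [], _ => cases s <;> rfl
  | [a], _ => cases s <;> rfl
  | [a, b], _ => cases s <;> rfl
  | [a, b, c], _ => cases s <;> rfl
  | a :: b :: c :: d :: e :: l, _ => cases s <;> rfl

/-- The linear combination of the terms. -/
def combination (L : List (ℤ × Term)) (l : List (ℕ × ℕ)) : ℤ :=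
  (L.map fun u => u.1 * if u.2.test l then 1 else 0).sum

theorem sum_map_combination (L : List (ℤ × Term)) (P : List (List (ℕ × ℕ))) :
    (P.map (combination L)).sum = (L.map fun u => u.1 * (P.countP u.2.test : ℤ)).sum := by
  induction P with
  | nil => simp
  | cons l P ih =>
    rw [List.map_cons, List.sum_cons, ih, combination, ← List.sum_map_add]
    refine congrArg List.sum (List.map_congr_left fun u _ => ?_)
    rw [List.countP_cons]
    split_ifs <;> push_cast <;> ring

theorem sum_combination {n : ℕ} {r : List ℕ × List ℤ} (hr : r ∈ weights)
    (π : Equiv.Perm (Fin n)) : ∑ t, combination (r.2.zip terms) (points π t) =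
      12 * ∑ t, if patternTest r.1 (points π t) then 1 else 0 := by
  set F : List (ℕ × ℕ) → ℤ := fun l => combination (r.2.zip terms) l -
    12 * if patternTest r.1 l then 1 else 0 with hF
  have hinv : OrderInvariant F := fun l f h => by
    simp only [hF, combination, orderInvariant_patternTest _ l f h]
    congr 2
    exact List.map_congr_left fun u _ => by rw [orderInvariant_test _ l f h]
  have := sum_points_eq_zero hinv (fun l hl => ?_) π
  · simp only [hF] at this
    rw [Finset.sum_sub_distrib, sub_eq_zero] at this
    rw [this, Finset.mul_sum]
  · have h1 := List.all_eq_true.1 (List.all_eq_true.1 weights_valid l hl) r hr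
    rw [beq_iff_eq] at h1
    have h2 : ∀ P : List (List (ℕ × ℕ)), (P.map F).sum = (P.map (combination (r.2.zip terms))).sum -
        12 * (P.countP (patternTest r.1) : ℤ) := fun P => by
      induction P with
      | nil => simp
      | cons l P ih =>
        rw [List.map_cons, List.sum_cons, ih, List.map_cons, List.sum_cons, List.countP_cons]
        simp only [hF]
        split_ifs <;> push_cast <;> ring
    rw [h2, sum_map_combination, sub_eq_zero, ← h1, List.zip, List.map_zipWith]

theorem patternCount_eq {n : ℕ} (σ : Equiv.Perm (Fin 4)) (π : Equiv.Perm (Fin n)) :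
    (patternCount σ π : ℤ) =
      ∑ t, if patternTest (List.ofFn fun i => (σ i : ℕ)) (points π t) then 1 else 0 := by
  rw [patternCount, Finset.sum_boole]
  congr 2
  refine Finset.filter_congr fun t _ => ?_
  have h1 : (∀ a b, a < b → t a < t b) ↔ (t 0 < t 1 ∧ t 1 < t 2) ∧ t 2 < t 3 := by
    refine (Fin.strictMono_iff_lt_succ (f := t)).trans ⟨fun h => ⟨⟨h 0, h 1⟩, h 2⟩, fun h i => ?_⟩
    fin_cases i
    exacts [h.1.1, h.1.2, h.2]
  rw [h1]
  have h2 : (∀ a b, π (t a) < π (t b) ↔ σ a < σ b) ↔ ∀ a b : Fin 4,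
      (Nat.blt (π (t a)) (π (t b)) == Nat.blt (σ a) (σ b)) = true := by
    refine forall₂_congr fun a b => ?_
    rw [beq_iff_eq, Bool.eq_iff_iff, Nat.blt_eq, Nat.blt_eq, Fin.lt_def, Fin.lt_def]
  rw [h2]
  have hzip : ∀ P : (ℕ × ℕ) × ℕ → Bool, ((points π t).zip (List.ofFn fun i => (σ i : ℕ))).all P = true ↔
      ∀ a, P (((t a : ℕ), (π (t a) : ℕ)), (σ a : ℕ)) = true := by
    intro P
    simp only [points, List.ofFn_succ, List.ofFn_zero, List.zip_cons_cons, List.zip_nil_left,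
      List.all_cons, List.all_nil, Bool.and_eq_true, Fin.forall_fin_succ]
    simp
  have h3 : patternTest (List.ofFn fun i => (σ i : ℕ)) (points π t) = (Nat.blt (t 0) (t 1) &&
      Nat.blt (t 1) (t 2) && Nat.blt (t 2) (t 3) &&
        ((points π t).zip (List.ofFn fun i => (σ i : ℕ))).all fun u =>
          ((points π t).zip (List.ofFn fun i => (σ i : ℕ))).all fun v =>
            Nat.blt u.1.2 v.1.2 == Nat.blt u.2 v.2) := rfl
  rw [h3, Bool.and_eq_true, Bool.and_eq_true, Bool.and_eq_true, Nat.blt_eq, Nat.blt_eq, Nat.blt_eq,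
    hzip]
  simp only [hzip]
  rfl

theorem patternCount_le {n : ℕ} (σ : Equiv.Perm (Fin 4)) (π : Equiv.Perm (Fin n)) :
    patternCount σ π ≤ n ^ 4 :=
  (Finset.card_le_univ _).trans (by simp)

/-- Adds a multiple of the number of the counted quadruples to the accumulator. -/
def Term.stmt (c : Bool × ℕ) : Term → Stmt
  | .chain r₁ r₂ r₃ => .chain c r₁ r₂ r₃
  | .star r₁ r₂ r₃ => .star c r₁ r₂ r₃
  | .cycle => .cycle c

/-- Computes a linear combination of counts in the accumulator. -/
def Stmt.combine : List (ℤ × Term) → Stmt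
  | [] => .store 3 (.lit 0) (.lit 0)
  | u :: L => .seq (Stmt.combine L) (u.2.stmt (decide (0 ≤ u.1), u.1.natAbs))

section

variable {n M B : ℕ} {ρ : Env} {m : Arrays} {π : Equiv.Perm (Fin n)}

theorem Term.meets_stmt (hS : Setting n M B ρ) (hm : Ready π m) (c : Bool × ℕ) (T : Term) :
    (T.stmt c).Meets n M ρ m (2000 * timeBound n B) fun m' => Keeps work m m' ∧
      (m' 3 0 : ZMod M) = (m 3 0 : ZMod M) + coeff M c *
        ((∑ t, if T.test (points π t) then 1 else 0 : ℤ) : ZMod M) := by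
  have hsum : ((∑ t, if T.test (points π t) then 1 else 0 : ℤ) : ZMod M) =
      ∑ t, ind (ZMod M) (T.test (points π t) = true) := by
    push_cast
    rfl
  rw [hsum]
  cases T with
  | chain r₁ r₂ r₃ =>
    refine (Stmt.meets_chain hS hm c r₁ r₂ r₃).mono (by omega) fun m' h => ⟨h.1, ?_⟩
    rw [h.2, sum_chain]
    congr 2
    refine Finset.sum_congr rfl fun t _ => if_congr ?_ rfl rfl
    simp only [points, List.ofFn_succ, List.ofFn_zero, Term.test, Bool.and_eq_true, Rel.testPoints,
      Rel.holds, and_assoc]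
    rfl
  | star r₁ r₂ r₃ =>
    refine (Stmt.meets_star hS hm c r₁ r₂ r₃).mono (by omega) fun m' h => ⟨h.1, ?_⟩
    rw [h.2, sum_star]
    congr 2
    refine Finset.sum_congr rfl fun t _ => if_congr ?_ rfl rfl
    simp only [points, List.ofFn_succ, List.ofFn_zero, Term.test, Bool.and_eq_true, Rel.testPoints,
      Rel.holds, and_assoc]
    rfl
  | cycle =>
    refine (Stmt.meets_cycle hS hm c).mono le_rfl fun m' h => ⟨h.1, ?_⟩
    rw [h.2]
    congr 2
    refine Finset.sum_congr rfl fun t _ => if_congr ?_ rfl rfl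
    simp only [points, List.ofFn_succ, List.ofFn_zero, Term.test, Bool.and_eq_true, Nat.blt_eq,
      and_assoc]
    rfl

theorem coeff_int {c : ℤ} (hc : c.natAbs < 64) :
    coeff M (decide (0 ≤ c), c.natAbs) = (c : ZMod M) := by
  rw [coeff, Nat.mod_eq_of_lt hc]
  rcases le_or_gt 0 c with h | h
  · rw [if_pos (by simpa using h)]
    conv_rhs => rw [← Int.natAbs_of_nonneg h]
    simp
  · rw [if_neg (by simpa using h)]
    conv_rhs => rw [show c = -(c.natAbs : ℤ) by omega]
    simp

theorem Stmt.meets_combine (hS : Setting n M B ρ) (hm : Ready π m) (L : List (ℤ × Term))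
    (hL : ∀ u ∈ L, u.1.natAbs < 64) :
    (Stmt.combine L).Meets n M ρ m (8 + L.length * (2000 * timeBound n B)) fun m' => Keeps work m m' ∧
      (m' 3 0 : ZMod M) = ((∑ t, combination L (points π t) : ℤ) : ZMod M) := by
  induction L with
  | nil =>
    refine (Stmt.meets_store (c := 2) (by exact hS.pos) le_rfl
      ⟨(Keeps.refl _ _).update (by decide) _, ?_⟩).mono (by simp) fun _ => id
    rw [Function.update_self, show (Expr.lit 0).eval n M ρ m = 0 from rfl, Function.update_self]
    simp [combination]
  | cons u L ih =>
    refine (Stmt.Meets.seq (ih fun v hv => hL v (by simp [hv])) fun m₁ h₁ =>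
      (Term.meets_stmt hS (hm.congr_work h₁.1 (by decide)) _ u.2).mono le_rfl fun m' h =>
        ⟨h₁.1.step h.1 subset_rfl, ?_⟩).mono ?_ fun _ => id
    · rw [List.length_cons]
      linarith
    · rw [h.2, h₁.2, coeff_int (hL u (by simp)), ← Int.cast_mul, ← Int.cast_add, Finset.mul_sum,
        ← Finset.sum_add_distrib]
      refine congrArg _ (Finset.sum_congr rfl fun t _ => ?_)
      rw [combination, combination, List.map_cons, List.sum_cons, add_comm]

/-! ### The program -/

/-- The integral part of the cube root of `n`. -/
def cubeRoot (n : ℕ) : ℕ := Nat.findGreatest (fun b => b ^ 3 ≤ n) n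

theorem cubeRoot_pow_le (n : ℕ) : cubeRoot n ^ 3 ≤ n :=
  Nat.findGreatest_spec (P := fun b => b ^ 3 ≤ n) (Nat.zero_le n) (by simp)

theorem lt_cubeRoot_pow (n : ℕ) : n < (cubeRoot n + 1) ^ 3 := by
  by_contra h
  have h1 := not_lt.1 h
  have h2 : cubeRoot n + 1 ≤ n := (Nat.le_self_pow (by norm_num) _).trans h1
  have := Nat.le_findGreatest (P := fun b => b ^ 3 ≤ n) h2 h1
  exact absurd this (Nat.not_succ_le_self _)

theorem cubeRoot_pos (hn : 0 < n) : 0 < cubeRoot n := by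
  by_contra h
  have h1 := lt_cubeRoot_pow n
  rw [Nat.eq_zero_of_not_pos h] at h1
  omega

theorem cubeRoot_le (n : ℕ) : cubeRoot n ≤ n := Nat.findGreatest_le n

/-- Computes the cube root. -/
def Expr.cubeRoot : Expr :=
  .sum 2 (.var 0) (.ite (.mul (.mul (.add (.var 2) (.lit 1)) (.add (.var 2) (.lit 1)))
    (.add (.var 2) (.lit 1))) (.add (.var 0) (.lit 1)) (.lit 1) (.lit 0))

theorem Expr.eval_cubeRoot (h0 : ρ 0 = n) (hM : n ^ 3 + n + 1 < M) :
    Expr.cubeRoot.eval n M ρ m = WordRAM.cubeRoot n := by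
  have hle := cubeRoot_le n
  have hterm : ∀ b < n, (Expr.ite (.mul (.mul (.add (.var 2) (.lit 1)) (.add (.var 2) (.lit 1)))
      (.add (.var 2) (.lit 1))) (.add (.var 0) (.lit 1)) (.lit 1) (.lit 0)).eval n M
        (Function.update ρ 2 b) m = if b < WordRAM.cubeRoot n then 1 else 0 := by
    intro b hb
    have h1 : (b + 1) ^ 3 ≤ n ^ 3 := Nat.pow_le_pow_left hb 3
    have h2 : (b + 1) * (b + 1) ≤ (b + 1) ^ 3 := by
      rw [← pow_two]
      exact Nat.pow_le_pow_right (by omega) (by norm_num)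
    have hadd : (Expr.add (.var 2) (.lit 1)).eval n M (Function.update ρ 2 b) m = b + 1 := by
      simp only [Expr.eval, Function.update_self]
      exact Nat.mod_eq_of_lt (by omega)
    have hsize : (Expr.add (.var 0) (.lit 1)).eval n M (Function.update ρ 2 b) m = n + 1 := by
      simp only [Expr.eval, Function.update_of_ne (show (0 : Fin 8) ≠ 2 by decide), h0]
      exact Nat.mod_eq_of_lt (by omega)
    have hsq : (Expr.mul (.add (.var 2) (.lit 1)) (.add (.var 2) (.lit 1))).eval n M
        (Function.update ρ 2 b) m = (b + 1) * (b + 1) := by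
      rw [Expr.eval, hadd, Nat.mod_eq_of_lt (by omega)]
    have hcube : (Expr.mul (.mul (.add (.var 2) (.lit 1)) (.add (.var 2) (.lit 1)))
        (.add (.var 2) (.lit 1))).eval n M (Function.update ρ 2 b) m = (b + 1) ^ 3 := by
      rw [Expr.eval, hsq, hadd, show (b + 1) * (b + 1) * (b + 1) = (b + 1) ^ 3 by ring,
        Nat.mod_eq_of_lt (by omega)]
    rw [Expr.eval, hcube, hsize]
    refine if_congr ?_ rfl rfl
    rw [Nat.lt_succ_iff]
    refine ⟨fun h => Nat.le_findGreatest (P := fun b => b ^ 3 ≤ n) hb h, fun h => ?_⟩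
    exact (Nat.pow_le_pow_left h 3).trans (cubeRoot_pow_le n)
  rw [Expr.cubeRoot, Expr.eval, show (Expr.var 0).eval n M ρ m = n from h0,
    Finset.sum_congr rfl fun b hb => hterm b (Finset.mem_range.1 hb), ← Finset.sum_filter,
    Finset.sum_const, smul_eq_mul, mul_one, Nat.mod_eq_of_lt]
  · rw [show (Finset.range n).filter (· < WordRAM.cubeRoot n) = Finset.range (WordRAM.cubeRoot n) by
      ext b
      simp only [Finset.mem_filter, Finset.mem_range]
      omega, Finset.card_range]
  · refine (Finset.card_filter_le _ _).trans_lt ?_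
    rw [Finset.card_range]
    omega

theorem Expr.cubeRoot_cost (h0 : ρ 0 = n) : Expr.cubeRoot.cost n M ρ m ≤ 50 * n + 8 :=
  (Expr.cost_sum_le (c := 42) (ce := 1) (by exact h0) le_rfl fun i _ => by
    simp [Expr.cost]).trans (by omega)

/-- Computes the inverse of the permutation, the identity and a linear combination of counts. -/
def Stmt.main (L : List (ℤ × Term)) : Stmt :=
  .seq (.loop 2 (.var 0) (.store 1 (.get 0 (.var 2)) (.var 2)))
    (.seq (.fill 3 2 (.var 3)) (.letv 1 .cubeRoot (.combine L)))

theorem Stmt.meets_inverse (h0 : ρ 0 = n) (hm : ∀ i : Fin n, m 0 i = π i) :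
    (Stmt.loop 2 (.var 0) (.store 1 (.get 0 (.var 2)) (.var 2))).Meets n M ρ m (17 * n + 6)
      fun m' => Keeps {1} m m' ∧ ∀ i : Fin n, m' 1 i = π.symm i := by
  refine (Stmt.meets_loop (c := 13) n 1 (fun t m' => Keeps {1} m m' ∧
    ∀ i : Fin n, (i : ℕ) < t → m' 1 (π i) = i) (by exact h0) le_rfl ⟨.refl _ _, by simp⟩ ?_).mono
      (by omega) fun m' h => ⟨h.1, fun i => by simpa using h.2 (π.symm i) (Fin.is_lt _)⟩
  rintro t ht m' ⟨h1, h2⟩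
  have hv : (Expr.var 2).eval n M (Function.update ρ 2 t) m' = t := by simp [Expr.eval]
  have hi := Expr.eval_get (k := 0) ⟨t, ht⟩ hv
  rw [h1 0 (by decide), hm] at hi
  refine Stmt.meets_store (c := 7) (by rw [hi]; exact Fin.is_lt _) (by simp [Expr.cost])
    ⟨h1.update (by simp) _, fun i hit => ?_⟩
  rw [Function.update_self, hi, hv]
  by_cases h : i = ⟨t, ht⟩
  · subst h
    rw [Function.update_self]
  · rw [Function.update_of_ne]
    · refine h2 i (lt_of_le_of_ne (Nat.lt_succ_iff.1 hit) fun h' => h (Fin.ext h'))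
    · intro h'
      exact h (π.injective (Fin.ext h'))

theorem Stmt.meets_main (hn : 0 < n) (h0 : ρ 0 = n) (hM : M = (n + 64) ^ 5)
    (hm : ∀ i : Fin n, m 0 i = π i) (L : List (ℤ × Term)) (hL : ∀ u ∈ L, u.1.natAbs < 64) :
    (Stmt.main L).Meets n M ρ m ((2000 * L.length + 200) * timeBound n (cubeRoot n)) fun m' =>
      (m' 3 0 : ZMod M) = ((∑ t, combination L (points π t) : ℤ) : ZMod M) := by
  have hM3 : (n + 64) ^ 3 ≤ M := by
    rw [hM]
    exact Nat.pow_le_pow_right (by omega) (by norm_num)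
  have hM' : n ^ 3 + n + 1 < M ∧ 2 * n + 1 < M := by
    have : (n + 64) ^ 3 = n ^ 3 + 192 * n ^ 2 + 12288 * n + 262144 := by ring
    omega
  have hT := le_timeBound n (WordRAM.cubeRoot n)
  have hcost : (2000 * L.length + 200) * timeBound n (WordRAM.cubeRoot n) =
    L.length * (2000 * timeBound n (WordRAM.cubeRoot n)) +
      200 * timeBound n (WordRAM.cubeRoot n) := by ring
  refine Stmt.Meets.mono (c := 17 * n + 6 + (n * (1 + 11) + 6 + (50 * n + 8 + (8 + L.length *
    (2000 * timeBound n (WordRAM.cubeRoot n))) + 3))) (Stmt.Meets.seq (Stmt.meets_inverse h0 hm) ?_)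
    (by rw [hcost]; omega) fun _ => id
  rintro m₁ ⟨hk₁, hv₁⟩
  refine Stmt.Meets.seq (Stmt.meets_fill h0 (fun i x => x = i) fun i _ m' _ _ =>
    ⟨by simp [Expr.eval], le_rfl⟩) ?_
  rintro m₂ ⟨hk₂, hv₂⟩
  have hready : Ready π m₂ := ⟨fun i => by rw [hk₂ 0 (by decide), hk₁ 0 (by decide), hm],
    fun i => by rw [hk₂ 1 (by decide), hv₁], fun i => hv₂ i i.2⟩
  have hS : Setting n M (WordRAM.cubeRoot n) (Function.update ρ 1 (WordRAM.cubeRoot n)) :=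
    { size := by rw [Function.update_of_ne (by decide), h0]
      block := Function.update_self ..
      pos := hn
      block_pos := cubeRoot_pos hn
      block_le := cubeRoot_le n
      lt := hM'.2 }
  refine (Stmt.Meets.letv (Expr.eval_cubeRoot h0 hM'.1) (Stmt.meets_combine hS hready L hL)).mono ?_
    fun m' h => h.2
  have := Expr.cubeRoot_cost (M := M) (m := m₂) h0
  omega

/-- A twelfth of the accumulator. -/
def Expr.result : Expr := .div (.add (.get 3 (.lit 0)) (.lit 0)) (.lit 12)

/-- The program that counts the occurrences of a pattern. -/
def countProgram (r : List ℕ × List ℤ) : Program := (Stmt.main (r.2.zip terms)).program .result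

theorem eval_result {σ : Equiv.Perm (Fin 4)} {r : List ℕ × List ℤ} (hr : r ∈ weights)
    (hσ : r.1 = List.ofFn fun i => (σ i : ℕ)) (h0 : ρ 0 = n) (hM : M = (n + 64) ^ 5)
    (hm : ∀ i : Fin n, m 0 i = π i) :
    Expr.result.eval n M ρ ((Stmt.main (r.2.zip terms)).eval n M ρ m) = patternCount σ π := by
  have hle := patternCount_le σ π
  rcases Nat.eq_zero_or_pos n with rfl | hn
  · have : patternCount σ π = 0 := by simpa using hle
    simp [this, Expr.result, Expr.eval]
  have hL : ∀ u ∈ r.2.zip terms, u.1.natAbs < 64 := fun u hu => by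
    simpa using List.all_eq_true.1 (natAbs_weights r hr) u.1 (List.of_mem_zip hu).1
  have h := (Stmt.meets_main hn h0 hM hm (r.2.zip terms) hL).1
  have hcount : 12 * patternCount σ π < M := by
    have h1 : n ^ 4 ≤ (n + 64) ^ 4 := Nat.pow_le_pow_left (by omega) 4
    have h2 : M = (n + 64) ^ 4 * (n + 64) := by rw [hM, pow_succ]
    have h3 : 0 < (n + 64) ^ 4 := by positivity
    nlinarith
  rw [sum_combination hr, hσ, ← patternCount_eq] at h
  have h' : (((Stmt.main (r.2.zip terms)).eval n M ρ m 3 0 : ℕ) : ZMod M) =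
      ((12 * patternCount σ π : ℕ) : ZMod M) := by
    rw [h]
    push_cast
    rfl
  rw [ZMod.natCast_eq_natCast_iff'] at h'
  rw [Nat.mod_eq_of_lt hcount] at h'
  simp [Expr.result, Expr.eval, hn, h']

end

theorem timeBound_cubeRoot_le {n : ℕ} (hn : 0 < n) :
    (timeBound n (cubeRoot n) : ℝ) ≤ 4 * (n : ℝ) ^ (5 / 3 : ℝ) := by
  set B := cubeRoot n with hB
  set x : ℝ := (n : ℝ) ^ (1 / 3 : ℝ) with hx
  have hn0 : (0 : ℝ) ≤ n := Nat.cast_nonneg n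
  have hn1 : (1 : ℝ) ≤ n := by exact_mod_cast hn
  have hx1 : 1 ≤ x := Real.one_le_rpow hn1 (by norm_num)
  have hx3 : x ^ 3 = n := by
    rw [hx, ← Real.rpow_natCast, ← Real.rpow_mul hn0]
    norm_num
  have hx5 : x ^ 5 = (n : ℝ) ^ (5 / 3 : ℝ) := by
    rw [hx, ← Real.rpow_natCast, ← Real.rpow_mul hn0]
    norm_num
  have hBx : (B : ℝ) ≤ x := by
    refine le_of_pow_le_pow_left₀ (n := 3) (by norm_num) (by linarith) ?_
    rw [hx3]
    exact_mod_cast cubeRoot_pow_le n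
  have hxB : x ≤ 2 * B := by
    have h1 : x ≤ B + 1 := by
      refine le_of_pow_le_pow_left₀ (n := 3) (by norm_num) (by positivity) ?_
      rw [hx3]
      exact_mod_cast (lt_cubeRoot_pow n).le
    have h2 : (1 : ℝ) ≤ B := by exact_mod_cast cubeRoot_pos hn
    linarith
  have hB0 : (0 : ℝ) < B := by exact_mod_cast cubeRoot_pos hn
  have hdiv : ((n / B : ℕ) : ℝ) ≤ 2 * x ^ 2 := by
    refine Nat.cast_div_le.trans ((div_le_iff₀ hB0).2 ?_)
    rw [← hx3]
    nlinarith [sq_nonneg x]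
  have hx2 : 1 ≤ x ^ 2 := one_le_pow₀ hx1
  have hB2 : (B : ℝ) * B ≤ x ^ 2 := by nlinarith
  rw [← hx5, timeBound]
  push_cast
  calc (n : ℝ) * (((n / B : ℕ) : ℝ) + 1) + n * B * B = n * ((((n / B : ℕ) : ℝ) + 1) + B * B) := by ring
    _ ≤ n * (4 * x ^ 2) := mul_le_mul_of_nonneg_left (by linarith) hn0
    _ = 4 * x ^ 5 := by rw [← hx3]; ring

/-- The number of bits of the words. -/
def wordLength (n : ℕ) : ℕ := 10 * (Nat.log 2 (n + 64) + 1)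

theorem lt_two_pow_wordLength (n : ℕ) :
    (n + 64) ^ 5 * (n + 64) ^ 5 < 2 ^ wordLength n := by
  rw [← pow_add, wordLength, mul_comm, pow_mul]
  exact Nat.pow_lt_pow_left (Nat.lt_pow_succ_log_self (by norm_num) _) (by norm_num)

theorem wordLength_isBigO : (fun n => (wordLength n : ℝ)) =O[atTop] fun n : ℕ => Real.log n := by
  refine IsBigO.of_bound 60 ?_
  filter_upwards [eventually_ge_atTop 64] with n hn
  have hn' : (64 : ℝ) ≤ n := by exact_mod_cast hn
  have hlog2 : (0.6 : ℝ) < Real.log 2 := by linarith [Real.log_two_gt_d9]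
  have h2 : Real.log 2 ≤ Real.log n := Real.log_le_log (by norm_num) (by linarith)
  have hlog : (Nat.log 2 (n + 64) : ℝ) * Real.log 2 ≤ 2 * Real.log n := by
    have h1 : ((2 : ℝ)) ^ Nat.log 2 (n + 64) ≤ (n : ℝ) ^ 2 := by
      have h3 : 2 ^ Nat.log 2 (n + 64) ≤ n + 64 := Nat.pow_log_le_self 2 (by omega)
      have h4 : n + 64 ≤ n ^ 2 := by
        have := Nat.mul_le_mul_right n hn
        rw [pow_two]
        omega
      exact_mod_cast h3.trans h4
    have := Real.log_le_log (by positivity) h1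
    rwa [Real.log_pow, Real.log_pow, Nat.cast_ofNat] at this
  rw [Real.norm_of_nonneg (Nat.cast_nonneg _), Real.norm_of_nonneg (by linarith), wordLength]
  push_cast
  have := mul_le_mul_of_nonneg_left hlog2.le (Nat.cast_nonneg (α := ℝ) (Nat.log 2 (n + 64)))
  linarith

/-- The worst case of the number of steps. -/
def maxCost (s : Stmt) (e : Expr) (n : ℕ) : ℕ :=
  Finset.univ.sup fun π : Equiv.Perm (Fin n) =>
    s.cost n ((n + 64) ^ 5) (Function.update 0 0 n) (inputArrays π) + e.cost n ((n + 64) ^ 5)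
      (Function.update 0 0 n) (s.eval n ((n + 64) ^ 5) (Function.update 0 0 n) (inputArrays π)) + 7

theorem inputArrays_zero {n : ℕ} (π : Equiv.Perm (Fin n)) (i : Fin n) : inputArrays π 0 i = π i := by
  simp [inputArrays]

theorem countProgram_computes {σ : Equiv.Perm (Fin 4)} {r : List ℕ × List ℤ} (hr : r ∈ weights)
    (hσ : r.1 = List.ofFn fun i => (σ i : ℕ)) :
    (countProgram r).Computes (fun _ π => patternCount σ π)
      (maxCost (.main (r.2.zip terms)) .result) (fun n => 16 * n) := by
  refine ⟨wordLength, wordLength_isBigO, fun n π => ?_⟩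
  have h := Stmt.program_outputs (.main (r.2.zip terms)) .result (M := (n + 64) ^ 5)
    (Eq.refl _) (lt_two_pow_wordLength n) π
  extract_lets ρ m' at h
  have he : Expr.result.eval n ((n + 64) ^ 5) ρ m' = patternCount σ π :=
    eval_result hr hσ (Function.update_self ..) (Eq.refl _) (inputArrays_zero π)
  rw [he] at h
  obtain ⟨t, ht, h⟩ := h
  refine ⟨t, ht.trans ?_, h⟩
  unfold maxCost
  exact Finset.le_sup (f := fun π : Equiv.Perm (Fin n) => Stmt.cost n ((n + 64) ^ 5) _ ρ
    (inputArrays π) + Expr.cost n ((n + 64) ^ 5) _ ρ (Stmt.eval n ((n + 64) ^ 5) _ ρ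
      (inputArrays π)) + 7) (Finset.mem_univ π)

theorem maxCost_main_le {n : ℕ} (hn : 0 < n) (L : List (ℤ × Term))
    (hL : ∀ u ∈ L, u.1.natAbs < 64) :
    maxCost (.main L) .result n ≤ (2000 * L.length + 300) * timeBound n (cubeRoot n) := by
  refine Finset.sup_le fun π _ => ?_
  have h := (Stmt.meets_main (ρ := Function.update 0 0 n) hn (by simp) rfl (inputArrays_zero π) L hL).2
  have hT := le_timeBound n (cubeRoot n)
  have he : ∀ m, Expr.result.cost n ((n + 64) ^ 5) (Function.update 0 0 n) m = 13 := fun m => rfl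
  rw [he]
  have : (2000 * L.length + 300) * timeBound n (cubeRoot n) =
    (2000 * L.length + 200) * timeBound n (cubeRoot n) + 100 * timeBound n (cubeRoot n) := by ring
  omega

end WordRAM

theorem theorem2 (σ : Equiv.Perm (Fin 4)) :
    ∃ (P : WordRAM.Program) (T S : ℕ → ℕ),
      IsSoftO (fun n => (T n : ℝ)) (fun n => (n : ℝ) ^ (5 / 3 : ℝ)) ∧
      IsSoftO (fun n => (S n : ℝ)) (fun n => (n : ℝ)) ∧
      P.Computes (fun _ π => patternCount σ π) T S := by
  obtain ⟨r, hr, hσ⟩ := WordRAM.exists_weights σ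
  refine ⟨_, _, _, ⟨0, ?_⟩, ⟨0, ?_⟩, WordRAM.countProgram_computes hr hσ⟩
  · simp only [pow_zero, mul_one]
    refine IsBigO.of_bound ((2000 * (r.2.zip WordRAM.terms).length + 300 : ℕ) * 4) ?_
    filter_upwards [eventually_gt_atTop 0] with n hn
    rw [Real.norm_of_nonneg (Nat.cast_nonneg _), Real.norm_of_nonneg (by positivity), mul_assoc]
    have h1 := WordRAM.maxCost_main_le hn (r.2.zip WordRAM.terms) fun u hu => by
      simpa using List.all_eq_true.1 (WordRAM.natAbs_weights r hr) u.1 (List.of_mem_zip hu).1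
    refine (Nat.cast_le.2 h1).trans ?_
    rw [Nat.cast_mul]
    exact mul_le_mul_of_nonneg_left (WordRAM.timeBound_cubeRoot_le hn) (Nat.cast_nonneg _)
  · simp only [pow_zero, mul_one]
    refine IsBigO.of_bound 16 (Eventually.of_forall fun n => ?_)
    rw [Real.norm_of_nonneg (Nat.cast_nonneg _), Real.norm_of_nonneg (Nat.cast_nonneg _)]
    push_cast
    exact le_rfl
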